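/- **Setting.** For each $k\in\mathbb N$ let $n=n_k$, $T=T_k$, $N=N_k\ge 1$ be integers with $n,N\to\infty$ and $n/N\to\gamma\in(0,\infty)$ as $k\to\infty$ (the index $k$ is suppressed below). Let $\mathbf W\in\mathbb R^{n\times n}$, $\mathbf w_{\rm in}\in\mathbb R^n$ be fixed and let $$\mathbf z=F(\mathbf u)=\sum_{t=0}^{T-1}\mathbf W^t\mathbf w_{\rm in}\,u_{T-t}=\mathbf S\mathbf u,\qquad \mathbf S=[\mathbf W^{T-1}\mathbf w_{\rm in},\dots,\mathbf W\mathbf w_{\rm in},\mathbf w_{\rm in}]\in\mathbb R^{n\times T},$$ be the feature map of the linear echo state network (ESN). The reservoir has leak factor $\varphi\in(0,1]$, meaning that $\mathbf S^\top\mathbf S=\mathrm{diag}(\varphi^{t-T})_{t=1}^T$. The teacher is $y=\boldsymbol\theta_*^\top\mathbf u+\epsilon$, where $\mathbf u\in\mathbb R^T$ is random, $\epsilon$ is independent of $\mathbf u$ with mean $0$ and variance $\sigma^2$ (the same for all $k$), and $\|\boldsymbol\theta_*\|_2$ is bounded uniformly in $k$. The features are $q$-exponentially concentrated: there are $q,C,s>0$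 independent of $k$ with $\mathbb P(|f(\mathbf z)-\mathbb E f(\mathbf z)|\ge t)\le Ce^{-(t/s)^q}$ for all $t>0$ and all $1$-Lipschitz $f:\mathbb R^n\to\mathbb R$. The student is trained on $N$ i.i.d. pairs $(\mathbf u_i,y_i)$. With $\mathbf Z=[F(\mathbf u_1),\dots,F(\mathbf u_N)]$, $\mathbf y=(y_1,\dots,y_N)^\top$ and a fixed $\lambda>0$, it uses $\hat{\mathbf w}=(\tfrac1N\mathbf Z\mathbf Z^\top+\lambda\mathbf I_n)^{-1}\tfrac1N\mathbf Z\mathbf y$ and predicts $\hat y'=\hat{\mathbf w}^\top F(\mathbf u')$ at an independent test pair $(\mathbf u',y')$. Let $$\mathcal R=\mathbb E[(\hat y'-y')^2],\quad \mathcal B^2=\mathbb E\big[(\mathbb E[\hat y'\mid \mathbf u_1,\dots,\mathbf u_N,\mathbf u']-\boldsymbol\theta_*^\top\mathbf u')^2\big],\quad \mathcal V=\mathbb E\big[(\hat y'-\mathbb E[\hat y'\mid \mathbf u_1,\dots,\mathbf u_N,\mathbf u'])^2\big].$$ Put $\mathbf\Sigma_u=\mathbb E[\mathbf u\mathbf u^\top]$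 and $\mathbf\Sigma_z=\mathbb E[\mathbf z\mathbf z^\top]$. Let $(\mu_t,\mathbf v_t)_{t=1}^T$ be eigenpairs, with orthonormal eigenvectors, of $\mathbf\Sigma_u^{1/2}\,\mathrm{diag}(\varphi^{t-T})_{t=1}^T\,\mathbf\Sigma_u^{1/2}$. **Claim.** For each $k$ the equation $$\delta=\tfrac1N\mathrm{Tr}(\mathbf\Sigma_z\bar{\mathbf Q}),\qquad \bar{\mathbf Q}=\Big(\frac{\mathbf\Sigma_z}{1+\delta}+\lambda\mathbf I_n\Big)^{-1},$$ has exactly one solution $\delta\ge0$, and it is positive if $\mathbf\Sigma_z\ne0$. With $\alpha=\tfrac1N\big\|\tfrac{\mathbf\Sigma_z}{1+\delta}\bar{\mathbf Q}\big\|_F^2$ one has $\mathcal R=\mathcal B^2+\mathcal V+\sigma^2$ for every $k$, and, as $k\to\infty$, $$\mathcal B^2-\frac{(1+\delta)^2}{1-\alpha}\sum_{t=1}^T\alpha_t\,(\boldsymbol\theta_*^\top\mathbf\Sigma_u^{1/2}\mathbf v_t)^2\to0,\qquad \mathcal V-\frac{\sigma^2}{N(1-\alpha)}\sum_{t=1}^T\beta_t\to0,$$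 where $$\alpha_t=\frac{\lambda^2}{(\mu_t+\lambda(1+\delta))^2},\qquad \beta_t=\frac{\mu_t^2}{(\mu_t+\lambda(1+\delta))^2}.$$ -/

import Mathlib

open MeasureTheory Filter Topology
open scoped Matrix MatrixOrder

namespace LinearESN

/-- Euclidean space of dimension `d`. -/
abbrev Vec (d : ℕ) : Type := EuclideanSpace ℝ (Fin d)

/-- The last state of the linear echo state network `x ← W x + w_in u_t`, started at zero and driven
by `u_1, …, u_T`: it is `∑_{t=0}^{T-1} W^t w_in u_{T-t}`.  With indices from `0`, the entry `u_{T-t}`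
is `u (Fin.rev t)`. -/
noncomputable def feature {n T : ℕ} (W : Matrix (Fin n) (Fin n) ℝ) (wIn : Fin n → ℝ) (u : Vec T) :
    Vec n :=
  WithLp.toLp 2 (∑ t : Fin T, u (Fin.rev t) • ((W ^ (t : ℕ)) *ᵥ wIn))

/-- The matrix `S = [W^{T-1} w_in, …, W w_in, w_in]` of impulse responses. -/
def responseMatrix {n : ℕ} (T : ℕ) (W : Matrix (Fin n) (Fin n) ℝ) (wIn : Fin n → ℝ) :
    Matrix (Fin n) (Fin T) ℝ :=
  Matrix.of fun i t => ((W ^ (Fin.rev t : ℕ)) *ᵥ wIn) i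

/-- The diagonal matrix `diag(φ^{t-T})_{t=1}^T`; `t : Fin T` counts from `0`. -/
noncomputable def leakMatrix (T : ℕ) (φ : ℝ) : Matrix (Fin T) (Fin T) ℝ :=
  Matrix.diagonal fun t => φ ^ ((t : ℤ) + 1 - (T : ℤ))

/-- The (uncentred) second moment matrix `E[X Xᵀ]`. -/
noncomputable def secondMoment {Ω : Type*} [MeasurableSpace Ω] {d : ℕ} (P : Measure Ω)
    (X : Ω → Vec d) : Matrix (Fin d) (Fin d) ℝ :=
  Matrix.of fun i j => ∫ ω, X ω i * X ω j ∂P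

/-- `X` is `q`-exponentially concentrated, with constants `C` and `s`. -/
def ExpConcentrated {Ω : Type*} [MeasurableSpace Ω] {d : ℕ} (P : Measure Ω) (X : Ω → Vec d)
    (q C s : ℝ) : Prop :=
  ∀ f : Vec d → ℝ, LipschitzWith 1 f → ∀ t : ℝ, 0 < t →
    P.real {ω | t ≤ |f (X ω) - ∫ ω', f (X ω') ∂P|} ≤ C * Real.exp (-(t / s) ^ q)

/-- The readout `(N⁻¹ Z Zᵀ + lam I)⁻¹ N⁻¹ Z y` of ridge regression on the features `z_1, …, z_N`,
the columns of `Z`. -/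
noncomputable def readout {n N : ℕ} (lam : ℝ) (z : Fin N → Vec n) (y : Fin N → ℝ) : Fin n → ℝ :=
  let Z : Matrix (Fin n) (Fin N) ℝ := Matrix.of fun i j => z j i
  ((1 / (N : ℝ)) • (Z * Zᵀ) + lam • (1 : Matrix (Fin n) (Fin n) ℝ))⁻¹ *ᵥ ((1 / (N : ℝ)) • (Z *ᵥ y))

/-- The teacher `y = θᵀ u + e`. -/
def teacher {T : ℕ} (θ u : Vec T) (e : ℝ) : ℝ := θ ⬝ᵥ u + e

/-- The prediction at the test input `u'` of the student with feature map `F`, trained on the inputs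
`U` with noises `e`. -/
noncomputable def prediction {T n N : ℕ} (F : Vec T → Vec n) (lam : ℝ) (θ : Vec T)
    (U : Fin N → Vec T) (e : Fin N → ℝ) (u' : Vec T) : ℝ :=
  readout lam (fun i => F (U i)) (fun i => teacher θ (U i) (e i)) ⬝ᵥ F u'

/-- The prediction averaged over the training noise, for given training and test inputs. -/
noncomputable def meanPrediction {T n N : ℕ} (F : Vec T → Vec n) (lam : ℝ) (θ : Vec T)
    (ν : Measure ℝ) (U : Fin N → Vec T) (u' : Vec T) : ℝ :=
  ∫ e, prediction F lam θ U e u' ∂(Measure.pi fun _ : Fin N => ν)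

/-- The out-of-sample risk `E[(ŷ' - y')²]`, where the inputs have law `P`, the noise has law `ν`, and
the `N` training pairs and the test pair are independent. -/
noncomputable def risk {T n : ℕ} (N : ℕ) (F : Vec T → Vec n) (lam : ℝ) (θ : Vec T)
    (P : Measure (Vec T)) (ν : Measure ℝ) : ℝ :=
  ∫ w : (Fin N → Vec T × ℝ) × (Vec T × ℝ),
    (prediction F lam θ (fun i => (w.1 i).1) (fun i => (w.1 i).2) w.2.1
      - teacher θ w.2.1 w.2.2) ^ 2
    ∂((Measure.pi fun _ : Fin N => P.prod ν).prod (P.prod ν))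

/-- The squared bias `E[(E[ŷ' | inputs] - θᵀ u')²]`. -/
noncomputable def biasSq {T n : ℕ} (N : ℕ) (F : Vec T → Vec n) (lam : ℝ) (θ : Vec T)
    (P : Measure (Vec T)) (ν : Measure ℝ) : ℝ :=
  ∫ w : (Fin N → Vec T) × Vec T,
    (meanPrediction F lam θ ν w.1 w.2 - θ ⬝ᵥ w.2) ^ 2 ∂((Measure.pi fun _ : Fin N => P).prod P)

/-- The variance `E[(ŷ' - E[ŷ' | inputs])²]`. -/
noncomputable def predVariance {T n : ℕ} (N : ℕ) (F : Vec T → Vec n) (lam : ℝ) (θ : Vec T)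
    (P : Measure (Vec T)) (ν : Measure ℝ) : ℝ :=
  ∫ w : ((Fin N → Vec T) × Vec T) × (Fin N → ℝ),
    (prediction F lam θ w.1.1 w.2 w.1.2 - meanPrediction F lam θ ν w.1.1 w.1.2) ^ 2
    ∂(((Measure.pi fun _ : Fin N => P).prod P).prod (Measure.pi fun _ : Fin N => ν))

/-- `Q̄ = (Σ_z / (1 + δ) + lam I)⁻¹`. -/
noncomputable def resolvent {n : ℕ} (lam δ : ℝ) (Sz : Matrix (Fin n) (Fin n) ℝ) :
    Matrix (Fin n) (Fin n) ℝ :=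
  ((1 / (1 + δ)) • Sz + lam • (1 : Matrix (Fin n) (Fin n) ℝ))⁻¹

/-- The fixed-point equation `δ = N⁻¹ Tr(Σ_z Q̄)`. -/
def FixedPoint {n : ℕ} (N : ℕ) (lam : ℝ) (Sz : Matrix (Fin n) (Fin n) ℝ) (δ : ℝ) : Prop :=
  δ = 1 / (N : ℝ) * (Sz * resolvent lam δ Sz).trace

/-- `α = N⁻¹ ‖Σ_z / (1 + δ) Q̄‖_F²`. -/
noncomputable def alpha {n : ℕ} (N : ℕ) (lam : ℝ) (Sz : Matrix (Fin n) (Fin n) ℝ) (δ : ℝ) : ℝ :=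
  1 / (N : ℝ) * ∑ i, ∑ j, (((1 / (1 + δ)) • Sz) * resolvent lam δ Sz) i j ^ 2

/-- `Σ_u^{1/2} diag(φ^{t-T}) Σ_u^{1/2}`. -/
noncomputable def memoryMatrix {T : ℕ} (φ : ℝ) (Su : Matrix (Fin T) (Fin T) ℝ) :
    Matrix (Fin T) (Fin T) ℝ :=
  CFC.sqrt Su * leakMatrix T φ * CFC.sqrt Su

end LinearESN

/-!
The proof compares the trained student with a deterministic equivalent, and reads the answer off the
spectrum of the memory matrix.

*Reduction.* The inputs enter only through the features `z = S u`: as `Sᵀ S` is the leak matrix, which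
is at least `1`, there is a vector `w` with `θᵀ u = wᵀ z` and `|w| ≤ |θ|` (`exists_feature_weight`).
With `Q = (N⁻¹ Z Zᵀ + lam)⁻¹`, the prediction error before noise is `-lam z'ᵀ Q w`, and the noise
enters linearly with coefficients `N⁻¹ z_jᵀ Q z'` (`prediction_eq`).  Hence the squared bias is
`lam² E (z'ᵀ Q w)²`, the variance is `σ² E[N⁻¹ (Q z')ᵀ (N⁻¹ Z Zᵀ) (Q z')]`, and the risk splits
(`biasSq_eq`, `predVariance_eq`, `risk_eq`).

*Moments.* Concentration is used only through fourth moments of centred linear forms and variances of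
squared norms `|G z|²` (`Concentrated`, `ExpConcentrated.concentrated`).  The mean of the features need
not be bounded in the dimension.  To control it, the second moment matrix is bounded along each sample
path by a multiple `L` of the sample matrix plus `lam`, where `L` has bounded moments
(`Concentrated.le_loewner`, `Concentrated.meanLE_loewner_sq`).

*Deterministic equivalents.* By leave-one-out formulas and the exact identity behind
`self_consistency`, the trace `N⁻¹ Tr(Σ_z Q)` is close in mean to `δ`
(`Concentrated.meanLE_resTrace_sub`), then `wᵀ Q w` is close in mean to `wᵀ Q̄ w`
(`Concentrated.abs_integral_quad_sub_le`), and a fresh feature sees `(1 + δ)²` times the energy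
`(Q w)ᵀ (N⁻¹ Z Zᵀ) (Q w)` seen by the training features (`Concentrated.abs_integral_test_sub_le`).

*Energies as derivatives.* Both energies are derivatives in `lam` of quantities with known
equivalents: `d/dlam (lam Q) = Q (N⁻¹ Z Zᵀ) Q`.  A difference quotient with step `η` costs an error of
order `η`, uniformly in the dimension (`ridge_expansion_bound`), so that first `N → ∞` and then
`η → 0` suffices (`tendsto_zero_of_forall_le`).

*Spectrum.* With `κ = lam (1 + δ)`, the fixed-point equation reads
`δ / (1 + δ) = N⁻¹ ∑ μ_t / (μ_t + κ)` (`fixedPoint_iff`), which gives existence and uniqueness, and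
`dκ/dlam = 1 / (1 - α)` (`abs_kappa_sub_le`).  As `lam δ = κ - lam` and
`lam wᵀ Q̄ w = |w|² - ∑ a_t² / (μ_t + κ)` with `a_t = θᵀ Σ_u^{1/2} v_t`, the derivatives are
`α / (1 - α)` and `(1 - α)⁻¹ ∑ a_t² / (μ_t + κ)²`.
-/

namespace LinearESN

/-! ### Ridge resolvents -/

section LinearAlgebra

variable {d : ℕ}

/-- The ridge resolvent `(A + lam I)⁻¹`. -/
noncomputable def ridge (lam : ℝ) (A : Matrix (Fin d) (Fin d) ℝ) : Matrix (Fin d) (Fin d) ℝ :=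
  (A + lam • (1 : Matrix (Fin d) (Fin d) ℝ))⁻¹

lemma psd_nonneg {A : Matrix (Fin d) (Fin d) ℝ} (hA : A.PosSemidef) (v : Fin d → ℝ) : 0 ≤ v ⬝ᵥ A *ᵥ v := by
  simpa using hA.dotProduct_mulVec_nonneg v

lemma psd_transpose {A : Matrix (Fin d) (Fin d) ℝ} (hA : A.PosSemidef) : Aᵀ = A := by
  simpa using hA.isHermitian.eq

lemma psd_of_nonneg {A : Matrix (Fin d) (Fin d) ℝ} (hs : Aᵀ = A) (h : ∀ v, 0 ≤ v ⬝ᵥ A *ᵥ v) :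
    A.PosSemidef :=
  Matrix.PosSemidef.of_dotProduct_mulVec_nonneg (by simpa [Matrix.IsHermitian] using hs)
    (by simpa using h)

lemma mulVec_dot {A : Matrix (Fin d) (Fin d) ℝ} (hA : Aᵀ = A) (v w : Fin d → ℝ) :
    (A *ᵥ v) ⬝ᵥ w = v ⬝ᵥ A *ᵥ w := by
  rw [Matrix.dotProduct_mulVec, ← Matrix.vecMul_transpose, hA]

lemma dot_self_nonneg (v : Fin d → ℝ) : 0 ≤ v ⬝ᵥ v := by
  simpa using dotProduct_star_self_nonneg v

/-- Cauchy–Schwarz for the form of a positive semidefinite matrix. -/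
lemma psd_cauchy_schwarz {A : Matrix (Fin d) (Fin d) ℝ} (hA : A.PosSemidef) (v w : Fin d → ℝ) :
    (v ⬝ᵥ A *ᵥ w) ^ 2 ≤ (v ⬝ᵥ A *ᵥ v) * (w ⬝ᵥ A *ᵥ w) := by
  have h : ∀ t : ℝ, 0 ≤ (w ⬝ᵥ A *ᵥ w) * (t * t) + (2 * (v ⬝ᵥ A *ᵥ w)) * t + v ⬝ᵥ A *ᵥ v := by
    intro t
    have h1 := psd_nonneg hA (v + t • w)
    have h2 : w ⬝ᵥ A *ᵥ v = v ⬝ᵥ A *ᵥ w := by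
      rw [← mulVec_dot (psd_transpose hA), dotProduct_comm]
    simp only [Matrix.mulVec_add, Matrix.mulVec_smul, dotProduct_add, add_dotProduct,
      dotProduct_smul, smul_dotProduct, smul_eq_mul, h2] at h1
    linarith
  have := discrim_le_zero h
  simp only [discrim] at this
  nlinarith

lemma dot_cauchy_schwarz (v w : Fin d → ℝ) : (v ⬝ᵥ w) ^ 2 ≤ (v ⬝ᵥ v) * (w ⬝ᵥ w) := by
  simpa using psd_cauchy_schwarz (Matrix.PosSemidef.one (n := Fin d) (R := ℝ)) v w

lemma trace_mul_vecMulVec (M : Matrix (Fin d) (Fin d) ℝ) (x y : Fin d → ℝ) :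
    (M * Matrix.vecMulVec x y).trace = y ⬝ᵥ M *ᵥ x := by
  rw [Matrix.mul_vecMulVec, Matrix.trace_vecMulVec, dotProduct_comm]

/-- A positive semidefinite matrix is a sum of squares. -/
lemma psd_decomp {A : Matrix (Fin d) (Fin d) ℝ} (hA : A.PosSemidef) :
    ∃ (m : ℕ) (G : Matrix (Fin m) (Fin d) ℝ), A = Gᵀ * G := by
  obtain ⟨m, v, hv⟩ := Matrix.posSemidef_iff_eq_sum_vecMulVec.1 hA
  refine ⟨m, Matrix.of v, ?_⟩
  rw [hv]
  ext i j
  simp [Matrix.sum_apply, Matrix.mul_apply, Matrix.vecMulVec_apply]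

lemma trace_mul_nonneg {A B : Matrix (Fin d) (Fin d) ℝ} (hA : A.PosSemidef) (hB : B.PosSemidef) :
    0 ≤ (A * B).trace := by
  obtain ⟨m, v, hv⟩ := Matrix.posSemidef_iff_eq_sum_vecMulVec.1 hB
  rw [hv, Finset.mul_sum, Matrix.trace_sum]
  refine Finset.sum_nonneg fun i _ => ?_
  rw [trace_mul_vecMulVec]
  simpa using psd_nonneg hA (v i)

variable {lam : ℝ} {A : Matrix (Fin d) (Fin d) ℝ}

lemma reg_posDef (hA : A.PosSemidef) (hl : 0 < lam) :
    (A + lam • (1 : Matrix (Fin d) (Fin d) ℝ)).PosDef :=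
  Matrix.PosDef.posSemidef_add hA (Matrix.PosDef.one.smul hl)

lemma reg_isUnit (hA : A.PosSemidef) (hl : 0 < lam) :
    IsUnit (A + lam • (1 : Matrix (Fin d) (Fin d) ℝ)).det :=
  (Matrix.isUnit_iff_isUnit_det _).1 (reg_posDef hA hl).isUnit

lemma reg_mul_ridge (hA : A.PosSemidef) (hl : 0 < lam) :
    (A + lam • (1 : Matrix (Fin d) (Fin d) ℝ)) * ridge lam A = 1 :=
  Matrix.mul_nonsing_inv _ (reg_isUnit hA hl)

lemma ridge_mul_reg (hA : A.PosSemidef) (hl : 0 < lam) :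
    ridge lam A * (A + lam • (1 : Matrix (Fin d) (Fin d) ℝ)) = 1 :=
  Matrix.nonsing_inv_mul _ (reg_isUnit hA hl)

lemma mul_ridge (hA : A.PosSemidef) (hl : 0 < lam) : A * ridge lam A = 1 - lam • ridge lam A := by
  have := reg_mul_ridge hA hl
  rw [add_mul, smul_mul_assoc, one_mul] at this
  rw [← this]; abel

lemma ridge_mul (hA : A.PosSemidef) (hl : 0 < lam) : ridge lam A * A = 1 - lam • ridge lam A := by
  have := ridge_mul_reg hA hl
  rw [mul_add, mul_smul_comm, mul_one] at this
  rw [← this]; abel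

lemma ridge_posSemidef (hA : A.PosSemidef) (hl : 0 < lam) : (ridge lam A).PosSemidef :=
  (reg_posDef hA hl).inv.posSemidef

lemma ridge_transpose (hA : A.PosSemidef) (hl : 0 < lam) : (ridge lam A)ᵀ = ridge lam A :=
  psd_transpose (ridge_posSemidef hA hl)

lemma reg_mulVec_ridge (hA : A.PosSemidef) (hl : 0 < lam) (v : Fin d → ℝ) :
    A *ᵥ (ridge lam A *ᵥ v) + lam • (ridge lam A *ᵥ v) = v := by
  rw [Matrix.mulVec_mulVec, mul_ridge hA hl, Matrix.sub_mulVec, Matrix.one_mulVec,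
    Matrix.smul_mulVec]
  abel

lemma ridge_eq_of_reg {v w : Fin d → ℝ} (hA : A.PosSemidef) (hl : 0 < lam)
    (h : A *ᵥ v + lam • v = w) : ridge lam A *ᵥ w = v := by
  rw [← h, Matrix.mulVec_add, Matrix.mulVec_mulVec, ridge_mul hA hl, Matrix.mulVec_smul,
    Matrix.sub_mulVec, Matrix.one_mulVec, Matrix.smul_mulVec]
  abel

/-- The energy identity `vᵀ Q v = (Q v)ᵀ A (Q v) + lam ‖Q v‖²`. -/
lemma ridge_energy (hA : A.PosSemidef) (hl : 0 < lam) (v : Fin d → ℝ) :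
    v ⬝ᵥ ridge lam A *ᵥ v = (ridge lam A *ᵥ v) ⬝ᵥ A *ᵥ (ridge lam A *ᵥ v)
      + lam * ((ridge lam A *ᵥ v) ⬝ᵥ (ridge lam A *ᵥ v)) := by
  conv_lhs => rw [← mulVec_dot (ridge_transpose hA hl)]
  conv_lhs => rw [← reg_mulVec_ridge hA hl v]
  rw [Matrix.mulVec_add, reg_mulVec_ridge hA hl, ← Matrix.mulVec_add, reg_mulVec_ridge hA hl]
  conv_lhs => rw [← reg_mulVec_ridge hA hl v]
  rw [Matrix.mulVec_add, ← Matrix.mulVec_add, reg_mulVec_ridge hA hl]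
  conv_lhs => rhs; rw [← reg_mulVec_ridge hA hl v]
  rw [dotProduct_add, dotProduct_smul, smul_eq_mul]

lemma ridge_normSq_le (hA : A.PosSemidef) (hl : 0 < lam) (v : Fin d → ℝ) :
    lam * ((ridge lam A *ᵥ v) ⬝ᵥ (ridge lam A *ᵥ v)) ≤ v ⬝ᵥ ridge lam A *ᵥ v := by
  rw [ridge_energy hA hl]
  linarith [psd_nonneg hA (ridge lam A *ᵥ v)]

lemma ridge_quad_le (hA : A.PosSemidef) (hl : 0 < lam) (v : Fin d → ℝ) :
    v ⬝ᵥ ridge lam A *ᵥ v ≤ v ⬝ᵥ v / lam := by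
  have h1 := ridge_normSq_le hA hl v
  have h2 := dot_cauchy_schwarz v (ridge lam A *ᵥ v)
  have h3 := psd_nonneg (ridge_posSemidef hA hl) v
  have h4 := dot_self_nonneg v
  rw [le_div_iff₀ hl]
  rcases h3.eq_or_lt with h | h
  · rw [← h, zero_mul]; exact h4
  · nlinarith

lemma ridge_normSq_le' (hA : A.PosSemidef) (hl : 0 < lam) (v : Fin d → ℝ) :
    (ridge lam A *ᵥ v) ⬝ᵥ (ridge lam A *ᵥ v) ≤ v ⬝ᵥ v / lam ^ 2 := by
  have h1 := ridge_normSq_le hA hl v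
  have h2 := ridge_quad_le hA hl v
  rw [le_div_iff₀ (by positivity)]
  rw [le_div_iff₀ hl] at h2
  nlinarith

/-- `I - lam Q` is positive semidefinite. -/
lemma one_sub_ridge_nonneg (hA : A.PosSemidef) (hl : 0 < lam) (v : Fin d → ℝ) :
    0 ≤ v ⬝ᵥ v - lam * (v ⬝ᵥ ridge lam A *ᵥ v) := by
  have h2 := ridge_quad_le hA hl v
  rw [le_div_iff₀ hl] at h2
  linarith

lemma smul_vecMulVec_psd {c : ℝ} (hc : 0 ≤ c) (z : Fin d → ℝ) :
    (c • Matrix.vecMulVec z z).PosSemidef := by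
  have := (Matrix.posSemidef_vecMulVec_self_star z).smul hc
  simpa using this

/-- The Sherman–Morrison formula, applied to a vector. -/
lemma ridge_rankOne (hA : A.PosSemidef) (hl : 0 < lam) {c : ℝ} (hc : 0 ≤ c) (z w : Fin d → ℝ) :
    ridge lam (A + c • Matrix.vecMulVec z z) *ᵥ w
      = ridge lam A *ᵥ w - (c * (z ⬝ᵥ ridge lam A *ᵥ w) / (1 + c * (z ⬝ᵥ ridge lam A *ᵥ z)))
          • (ridge lam A *ᵥ z) := by
  have hq : 0 ≤ c * (z ⬝ᵥ ridge lam A *ᵥ z) :=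
    mul_nonneg hc (psd_nonneg (ridge_posSemidef hA hl) z)
  refine ridge_eq_of_reg (hA.add (smul_vecMulVec_psd hc z)) hl ?_
  set b := c * (z ⬝ᵥ ridge lam A *ᵥ w) / (1 + c * (z ⬝ᵥ ridge lam A *ᵥ z)) with hb
  have e1 := reg_mulVec_ridge hA hl w
  have e2 := reg_mulVec_ridge hA hl z
  have hb' : b * (1 + c * (z ⬝ᵥ ridge lam A *ᵥ z)) = c * (z ⬝ᵥ ridge lam A *ᵥ w) := by
    rw [hb]; field_simp
  have key : ∀ x : Fin d → ℝ, Matrix.vecMulVec z z *ᵥ x = (z ⬝ᵥ x) • z := by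
    intro x; rw [Matrix.vecMulVec_mulVec]; simp
  calc (A + c • Matrix.vecMulVec z z) *ᵥ (ridge lam A *ᵥ w - b • ridge lam A *ᵥ z)
        + lam • (ridge lam A *ᵥ w - b • ridge lam A *ᵥ z)
      = (A *ᵥ (ridge lam A *ᵥ w) + lam • (ridge lam A *ᵥ w))
        - b • (A *ᵥ (ridge lam A *ᵥ z) + lam • (ridge lam A *ᵥ z))
        + (c * (z ⬝ᵥ ridge lam A *ᵥ w) - b * (c * (z ⬝ᵥ ridge lam A *ᵥ z))) • z := by
        rw [Matrix.add_mulVec, Matrix.smul_mulVec, key, Matrix.mulVec_sub, Matrix.mulVec_smul,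
          dotProduct_sub, dotProduct_smul, smul_eq_mul]
        module
    _ = w := by
        rw [e1, e2, ← hb']; module

lemma ridge_rankOne_self (hA : A.PosSemidef) (hl : 0 < lam) {c : ℝ} (hc : 0 ≤ c) (z : Fin d → ℝ) :
    ridge lam (A + c • Matrix.vecMulVec z z) *ᵥ z
      = (1 / (1 + c * (z ⬝ᵥ ridge lam A *ᵥ z))) • (ridge lam A *ᵥ z) := by
  have hq : 0 ≤ c * (z ⬝ᵥ ridge lam A *ᵥ z) :=
    mul_nonneg hc (psd_nonneg (ridge_posSemidef hA hl) z)
  rw [ridge_rankOne hA hl hc]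
  have : ∀ x : Fin d → ℝ, ∀ b : ℝ, x - b • x = (1 - b) • x := by intros; module
  rw [this]
  congr 1
  field_simp
  ring

/-- `lam ↦ lam Q` has derivative `Q A Q`; the error of the linear approximation is
`- h² Q A Q' Q`. -/
lemma ridge_expansion (hA : A.PosSemidef) (hl : 0 < lam) {h : ℝ} (hh : 0 ≤ h) :
    (lam + h) • ridge (lam + h) A - lam • ridge lam A - h • (ridge lam A * A * ridge lam A)
      = -(h ^ 2) • (ridge lam A * (A * ridge (lam + h) A) * ridge lam A) := by
  have hl' : 0 < lam + h := by linarith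
  have e1 := ridge_mul hA hl
  have e2 := mul_ridge hA hl'
  have e3 := mul_ridge hA hl
  set Q := ridge lam A
  set Q' := ridge (lam + h) A
  have c1 : Q * (A * Q') = Q - (lam + h) • (Q * Q') := by
    rw [e2, mul_sub, mul_one, mul_smul_comm]
  have c2 : Q * (A * Q') = Q' - lam • (Q * Q') := by
    rw [← mul_assoc, e1, sub_mul, one_mul, smul_mul_assoc]
  have c3 : h • (Q * Q') = Q - Q' := by
    have : (Q - (lam + h) • (Q * Q')) - (Q' - lam • (Q * Q')) = 0 := by
      rw [← c1, ← c2, sub_self]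
    rw [← sub_eq_zero, ← neg_eq_zero, ← this]
    module
  have c4 : h • (Q' * Q) = Q - Q' := by
    have := congrArg Matrix.transpose c3
    simpa [Matrix.transpose_smul, Matrix.transpose_mul, Matrix.transpose_sub,
      ridge_transpose hA hl, ridge_transpose hA hl', Q, Q'] using this
  have c5 : h • (Q * Q' * Q) = Q * Q - Q' * Q := by
    rw [← smul_mul_assoc, c3, sub_mul]
  rw [e1, c1, sub_mul, sub_mul, one_mul, smul_mul_assoc, smul_mul_assoc]
  have c6 : h ^ 2 • (Q * Q' * Q) = h • (Q * Q) - (Q - Q') := by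
    rw [pow_two, mul_smul, c5, smul_sub, c4]
  have : -(h ^ 2) • (Q * Q - (lam + h) • (Q * Q' * Q))
      = -(h ^ 2) • (Q * Q) + (lam + h) • (h ^ 2 • (Q * Q' * Q)) := by module
  rw [this, c6]
  module

/-- Second order error of the linear approximation of `lam ↦ lam Q`. -/
lemma ridge_expansion_bound (hA : A.PosSemidef) (hl : 0 < lam) {h : ℝ} (hh : 0 ≤ h)
    (v : Fin d → ℝ) :
    |(lam + h) * (v ⬝ᵥ ridge (lam + h) A *ᵥ v) - lam * (v ⬝ᵥ ridge lam A *ᵥ v)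
      - h * ((ridge lam A *ᵥ v) ⬝ᵥ A *ᵥ (ridge lam A *ᵥ v))|
      ≤ h ^ 2 * (v ⬝ᵥ ridge lam A *ᵥ v) / lam := by
  have hl' : 0 < lam + h := by linarith
  have e := congrArg (fun M => v ⬝ᵥ M *ᵥ v) (ridge_expansion hA hl hh)
  simp only [Matrix.sub_mulVec, Matrix.smul_mulVec, dotProduct_sub, dotProduct_smul,
    smul_eq_mul, ← Matrix.mulVec_mulVec] at e
  rw [← mulVec_dot (ridge_transpose hA hl) v (A *ᵥ (ridge lam A *ᵥ v)),
    ← mulVec_dot (ridge_transpose hA hl) v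
      (A *ᵥ (ridge (lam + h) A *ᵥ (ridge lam A *ᵥ v)))] at e
  rw [e]
  set u := ridge lam A *ᵥ v with hu
  have e3 : A *ᵥ (ridge (lam + h) A *ᵥ u) = u - (lam + h) • (ridge (lam + h) A *ᵥ u) := by
    rw [eq_sub_iff_add_eq, reg_mulVec_ridge hA hl']
  have b1 := one_sub_ridge_nonneg hA hl' u
  have b2 := psd_nonneg (ridge_posSemidef hA hl') u
  have b3 := ridge_normSq_le hA hl v
  rw [← hu] at b3
  have e4 : u ⬝ᵥ A *ᵥ (ridge (lam + h) A *ᵥ u)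
      = u ⬝ᵥ u - (lam + h) * (u ⬝ᵥ ridge (lam + h) A *ᵥ u) := by
    rw [e3, dotProduct_sub, dotProduct_smul, smul_eq_mul]
  rw [e4, abs_mul, abs_neg, abs_of_nonneg (sq_nonneg h), abs_of_nonneg b1, mul_div_assoc]
  refine mul_le_mul_of_nonneg_left ?_ (sq_nonneg h)
  rw [le_div_iff₀ hl]
  nlinarith [mul_nonneg hl'.le b2]

/-! ### Consequences of a Loewner bound `S ≤ L (A + lam I)` -/

variable {S : Matrix (Fin d) (Fin d) ℝ} {L : ℝ}

lemma ridge_conj_le (hA : A.PosSemidef) (hl : 0 < lam)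
    (hS : ∀ v, v ⬝ᵥ S *ᵥ v ≤ L * (v ⬝ᵥ A *ᵥ v + lam * (v ⬝ᵥ v))) (y : Fin d → ℝ) :
    (ridge lam A *ᵥ y) ⬝ᵥ S *ᵥ (ridge lam A *ᵥ y) ≤ L * (y ⬝ᵥ ridge lam A *ᵥ y) := by
  rw [ridge_energy hA hl]
  exact hS _

lemma trace_mul_ridge_le (hA : A.PosSemidef) (hl : 0 < lam)
    (hS : ∀ v, v ⬝ᵥ S *ᵥ v ≤ L * (v ⬝ᵥ A *ᵥ v + lam * (v ⬝ᵥ v))) (hsym : Sᵀ = S) :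
    (S * ridge lam A).trace ≤ L * d := by
  have hpsd : (L • (A + lam • (1 : Matrix (Fin d) (Fin d) ℝ)) - S).PosSemidef := by
    refine psd_of_nonneg ?_ fun v => ?_
    · simp [psd_transpose hA, hsym]
    · simp only [Matrix.sub_mulVec, Matrix.smul_mulVec, Matrix.add_mulVec, Matrix.one_mulVec,
        dotProduct_sub, dotProduct_smul, dotProduct_add, smul_eq_mul]
      linarith [hS v]
  have := trace_mul_nonneg hpsd (ridge_posSemidef hA hl)
  rw [sub_mul, Matrix.trace_sub, smul_mul_assoc, reg_mul_ridge hA hl, Matrix.trace_smul,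
    Matrix.trace_one, smul_eq_mul, Fintype.card_fin] at this
  linarith

end LinearAlgebra

end LinearESN

namespace LinearESN

/-! ### Bounds on means, and resampling one coordinate -/

section MeanBounds

/-- `f` is measurable and nonnegative, and its mean is finite and at most `c`. -/
def MeanLE {Ω : Type*} [MeasurableSpace Ω] (μ : Measure Ω) (f : Ω → ℝ) (c : ℝ) : Prop :=
  Measurable f ∧ (∀ ω, 0 ≤ f ω) ∧ 0 ≤ c ∧ ∫⁻ ω, ENNReal.ofReal (f ω) ∂μ ≤ ENNReal.ofReal c

namespace MeanLE

variable {Ω : Type*} [MeasurableSpace Ω] {μ : Measure Ω} {f g : Ω → ℝ} {c c' : ℝ}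

lemma of_integrable (hf : Measurable f) (h0 : ∀ ω, 0 ≤ f ω) (hi : Integrable f μ)
    (hc : ∫ ω, f ω ∂μ ≤ c) : MeanLE μ f c := by
  refine ⟨hf, h0, (integral_nonneg h0).trans hc, ?_⟩
  rw [← ofReal_integral_eq_lintegral_ofReal hi (ae_of_all _ h0)]
  exact ENNReal.ofReal_le_ofReal hc

lemma integrable (h : MeanLE μ f c) : Integrable f μ := by
  refine ⟨h.1.aestronglyMeasurable, ?_⟩
  rw [hasFiniteIntegral_iff_ofReal (ae_of_all _ h.2.1)]
  exact h.2.2.2.trans_lt ENNReal.ofReal_lt_top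

lemma integral_le (h : MeanLE μ f c) : ∫ ω, f ω ∂μ ≤ c := by
  rw [integral_eq_lintegral_of_nonneg_ae (ae_of_all _ h.2.1) h.1.aestronglyMeasurable]
  exact ENNReal.toReal_le_of_le_ofReal h.2.2.1 h.2.2.2

lemma mono (h : MeanLE μ g c) (hf : Measurable f) (h0 : ∀ ω, 0 ≤ f ω) (hfg : ∀ ω, f ω ≤ g ω) :
    MeanLE μ f c :=
  ⟨hf, h0, h.2.2.1,
    (lintegral_mono fun ω => ENNReal.ofReal_le_ofReal (hfg ω)).trans h.2.2.2⟩

lemma weaken (h : MeanLE μ f c) (hc : c ≤ c') : MeanLE μ f c' :=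
  ⟨h.1, h.2.1, h.2.2.1.trans hc, h.2.2.2.trans (ENNReal.ofReal_le_ofReal hc)⟩

lemma add (hf : MeanLE μ f c) (hg : MeanLE μ g c') : MeanLE μ (fun ω => f ω + g ω) (c + c') :=
  of_integrable (hf.1.add hg.1) (fun ω => add_nonneg (hf.2.1 ω) (hg.2.1 ω))
    (hf.integrable.add hg.integrable)
    ((integral_add hf.integrable hg.integrable).trans_le (add_le_add hf.integral_le hg.integral_le))

lemma const_mul {a : ℝ} (ha : 0 ≤ a) (hf : MeanLE μ f c) : MeanLE μ (fun ω => a * f ω) (a * c) :=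
  of_integrable (hf.1.const_mul a) (fun ω => mul_nonneg ha (hf.2.1 ω)) (hf.integrable.const_mul a)
    ((integral_const_mul a f).trans_le (mul_le_mul_of_nonneg_left hf.integral_le ha))

lemma const [IsProbabilityMeasure μ] (hc : 0 ≤ c) : MeanLE μ (fun _ => c) c :=
  of_integrable measurable_const (fun _ => hc) (integrable_const c) (by simp)

lemma sum {ι : Type*} (s : Finset ι) {F : ι → Ω → ℝ} {C : ι → ℝ} [IsProbabilityMeasure μ]
    (h : ∀ i ∈ s, MeanLE μ (F i) (C i)) :
    MeanLE μ (fun ω => ∑ i ∈ s, F i ω) (∑ i ∈ s, C i) := by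
  classical
  induction s using Finset.induction_on with
  | empty => simpa using MeanLE.const (μ := μ) le_rfl
  | insert a s ha ih =>
    simp only [Finset.sum_insert ha]
    exact (h a (Finset.mem_insert_self a s)).add
      (ih fun i hi => h i (Finset.mem_insert_of_mem hi))

/-- A uniform bound on the means of the terms bounds the mean of the average. -/
lemma avg {N : ℕ} (hN : 0 < N) {F : Fin N → Ω → ℝ} [IsProbabilityMeasure μ]
    (h : ∀ i, MeanLE μ (F i) c) : MeanLE μ (fun ω => 1 / (N : ℝ) * ∑ i, F i ω) c := by
  have hN' : (N : ℝ) ≠ 0 := by positivity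
  have := (MeanLE.sum Finset.univ fun i _ => h i).const_mul (a := 1 / (N : ℝ)) (by positivity)
  refine this.weaken (le_of_eq ?_)
  simp
  field_simp

lemma abs_integral_le {F : Ω → ℝ} (h : MeanLE μ (fun ω => |F ω|) c) : |∫ ω, F ω ∂μ| ≤ c :=
  (norm_integral_le_integral_norm F).trans h.integral_le

/-- Iterated means: bound the inner mean for each value of the first variable. -/
lemma prod {E : Type*} [MeasurableSpace E] {π : Measure E} [SFinite π] {F : Ω → E → ℝ}
    (hF : Measurable fun p : Ω × E => F p.1 p.2) (h : ∀ Z, MeanLE π (F Z) (g Z))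
    (hg : MeanLE μ g c) : MeanLE (μ.prod π) (fun p => F p.1 p.2) c := by
  refine ⟨hF, fun p => (h p.1).2.1 p.2, hg.2.2.1, ?_⟩
  rw [lintegral_prod _ (hF.ennreal_ofReal.aemeasurable)]
  exact (lintegral_mono fun Z => (h Z).2.2.2).trans hg.2.2.2

lemma comp_fst {E : Type*} [MeasurableSpace E] {π : Measure E} [IsProbabilityMeasure π]
    [SFinite μ] (hg : MeanLE μ g c) : MeanLE (μ.prod π) (fun p => g p.1) c :=
  MeanLE.prod (F := fun Z _ => g Z) (hg.1.comp measurable_fst)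
    (fun Z => MeanLE.const (hg.2.1 Z)) hg

end MeanLE

variable {E : Type*} [MeasurableSpace E] {N : ℕ}

/-- Replacing one coordinate of an i.i.d. sample by a fresh draw does not change its law. -/
lemma measurePreserving_update (π : Measure E) [IsProbabilityMeasure π] (i : Fin N) :
    MeasurePreserving (fun p : (Fin N → E) × E => Function.update p.1 i p.2)
      ((Measure.pi fun _ => π).prod π) (Measure.pi fun _ => π) := by
  have hm : Measurable fun p : (Fin N → E) × E => Function.update p.1 i p.2 := by
    refine measurable_pi_lambda _ fun j => ?_
    by_cases hj : j = i
    · subst hj; simpa using measurable_snd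
    · have : Measurable fun p : (Fin N → E) × E => p.1 j := by fun_prop
      simpa [Function.update_of_ne hj] using this
  refine ⟨hm, (Measure.pi_eq fun s hs => ?_).symm⟩
  rw [Measure.map_apply hm (MeasurableSet.univ_pi hs)]
  have : (fun p : (Fin N → E) × E => Function.update p.1 i p.2) ⁻¹' Set.univ.pi s
      = (Set.univ.pi (Function.update s i Set.univ)) ×ˢ s i := by
    ext ⟨Z, y⟩
    simp only [Set.mem_preimage, Set.mem_pi, Set.mem_univ, true_implies, Set.mem_prod]
    constructor
    · intro h
      refine ⟨fun j => ?_, by simpa using h i⟩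
      by_cases hj : j = i
      · subst hj; simp
      · simpa [Function.update_of_ne hj] using h j
    · rintro ⟨h1, h2⟩ j
      by_cases hj : j = i
      · subst hj; simpa using h2
      · simpa [Function.update_of_ne hj] using h1 j
  rw [this, Measure.prod_prod, Measure.pi_pi,
    ← Finset.mul_prod_erase _ _ (Finset.mem_univ i),
    ← Finset.mul_prod_erase Finset.univ (fun j => π (s j)) (Finset.mem_univ i)]
  simp only [Function.update_self, measure_univ, one_mul]
  rw [mul_comm]
  congr 1
  refine Finset.prod_congr rfl fun j hj => ?_
  rw [Function.update_of_ne (Finset.ne_of_mem_erase hj)]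

variable {π : Measure E} [IsProbabilityMeasure π]

/-- If `f Z y` does not depend on `Z i`, then `Z i` may be replaced by a fresh draw in
`f Z (Z i)`. -/
lemma MeanLE.coord {f : (Fin N → E) → E → ℝ} {c : ℝ} (i : Fin N)
    (hf : ∀ Z a y, f (Function.update Z i a) y = f Z y)
    (h : MeanLE ((Measure.pi fun _ => π).prod π) (fun p => f p.1 p.2) c) :
    MeanLE (Measure.pi fun _ : Fin N => π) (fun Z => f Z (Z i)) c := by
  have hm : Measurable fun Z : Fin N → E => f Z (Z i) :=
    h.1.comp (measurable_id.prodMk (measurable_pi_apply i))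
  refine ⟨hm, fun Z => h.2.1 (Z, Z i), h.2.2.1, ?_⟩
  rw [← (measurePreserving_update π i).lintegral_comp hm.ennreal_ofReal]
  simpa [hf] using h.2.2.2

/-- A coordinate that `f` does not see through its first argument may be taken as a fresh sample. -/
lemma integral_coord {f : (Fin N → E) → E → ℝ} (i : Fin N)
    (hf : ∀ Z a y, f (Function.update Z i a) y = f Z y)
    (h : Measurable fun p : (Fin N → E) × E => f p.1 p.2) :
    ∫ Z, f Z (Z i) ∂(Measure.pi fun _ : Fin N => π)
      = ∫ p, f p.1 p.2 ∂((Measure.pi fun _ : Fin N => π).prod π) := by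
  have hm : Measurable fun Z : Fin N → E => f Z (Z i) :=
    h.comp (measurable_id.prodMk (measurable_pi_apply i))
  rw [← (measurePreserving_update π i).map_eq,
    integral_map (measurePreserving_update π i).measurable.aemeasurable
      hm.aestronglyMeasurable]
  simp [hf, (measurePreserving_update π i).map_eq]

end MeanBounds

end LinearESN

namespace LinearESN

/-! ### Moment bounds for concentrated vectors -/

section Moments

variable {n : ℕ}

/-- The consequences of concentration that the argument uses, for a law `π` with mean `m` and second
moment matrix `S`: fourth moments of centred linear forms are bounded, and squared norms of linear
images fluctuate little. -/
structure Concentrated (π : Measure (Fin n → ℝ)) (m : Fin n → ℝ) (S : Matrix (Fin n) (Fin n) ℝ)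
    (K : ℝ) : Prop where
  int4 : ∀ i, Integrable (fun z => z i ^ 4) π
  mean : ∀ i, ∫ z, z i ∂π = m i
  second : ∀ i j, ∫ z, z i * z j ∂π = S i j
  nonneg : 0 ≤ K
  lin : ∀ w : Fin n → ℝ, ∫ z, (w ⬝ᵥ (z - m)) ^ 4 ∂π ≤ K * (w ⬝ᵥ w) ^ 2
  quad : ∀ (p : ℕ) (G : Matrix (Fin p) (Fin n) ℝ) (a : ℝ), 0 ≤ a →
    (∀ v, (G *ᵥ v) ⬝ᵥ (G *ᵥ v) ≤ a * (v ⬝ᵥ v)) →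
    ∫ z, ((G *ᵥ z) ⬝ᵥ (G *ᵥ z) - (S * (Gᵀ * G)).trace) ^ 2 ∂π
      ≤ K * (a ^ 2 + a * (S * (Gᵀ * G)).trace)

namespace Concentrated

variable {π : Measure (Fin n → ℝ)} [IsProbabilityMeasure π] {m : Fin n → ℝ}
  {S : Matrix (Fin n) (Fin n) ℝ} {K : ℝ} (h : Concentrated π m S K)

include h

lemma memLp_coord (i : Fin n) : MemLp (fun z : Fin n → ℝ => z i) 4 π := by
  have h4 : ((4 : ENNReal)).toReal = (4 : ℕ) := by norm_num
  rw [← integrable_norm_rpow_iff (measurable_pi_apply i).aestronglyMeasurable (by norm_num)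
    (by norm_num), h4]
  simp only [Real.rpow_natCast, Real.norm_eq_abs]
  refine (h.int4 i).congr (ae_of_all _ fun z => ?_)
  simp only
  rw [Even.pow_abs (by decide)]

lemma memLp_lin (w : Fin n → ℝ) : MemLp (fun z : Fin n → ℝ => w ⬝ᵥ z) 4 π := by
  simp only [dotProduct]
  exact memLp_finsetSum _ fun i _ => (h.memLp_coord i).const_mul (w i)

lemma memLp_lin_sub (w : Fin n → ℝ) : MemLp (fun z : Fin n → ℝ => w ⬝ᵥ (z - m)) 4 π := by
  simp only [dotProduct_sub]
  exact (h.memLp_lin w).sub (memLp_const _)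

lemma memLp_mul {f g : (Fin n → ℝ) → ℝ} (hf : MemLp f 4 π) (hg : MemLp g 4 π) :
    MemLp (fun z => f z * g z) 2 π := by
  have : ENNReal.HolderTriple 4 4 2 := ⟨by
    rw [← two_mul, show (4 : ENNReal) = 2 * 2 by norm_num,
      ENNReal.mul_inv (by norm_num) (by norm_num), ← mul_assoc,
      ENNReal.mul_inv_cancel (by norm_num) (by norm_num), one_mul]⟩
  exact hg.mul hf

lemma memLp_quad (M : Matrix (Fin n) (Fin n) ℝ) :
    MemLp (fun z : Fin n → ℝ => z ⬝ᵥ M *ᵥ z) 2 π := by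
  simp only [dotProduct]
  refine memLp_finsetSum _ fun i _ => h.memLp_mul (h.memLp_coord i) ?_
  exact h.memLp_lin (M i)

lemma integrable_coord_mul (i j : Fin n) : Integrable (fun z : Fin n → ℝ => z i * z j) π :=
  (h.memLp_mul (h.memLp_coord i) (h.memLp_coord j)).integrable (by norm_num)

lemma integrable_lin (w : Fin n → ℝ) : Integrable (fun z : Fin n → ℝ => w ⬝ᵥ z) π :=
  (h.memLp_lin w).integrable (by norm_num)

lemma integrable_lin_mul (v w : Fin n → ℝ) :
    Integrable (fun z : Fin n → ℝ => (v ⬝ᵥ z) * (w ⬝ᵥ z)) π :=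
  (h.memLp_mul (h.memLp_lin v) (h.memLp_lin w)).integrable (by norm_num)

lemma integral_lin (w : Fin n → ℝ) : ∫ z, w ⬝ᵥ z ∂π = w ⬝ᵥ m := by
  simp only [dotProduct]
  rw [integral_finsetSum _ fun i _ => ((h.memLp_coord i).integrable (by norm_num)).const_mul _]
  simp [integral_const_mul, h.mean]

lemma integral_lin_mul (v w : Fin n → ℝ) :
    ∫ z, (v ⬝ᵥ z) * (w ⬝ᵥ z) ∂π = v ⬝ᵥ S *ᵥ w := by
  have : ∀ z : Fin n → ℝ, (v ⬝ᵥ z) * (w ⬝ᵥ z) = ∑ i, ∑ j, v i * w j * (z i * z j) := by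
    intro z
    simp only [dotProduct, Finset.sum_mul_sum]
    exact Finset.sum_congr rfl fun i _ => Finset.sum_congr rfl fun j _ => by ring
  simp only [this]
  rw [integral_finsetSum _ fun i _ => integrable_finsetSum _ fun j _ =>
    (h.integrable_coord_mul i j).const_mul _]
  simp only [dotProduct, Matrix.mulVec, Finset.mul_sum]
  refine Finset.sum_congr rfl fun i _ => ?_
  rw [integral_finsetSum _ fun j _ => (h.integrable_coord_mul i j).const_mul _]
  refine Finset.sum_congr rfl fun j _ => ?_
  rw [integral_const_mul, h.second]
  ring

lemma transpose : Sᵀ = S := by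
  ext i j
  rw [Matrix.transpose_apply, ← h.second, ← h.second]
  simp only [mul_comm]

lemma posSemidef : S.PosSemidef :=
  psd_of_nonneg h.transpose fun v => by
    rw [← h.integral_lin_mul]
    exact integral_nonneg fun z => mul_self_nonneg _

lemma integrable_quad (M : Matrix (Fin n) (Fin n) ℝ) :
    Integrable (fun z : Fin n → ℝ => z ⬝ᵥ M *ᵥ z) π :=
  (h.memLp_quad M).integrable (by norm_num)

lemma integral_quad (M : Matrix (Fin n) (Fin n) ℝ) :
    ∫ z, z ⬝ᵥ M *ᵥ z ∂π = (S * M).trace := by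
  have e : ∀ z : Fin n → ℝ, z ⬝ᵥ M *ᵥ z = ∑ i, (Pi.single i 1 ⬝ᵥ z) * (M.row i ⬝ᵥ z) := by
    intro z
    simp only [single_dotProduct, one_mul]
    rfl
  simp only [e]
  rw [integral_finsetSum _ fun i _ => h.integrable_lin_mul _ _, ← Matrix.trace_transpose,
    Matrix.transpose_mul, h.transpose, Matrix.trace_mul_comm]
  simp only [h.integral_lin_mul]
  simp only [single_dotProduct, one_mul]
  rfl

/-- Centred linear forms have bounded variance. -/
lemma meanLE_lin_sq (w : Fin n → ℝ) :
    MeanLE π (fun z => (w ⬝ᵥ (z - m)) ^ 2) ((K + 1) * (w ⬝ᵥ w)) := by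
  have hi4 : Integrable (fun z : Fin n → ℝ => (w ⬝ᵥ (z - m)) ^ 4) π := by
    refine ((h.memLp_mul (h.memLp_lin_sub w) (h.memLp_lin_sub w)).integrable_sq).congr
      (ae_of_all _ fun z => ?_)
    simp only; ring
  have hi2 : Integrable (fun z : Fin n → ℝ => (w ⬝ᵥ (z - m)) ^ 2) π := by
    refine ((h.memLp_mul (h.memLp_lin_sub w) (h.memLp_lin_sub w)).integrable (by norm_num)).congr
      (ae_of_all _ fun z => ?_)
    simp only; ring
  refine MeanLE.of_integrable (by fun_prop) (fun z => sq_nonneg _) hi2 ?_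
  rcases (dot_self_nonneg w).eq_or_lt with h0 | h0
  · have : w = 0 := by simpa using h0.symm
    simp [this]
  · have hle : ∫ z, (w ⬝ᵥ (z - m)) ^ 2 ∂π
        ≤ ∫ z, ((w ⬝ᵥ (z - m)) ^ 4 * (1 / (w ⬝ᵥ w)) + w ⬝ᵥ w) ∂π := by
      refine integral_mono hi2 ((hi4.mul_const _).add (integrable_const _)) fun z => ?_
      simp only
      set x := w ⬝ᵥ (z - m)
      set a := w ⬝ᵥ w
      have : x ^ 4 * (1 / a) + a - x ^ 2 = ((x ^ 2 - a / 2) ^ 2 + 3 / 4 * a ^ 2) / a := by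
        field_simp; ring
      have : 0 ≤ x ^ 4 * (1 / a) + a - x ^ 2 := by rw [this]; positivity
      linarith
    rw [integral_add (hi4.mul_const _) (integrable_const _), integral_mul_const] at hle
    have := h.lin w
    simp only [integral_const, probReal_univ, smul_eq_mul, one_mul] at hle
    have h3 : (∫ z, (w ⬝ᵥ (z - m)) ^ 4 ∂π) * (1 / (w ⬝ᵥ w)) ≤ K * (w ⬝ᵥ w) := by
      rw [mul_one_div, div_le_iff₀ h0]; nlinarith
    linarith

lemma meanLE_lin_four (w : Fin n → ℝ) :
    MeanLE π (fun z => (w ⬝ᵥ z) ^ 4) (8 * (w ⬝ᵥ m) ^ 4 + 8 * (K * (w ⬝ᵥ w) ^ 2)) := by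
  have hi4 : Integrable (fun z : Fin n → ℝ => (w ⬝ᵥ (z - m)) ^ 4) π := by
    refine ((h.memLp_mul (h.memLp_lin_sub w) (h.memLp_lin_sub w)).integrable_sq).congr
      (ae_of_all _ fun z => ?_)
    simp only; ring
  have h1 : MeanLE π (fun z => (w ⬝ᵥ (z - m)) ^ 4) (K * (w ⬝ᵥ w) ^ 2) :=
    MeanLE.of_integrable (by fun_prop) (fun z => by positivity) hi4 (h.lin w)
  refine ((MeanLE.const (by positivity)).add (h1.const_mul (by norm_num : (0 : ℝ) ≤ 8))).mono
    (by fun_prop) (fun z => by positivity) fun z => ?_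
  rw [dotProduct_sub]
  set a := w ⬝ᵥ m
  set b := w ⬝ᵥ z
  have h2 : b ^ 2 ≤ 2 * a ^ 2 + 2 * (b - a) ^ 2 := by nlinarith [sq_nonneg (b - 2 * a)]
  have h3 : (b ^ 2) ^ 2 ≤ (2 * a ^ 2 + 2 * (b - a) ^ 2) ^ 2 :=
    pow_le_pow_left₀ (sq_nonneg b) h2 2
  nlinarith [sq_nonneg (a ^ 2 - (b - a) ^ 2)]

/-- The second moment form is the variance form plus the squared mean. -/
lemma quad_eq (v : Fin n → ℝ) :
    v ⬝ᵥ S *ᵥ v = ∫ z, (v ⬝ᵥ (z - m)) ^ 2 ∂π + (v ⬝ᵥ m) ^ 2 := by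
  have e : ∀ z : Fin n → ℝ, (v ⬝ᵥ (z - m)) ^ 2
      = (v ⬝ᵥ z) * (v ⬝ᵥ z) - 2 * (v ⬝ᵥ m) * (v ⬝ᵥ z) + (v ⬝ᵥ m) ^ 2 := by
    intro z; rw [dotProduct_sub]; ring
  simp only [e]
  rw [integral_add (f := fun z : Fin n → ℝ => (v ⬝ᵥ z) * (v ⬝ᵥ z) - 2 * (v ⬝ᵥ m) * (v ⬝ᵥ z))
    ((h.integrable_lin_mul v v).sub ((h.integrable_lin v).const_mul _))
    (integrable_const _), integral_sub (h.integrable_lin_mul v v)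
    ((h.integrable_lin v).const_mul _), integral_const_mul, h.integral_lin, h.integral_lin_mul]
  simp
  ring

/-- The covariance is at most `K + 1`, so that only the mean can make `S` large. -/
lemma quad_le (v : Fin n → ℝ) :
    v ⬝ᵥ S *ᵥ v ≤ (K + 1) * (v ⬝ᵥ v) + (v ⬝ᵥ m) ^ 2 := by
  rw [h.quad_eq]
  linarith [(h.meanLE_lin_sq v).integral_le]

lemma mean_sq_le (v : Fin n → ℝ) : (v ⬝ᵥ m) ^ 2 ≤ v ⬝ᵥ S *ᵥ v := by
  rw [h.quad_eq]
  linarith [integral_nonneg (μ := π) (f := fun z => (v ⬝ᵥ (z - m)) ^ 2) fun z => sq_nonneg _]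

lemma meanLE_normSq_sub :
    MeanLE π (fun z => (z - m) ⬝ᵥ (z - m)) ((K + 1) * n) := by
  have h1 := MeanLE.sum (μ := π) Finset.univ fun i _ => h.meanLE_lin_sq (Pi.single i 1)
  simp only [single_dotProduct, one_mul, Pi.single_eq_same, mul_one, Finset.sum_const,
    Finset.card_univ, Fintype.card_fin, nsmul_eq_mul] at h1
  refine (h1.weaken (by rw [mul_comm])).mono (by fun_prop) (fun z => dot_self_nonneg _) fun z => ?_
  simp [dotProduct, pow_two]

lemma meanLE_normSq_sub_sq :
    MeanLE π (fun z => ((z - m) ⬝ᵥ (z - m)) ^ 2) (K * n ^ 2) := by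
  have h0 : ∀ i, MeanLE π (fun z : Fin n → ℝ => (z i - m i) ^ 4) K := fun i => by
    have hi4 : Integrable (fun z : Fin n → ℝ => (Pi.single i 1 ⬝ᵥ (z - m)) ^ 4) π := by
      refine ((h.memLp_mul (h.memLp_lin_sub (Pi.single i 1))
        (h.memLp_lin_sub (Pi.single i 1))).integrable_sq).congr
        (ae_of_all _ fun z => ?_)
      simp only; ring
    have := h.lin (Pi.single i 1)
    simp only [single_dotProduct, one_mul, Pi.single_eq_same, one_pow, mul_one,
      Pi.sub_apply] at this hi4
    exact MeanLE.of_integrable (by fun_prop) (fun z => by positivity) hi4 this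
  have h1 := (MeanLE.sum (μ := π) Finset.univ fun i _ => h0 i).const_mul
    (Nat.cast_nonneg (α := ℝ) n)
  simp only [Finset.sum_const, Finset.card_univ, Fintype.card_fin, nsmul_eq_mul] at h1
  refine (h1.weaken (by linarith)).mono (by fun_prop) (fun z => sq_nonneg _) fun z => ?_
  have := sq_sum_le_card_mul_sum_sq (s := Finset.univ) (f := fun i => (z i - m i) ^ 2)
  simp only [Finset.card_univ, Fintype.card_fin] at this
  simp only [dotProduct, Pi.sub_apply]
  calc (∑ i, (z i - m i) * (z i - m i)) ^ 2 = (∑ i, (z i - m i) ^ 2) ^ 2 := by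
        simp only [pow_two]
    _ ≤ _ := this
    _ = _ := by simp only [← pow_mul]

/-- Fluctuation of a quadratic form of a positive semidefinite matrix bounded by `a`. -/
lemma meanLE_quad {A : Matrix (Fin n) (Fin n) ℝ} (hA : A.PosSemidef) {a : ℝ} (ha : 0 ≤ a)
    (hle : ∀ v, v ⬝ᵥ A *ᵥ v ≤ a * (v ⬝ᵥ v)) :
    MeanLE π (fun z => (z ⬝ᵥ A *ᵥ z - (S * A).trace) ^ 2) (K * (a ^ 2 + a * (S * A).trace)) := by
  refine MeanLE.of_integrable (by fun_prop) (fun z => sq_nonneg _)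
    ((h.memLp_quad A).sub (memLp_const _)).integrable_sq ?_
  obtain ⟨p, G, rfl⟩ := psd_decomp hA
  have e : ∀ v : Fin n → ℝ, v ⬝ᵥ (Gᵀ * G) *ᵥ v = (G *ᵥ v) ⬝ᵥ (G *ᵥ v) := by
    intro v
    rw [← Matrix.mulVec_mulVec, Matrix.dotProduct_mulVec, Matrix.vecMul_transpose]
  simp only [e] at hle ⊢
  exact h.quad p G a ha hle

/-- Fluctuation of the quadratic form of a product of two symmetric matrices, by polarisation. -/
lemma meanLE_quad_mul {A B : Matrix (Fin n) (Fin n) ℝ} (hA : Aᵀ = A) (hB : Bᵀ = B) {a : ℝ}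
    (ha : 0 ≤ a) (hAa : ∀ v, (A *ᵥ v) ⬝ᵥ (A *ᵥ v) ≤ a * (v ⬝ᵥ v))
    (hBa : ∀ v, (B *ᵥ v) ⬝ᵥ (B *ᵥ v) ≤ a * (v ⬝ᵥ v)) :
    MeanLE π (fun z => (z ⬝ᵥ (A * B) *ᵥ z - (S * (A * B)).trace) ^ 2)
      (K * (4 * a ^ 2 + a * ((S * (A * A)).trace + (S * (B * B)).trace))) := by
  -- polarisation: `4 zᵀ A B z = ‖(A + B) z‖² - ‖(A - B) z‖²`
  have hsum : ∀ v, ((A + B) *ᵥ v) ⬝ᵥ ((A + B) *ᵥ v) + ((A - B) *ᵥ v) ⬝ᵥ ((A - B) *ᵥ v)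
      = 2 * ((A *ᵥ v) ⬝ᵥ (A *ᵥ v)) + 2 * ((B *ᵥ v) ⬝ᵥ (B *ᵥ v)) := by
    intro v
    simp only [Matrix.add_mulVec, Matrix.sub_mulVec, add_dotProduct, sub_dotProduct,
      dotProduct_add, dotProduct_sub]
    ring
  have hp : ∀ v, ((A + B) *ᵥ v) ⬝ᵥ ((A + B) *ᵥ v) ≤ 4 * a * (v ⬝ᵥ v) := fun v => by
    linarith [hsum v, hAa v, hBa v, dot_self_nonneg ((A - B) *ᵥ v)]
  have hm : ∀ v, ((A - B) *ᵥ v) ⬝ᵥ ((A - B) *ᵥ v) ≤ 4 * a * (v ⬝ᵥ v) := fun v => by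
    linarith [hsum v, hAa v, hBa v, dot_self_nonneg ((A + B) *ᵥ v)]
  have q : ∀ M : Matrix (Fin n) (Fin n) ℝ, (∀ v, (M *ᵥ v) ⬝ᵥ (M *ᵥ v) ≤ 4 * a * (v ⬝ᵥ v)) →
      MeanLE π (fun z => ((M *ᵥ z) ⬝ᵥ (M *ᵥ z) - (S * (Mᵀ * M)).trace) ^ 2)
        (K * ((4 * a) ^ 2 + 4 * a * (S * (Mᵀ * M)).trace)) := fun M hM => by
    have e : ∀ v : Fin n → ℝ, v ⬝ᵥ (Mᵀ * M) *ᵥ v = (M *ᵥ v) ⬝ᵥ (M *ᵥ v) := by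
      intro v
      rw [← Matrix.mulVec_mulVec, Matrix.dotProduct_mulVec, Matrix.vecMul_transpose]
    have hpsd : (Mᵀ * M).PosSemidef := by
      simpa using Matrix.posSemidef_conjTranspose_mul_self M
    have := h.meanLE_quad hpsd (a := 4 * a) (by positivity) (fun v => by rw [e]; exact hM v)
    simpa only [e] using this
  have hcomm : (S * (B * A)).trace = (S * (A * B)).trace := by
    rw [← Matrix.trace_transpose, Matrix.transpose_mul, Matrix.transpose_mul, hA, hB, h.transpose,
      Matrix.trace_mul_comm]
  have htr1 : (S * ((A + B)ᵀ * (A + B))).trace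
      = (S * (A * A)).trace + (S * (B * B)).trace + 2 * (S * (A * B)).trace := by
    rw [Matrix.transpose_add, hA, hB]
    simp only [add_mul, mul_add, Matrix.trace_add]
    linarith
  have htr2 : (S * ((A - B)ᵀ * (A - B))).trace
      = (S * (A * A)).trace + (S * (B * B)).trace - 2 * (S * (A * B)).trace := by
    rw [Matrix.transpose_sub, hA, hB]
    simp only [sub_mul, mul_sub, Matrix.trace_sub]
    linarith
  have key := ((q _ hp).add (q _ hm)).const_mul (a := 1 / 8) (by norm_num)
  refine (key.weaken (le_of_eq ?_)).mono (by fun_prop) (fun z => sq_nonneg _) fun z => ?_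
  · rw [htr1, htr2]; ring
  · have e1 : z ⬝ᵥ (A * B) *ᵥ z = (A *ᵥ z) ⬝ᵥ (B *ᵥ z) := by
      rw [← Matrix.mulVec_mulVec, ← mulVec_dot hA]
    have e2 : (B *ᵥ z) ⬝ᵥ (A *ᵥ z) = (A *ᵥ z) ⬝ᵥ (B *ᵥ z) := dotProduct_comm _ _
    rw [htr1, htr2, e1]
    simp only [Matrix.add_mulVec, Matrix.sub_mulVec, add_dotProduct, sub_dotProduct,
      dotProduct_add, dotProduct_sub, e2]
    set x := (A *ᵥ z) ⬝ᵥ (A *ᵥ z)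
    set y := (B *ᵥ z) ⬝ᵥ (B *ᵥ z)
    set c := (A *ᵥ z) ⬝ᵥ (B *ᵥ z)
    nlinarith [sq_nonneg (x + y - ((S * (A * A)).trace + (S * (B * B)).trace))]

end Concentrated

end Moments

end LinearESN

namespace LinearESN

/-! ### Sample covariance matrices and their leave-one-out versions -/

section Gram

variable {n N : ℕ}

/-- The contribution `N⁻¹ ∑_{j ∈ J} z_j z_jᵀ` of the samples in `J` to `N⁻¹ Z Zᵀ`. -/
noncomputable def gram (J : Finset (Fin N)) (Z : Fin N → Fin n → ℝ) : Matrix (Fin n) (Fin n) ℝ :=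
  (1 / (N : ℝ)) • ∑ j ∈ J, Matrix.vecMulVec (Z j) (Z j)

lemma gram_posSemidef (J : Finset (Fin N)) (Z : Fin N → Fin n → ℝ) : (gram J Z).PosSemidef := by
  refine (Matrix.posSemidef_sum J fun j _ => ?_).smul (by positivity)
  simpa using Matrix.posSemidef_vecMulVec_self_star (Z j)

lemma gram_quad (J : Finset (Fin N)) (Z : Fin N → Fin n → ℝ) (v w : Fin n → ℝ) :
    v ⬝ᵥ gram J Z *ᵥ w = 1 / (N : ℝ) * ∑ j ∈ J, (v ⬝ᵥ Z j) * (Z j ⬝ᵥ w) := by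
  rw [gram, Matrix.smul_mulVec, dotProduct_smul, smul_eq_mul, Matrix.sum_mulVec, dotProduct_sum]
  congr 1
  refine Finset.sum_congr rfl fun j _ => ?_
  rw [Matrix.vecMulVec_mulVec]
  simp
  ring

lemma gram_univ (i : Fin N) (Z : Fin N → Fin n → ℝ) :
    gram Finset.univ Z
      = gram (Finset.univ.erase i) Z + (1 / (N : ℝ)) • Matrix.vecMulVec (Z i) (Z i) := by
  rw [gram, gram, ← smul_add, Finset.sum_erase_add _ (fun j => Matrix.vecMulVec (Z j) (Z j))
    (Finset.mem_univ i)]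

lemma gram_erase_update (i : Fin N) (Z : Fin N → Fin n → ℝ) (a : Fin n → ℝ) :
    gram (Finset.univ.erase i) (Function.update Z i a) = gram (Finset.univ.erase i) Z := by
  rw [gram, gram]
  congr 1
  refine Finset.sum_congr rfl fun j hj => ?_
  rw [Function.update_of_ne (Finset.ne_of_mem_erase hj)]

@[fun_prop]
lemma continuous_gram (J : Finset (Fin N)) :
    Continuous fun Z : Fin N → Fin n → ℝ => gram J Z := by
  unfold gram
  refine continuous_matrix fun a b => ?_
  simp only [Matrix.smul_apply, Matrix.sum_apply, Matrix.vecMulVec_apply]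
  fun_prop

lemma continuous_ridge {X : Type*} [TopologicalSpace X] {A : X → Matrix (Fin n) (Fin n) ℝ}
    (hA : Continuous A) (hp : ∀ x, (A x).PosSemidef) {lam : ℝ} (hl : 0 < lam) :
    Continuous fun x => ridge lam (A x) := by
  have hc : Continuous fun x => A x + lam • (1 : Matrix (Fin n) (Fin n) ℝ) :=
    hA.add continuous_const
  unfold ridge
  simp only [Matrix.inv_def, Ring.inverse_eq_inv']
  refine Continuous.smul (hc.matrix_det.inv₀ fun x => ?_) hc.matrix_adjugate
  exact (reg_isUnit (hp x) hl).ne_zero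

/-- The resolvent of the samples in `J`. -/
noncomputable def res (lam : ℝ) (J : Finset (Fin N)) (Z : Fin N → Fin n → ℝ) :
    Matrix (Fin n) (Fin n) ℝ :=
  ridge lam (gram J Z)

lemma continuous_res {lam : ℝ} (hl : 0 < lam) (J : Finset (Fin N)) :
    Continuous fun Z : Fin N → Fin n → ℝ => res lam J Z :=
  continuous_ridge (continuous_gram J) (gram_posSemidef J) hl

lemma res_erase_update (lam : ℝ) (i : Fin N) (Z : Fin N → Fin n → ℝ) (a : Fin n → ℝ) :
    res lam (Finset.univ.erase i) (Function.update Z i a) = res lam (Finset.univ.erase i) Z := by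
  rw [res, res, gram_erase_update]

lemma res_posSemidef {lam : ℝ} (hl : 0 < lam) (J : Finset (Fin N)) (Z : Fin N → Fin n → ℝ) :
    (res lam J Z).PosSemidef :=
  ridge_posSemidef (gram_posSemidef J Z) hl

lemma res_transpose {lam : ℝ} (hl : 0 < lam) (J : Finset (Fin N)) (Z : Fin N → Fin n → ℝ) :
    (res lam J Z)ᵀ = res lam J Z :=
  psd_transpose (res_posSemidef hl J Z)

/-- The rank-one denominator term `N⁻¹ yᵀ Q₋ y` of a fresh sample `y`. -/
noncomputable def loo (lam : ℝ) (i : Fin N) (Z : Fin N → Fin n → ℝ) (y : Fin n → ℝ) : ℝ :=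
  1 / (N : ℝ) * (y ⬝ᵥ res lam (Finset.univ.erase i) Z *ᵥ y)

lemma loo_nonneg {lam : ℝ} (hl : 0 < lam) (i : Fin N) (Z : Fin N → Fin n → ℝ) (y : Fin n → ℝ) :
    0 ≤ loo lam i Z y :=
  mul_nonneg (by positivity) (psd_nonneg (res_posSemidef hl _ _) y)

lemma res_mulVec_self {lam : ℝ} (hl : 0 < lam) (i : Fin N) (Z : Fin N → Fin n → ℝ) :
    res lam Finset.univ Z *ᵥ Z i
      = (1 / (1 + loo lam i Z (Z i))) • (res lam (Finset.univ.erase i) Z *ᵥ Z i) := by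
  rw [res, gram_univ i, ridge_rankOne_self (gram_posSemidef _ Z) hl (by positivity)]
  rfl

/-- The Sherman–Morrison formula for the sample `i`. -/
lemma res_mulVec {lam : ℝ} (hl : 0 < lam) (i : Fin N) (Z : Fin N → Fin n → ℝ) (w : Fin n → ℝ) :
    res lam Finset.univ Z *ᵥ w = res lam (Finset.univ.erase i) Z *ᵥ w
      - (1 / (N : ℝ) * (Z i ⬝ᵥ res lam (Finset.univ.erase i) Z *ᵥ w) / (1 + loo lam i Z (Z i)))
        • (res lam (Finset.univ.erase i) Z *ᵥ Z i) := by
  conv_lhs => rw [res, gram_univ i, ridge_rankOne (gram_posSemidef _ Z) hl (by positivity)]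
  rfl

/-- Against the sample `i` itself, the full resolvent is the leave-one-out one divided by
 `1 + N⁻¹ z_iᵀ Q₋ z_i`. -/
lemma dot_res_mulVec_self {lam : ℝ} (hl : 0 < lam) (i : Fin N) (Z : Fin N → Fin n → ℝ)
    (w : Fin n → ℝ) :
    Z i ⬝ᵥ res lam Finset.univ Z *ᵥ w
      = (Z i ⬝ᵥ res lam (Finset.univ.erase i) Z *ᵥ w) / (1 + loo lam i Z (Z i)) := by
  rw [← mulVec_dot (res_transpose hl _ Z), res_mulVec_self hl i, smul_dotProduct,
    mulVec_dot (res_transpose hl _ Z), smul_eq_mul]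
  ring

/-! ### The sample matrix controls the second moment matrix -/

/-- The sum of the centred samples in `J`. -/
def centredSum (m : Fin n → ℝ) (J : Finset (Fin N)) (Z : Fin N → Fin n → ℝ) : Fin n → ℝ :=
  ∑ j ∈ J, (Z j - m)

variable {π : Measure (Fin n → ℝ)} [IsProbabilityMeasure π] {m : Fin n → ℝ}
  {S : Matrix (Fin n) (Fin n) ℝ} {K : ℝ}

@[fun_prop]
lemma continuous_centredSum (J : Finset (Fin N)) :
    Continuous fun Z : Fin N → Fin n → ℝ => centredSum m J Z := by
  unfold centredSum; fun_prop

lemma centredSum_update {J : Finset (Fin N)} {i : Fin N} (hi : i ∉ J) (Z : Fin N → Fin n → ℝ)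
    (a : Fin n → ℝ) : centredSum m J (Function.update Z i a) = centredSum m J Z := by
  refine Finset.sum_congr rfl fun j hj => ?_
  rw [Function.update_of_ne]
  rintro rfl; exact hi hj

lemma Concentrated.integral_centred (h : Concentrated π m S K) (s : Fin n → ℝ) :
    ∫ y, s ⬝ᵥ (y - m) ∂π = 0 := by
  simp only [dotProduct_sub]
  rw [integral_sub (h.integrable_lin s) (integrable_const _), h.integral_lin]
  simp

/-- The samples are added one at a time;
the cross term with the new centred sample has mean zero. -/
lemma Concentrated.meanLE_centredSum_sq (h : Concentrated π m S K) (J : Finset (Fin N)) :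
    MeanLE (Measure.pi fun _ : Fin N => π)
      (fun Z => centredSum m J Z ⬝ᵥ centredSum m J Z) (J.card * ((K + 1) * n)) := by
  have hK := h.nonneg
  induction J using Finset.induction_on with
  | empty => simpa [centredSum] using MeanLE.const (μ := Measure.pi fun _ : Fin N => π) le_rfl
  | insert a J ha ih =>
    have hin : ∀ s : Fin n → ℝ, MeanLE π (fun y => (s + (y - m)) ⬝ᵥ (s + (y - m)))
        (s ⬝ᵥ s + (K + 1) * n) := by
      intro s
      have e : ∀ y : Fin n → ℝ, (s + (y - m)) ⬝ᵥ (s + (y - m))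
          = s ⬝ᵥ s + 2 * (s ⬝ᵥ (y - m)) + (y - m) ⬝ᵥ (y - m) := by
        intro y
        rw [dotProduct_add, add_dotProduct, add_dotProduct, dotProduct_comm (y - m) s]
        ring
      have i1 : Integrable (fun y => s ⬝ᵥ (y - m)) π := (h.memLp_lin_sub s).integrable (by norm_num)
      have i3 := h.meanLE_normSq_sub.integrable
      refine MeanLE.of_integrable (by fun_prop) (fun y => dot_self_nonneg _) ?_ ?_
      · simp only [e]
        exact ((integrable_const _).add (i1.const_mul 2)).add i3
      · simp only [e]
        have i12 : Integrable (fun y : Fin n → ℝ => s ⬝ᵥ s + 2 * (s ⬝ᵥ (y - m))) π :=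
          (integrable_const _).add (i1.const_mul 2)
        rw [integral_add i12 i3, integral_add (integrable_const _) (i1.const_mul 2), integral_const_mul,
          h.integral_centred]
        simpa using h.meanLE_normSq_sub.integral_le
    have := MeanLE.coord (π := π) (f := fun Z y => (centredSum m J Z + (y - m)) ⬝ᵥ
        (centredSum m J Z + (y - m))) a
      (fun Z b y => by simp only [centredSum_update ha])
      (MeanLE.prod (by fun_prop) (fun Z => hin _)
        (ih.add (MeanLE.const (c := (K + 1) * n) (by positivity))))
    rw [Finset.card_insert_of_notMem ha]
    refine (this.weaken (le_of_eq (by push_cast; ring))).mono (by fun_prop)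
      (fun Z => dot_self_nonneg _) fun Z => le_of_eq ?_
    rw [centredSum, Finset.sum_insert ha, add_comm]
    rfl

/-- The analogue of `meanLE_centredSum_sq` for the fourth power of the norm: the only term of odd
order in the new centred sample that is kept is linear, and has mean zero. -/
lemma Concentrated.meanLE_centredSum_four (h : Concentrated π m S K) (J : Finset (Fin N)) :
    MeanLE (Measure.pi fun _ : Fin N => π)
      (fun Z => (centredSum m J Z ⬝ᵥ centredSum m J Z) ^ 2)
      (4 * (J.card * ((K + 1) * n)) ^ 2 + 3 * (J.card * (K * n ^ 2))) := by
  have hK := h.nonneg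
  induction J using Finset.induction_on with
  | empty => simpa [centredSum] using MeanLE.const (μ := Measure.pi fun _ : Fin N => π) le_rfl
  | insert a J ha ih =>
    have hin : ∀ s : Fin n → ℝ, MeanLE π (fun y => ((s + (y - m)) ⬝ᵥ (s + (y - m))) ^ 2)
        ((s ⬝ᵥ s) ^ 2 + 8 * ((K + 1) * n) * (s ⬝ᵥ s) + 3 * (K * n ^ 2)) := by
      intro s
      have i1 : Integrable (fun y => s ⬝ᵥ (y - m)) π := (h.memLp_lin_sub s).integrable (by norm_num)
      have i3 := h.meanLE_normSq_sub.integrable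
      have i4 := h.meanLE_normSq_sub_sq.integrable
      have e : ∀ y : Fin n → ℝ, (s + (y - m)) ⬝ᵥ (s + (y - m))
          = s ⬝ᵥ s + 2 * (s ⬝ᵥ (y - m)) + (y - m) ⬝ᵥ (y - m) := by
        intro y
        rw [dotProduct_add, add_dotProduct, add_dotProduct, dotProduct_comm (y - m) s]
        ring
      have hle : ∀ y : Fin n → ℝ, ((s + (y - m)) ⬝ᵥ (s + (y - m))) ^ 2
          ≤ (s ⬝ᵥ s) ^ 2 + 4 * (s ⬝ᵥ s) * (s ⬝ᵥ (y - m))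
            + 8 * (s ⬝ᵥ s) * ((y - m) ⬝ᵥ (y - m)) + 3 * ((y - m) ⬝ᵥ (y - m)) ^ 2 := by
        intro y
        rw [e]
        have c := dot_cauchy_schwarz s (y - m)
        set a := s ⬝ᵥ s
        set b := s ⬝ᵥ (y - m)
        set x := (y - m) ⬝ᵥ (y - m)
        nlinarith [sq_nonneg (b - x / 2), sq_nonneg (b - x)]
      have ib : Integrable (fun y : Fin n → ℝ => (s ⬝ᵥ s) ^ 2 + 4 * (s ⬝ᵥ s) * (s ⬝ᵥ (y - m))
            + 8 * (s ⬝ᵥ s) * ((y - m) ⬝ᵥ (y - m)) + 3 * ((y - m) ⬝ᵥ (y - m)) ^ 2) π :=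
        (((integrable_const _).add (i1.const_mul _)).add (i3.const_mul _)).add (i4.const_mul _)
      have ii : Integrable (fun y : Fin n → ℝ => ((s + (y - m)) ⬝ᵥ (s + (y - m))) ^ 2) π := by
        refine ib.mono' (Measurable.aestronglyMeasurable (by fun_prop)) (ae_of_all _ fun y => ?_)
        rw [Real.norm_eq_abs, abs_of_nonneg (sq_nonneg _)]
        exact hle y
      refine MeanLE.of_integrable (by fun_prop) (fun y => sq_nonneg _) ii ?_
      refine (integral_mono ii ib hle).trans ?_
      have i12 : Integrable (fun y : Fin n → ℝ =>
          (s ⬝ᵥ s) ^ 2 + 4 * (s ⬝ᵥ s) * (s ⬝ᵥ (y - m))) π :=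
        (integrable_const _).add (i1.const_mul _)
      have i123 : Integrable (fun y : Fin n → ℝ =>
          (s ⬝ᵥ s) ^ 2 + 4 * (s ⬝ᵥ s) * (s ⬝ᵥ (y - m))
            + 8 * (s ⬝ᵥ s) * ((y - m) ⬝ᵥ (y - m))) π :=
        i12.add (i3.const_mul _)
      rw [integral_add i123 (i4.const_mul _), integral_add i12 (i3.const_mul _),
        integral_add (integrable_const _) (i1.const_mul _), integral_const_mul,
        integral_const_mul, integral_const_mul, h.integral_centred]
      have l1 := h.meanLE_normSq_sub.integral_le
      have l2 := h.meanLE_normSq_sub_sq.integral_le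
      have := mul_le_mul_of_nonneg_left l1
        (show 0 ≤ 8 * (s ⬝ᵥ s) by linarith [dot_self_nonneg s])
      simp only [integral_const, probReal_univ, smul_eq_mul, one_mul, mul_zero, add_zero]
      linarith
    have := MeanLE.coord (π := π) (f := fun Z y => ((centredSum m J Z + (y - m)) ⬝ᵥ
        (centredSum m J Z + (y - m))) ^ 2) a
      (fun Z b y => by simp only [centredSum_update ha])
      (MeanLE.prod (by fun_prop) (fun Z => hin _)
        ((ih.add ((h.meanLE_centredSum_sq J).const_mul (a := 8 * ((K + 1) * n))
          (by positivity))).add (MeanLE.const (c := 3 * (K * n ^ 2)) (by positivity))))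
    rw [Finset.card_insert_of_notMem ha]
    refine (this.weaken ?_).mono (by fun_prop)
      (fun Z => sq_nonneg _) fun Z => le_of_eq ?_
    · push_cast
      nlinarith [sq_nonneg ((K + 1) * (n : ℝ))]
    · rw [centredSum, Finset.sum_insert ha, add_comm]
      rfl

/-- A random factor `L` with `S ≤ L (N⁻¹ Z₋ Z₋ᵀ + lam I)`, where `Z₋` omits the sample `i`. The mean
`m` may be large; it is compensated by the average of the samples. -/
noncomputable def loewner (K lam : ℝ) (m : Fin n → ℝ) (i : Fin N) (Z : Fin N → Fin n → ℝ) : ℝ :=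
  4 + (K + 1 + 2 * ((centredSum m (Finset.univ.erase i) Z ⬝ᵥ centredSum m (Finset.univ.erase i) Z)
    / ((N : ℝ) - 1) ^ 2)) / lam

@[fun_prop]
lemma continuous_loewner (K lam : ℝ) (i : Fin N) :
    Continuous fun Z : Fin N → Fin n → ℝ => loewner K lam m i Z := by
  unfold loewner; fun_prop

lemma Concentrated.one_le_loewner (h : Concentrated π m S K) {lam : ℝ} (hl : 0 < lam) (i : Fin N)
    (Z : Fin N → Fin n → ℝ) : 1 ≤ loewner K lam m i Z := by
  have := h.nonneg
  have h1 := dot_self_nonneg (centredSum m (Finset.univ.erase i) Z)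
  have : 0 ≤ (K + 1 + 2 * ((centredSum m (Finset.univ.erase i) Z ⬝ᵥ
    centredSum m (Finset.univ.erase i) Z) / ((N : ℝ) - 1) ^ 2)) / lam := by positivity
  rw [loewner]; linarith

/-- The covariance part of `S` is bounded by `K + 1`. The mean part `(vᵀ m)²` is compared with the
empirical mean of `vᵀ z_j`, which differs from `vᵀ m` by `vᵀ c / (N - 1)` with `c` the centred sum;
the square of the empirical mean is at most the empirical second moment. -/
lemma Concentrated.le_loewner (h : Concentrated π m S K) {lam : ℝ} (hl : 0 < lam) (hN : 2 ≤ N)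
    (i : Fin N) (Z : Fin N → Fin n → ℝ) (v : Fin n → ℝ) :
    v ⬝ᵥ S *ᵥ v ≤ loewner K lam m i Z
      * (v ⬝ᵥ gram (Finset.univ.erase i) Z *ᵥ v + lam * (v ⬝ᵥ v)) := by
  have hN' : (2 : ℝ) ≤ N := by exact_mod_cast hN
  have hM : 0 < (N : ℝ) - 1 := by linarith
  set J := Finset.univ.erase i
  have hcard : (J.card : ℝ) = (N : ℝ) - 1 := by
    rw [Finset.card_erase_of_mem (Finset.mem_univ i), Finset.card_univ, Fintype.card_fin,
      Nat.cast_sub (by omega)]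
    simp
  set c := centredSum m J Z with hc
  have e1 : v ⬝ᵥ c = ∑ j ∈ J, v ⬝ᵥ Z j - ((N : ℝ) - 1) * (v ⬝ᵥ m) := by
    rw [hc, centredSum, dotProduct_sum]
    simp only [dotProduct_sub, Finset.sum_sub_distrib, Finset.sum_const, nsmul_eq_mul, hcard]
  have e2 : (∑ j ∈ J, v ⬝ᵥ Z j) ^ 2 ≤ ((N : ℝ) - 1) * ∑ j ∈ J, (v ⬝ᵥ Z j) ^ 2 := by
    have := sq_sum_le_card_mul_sum_sq (s := J) (f := fun j => v ⬝ᵥ Z j)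
    rwa [hcard] at this
  have e3 : v ⬝ᵥ gram J Z *ᵥ v = 1 / (N : ℝ) * ∑ j ∈ J, (v ⬝ᵥ Z j) ^ 2 := by
    rw [gram_quad]
    congr 1
    exact Finset.sum_congr rfl fun j _ => by rw [dotProduct_comm (Z j) v]; ring
  have e4 := dot_cauchy_schwarz v c
  have e5 := h.quad_le v
  have g0 := psd_nonneg (gram_posSemidef J Z) v
  have v0 := dot_self_nonneg v
  have c0 := dot_self_nonneg c
  have hK := h.nonneg
  have e6 : ∑ j ∈ J, (v ⬝ᵥ Z j) ^ 2 = N * (v ⬝ᵥ gram J Z *ᵥ v) := by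
    rw [e3]; field_simp
  have e7 : (((N : ℝ) - 1) * (v ⬝ᵥ m)) ^ 2
      ≤ 2 * (((N : ℝ) - 1) * (N * (v ⬝ᵥ gram J Z *ᵥ v))) + 2 * ((v ⬝ᵥ v) * (c ⬝ᵥ c)) := by
    have : ((N : ℝ) - 1) * (v ⬝ᵥ m) = ∑ j ∈ J, v ⬝ᵥ Z j - v ⬝ᵥ c := by rw [e1]; ring
    rw [this, ← e6]
    nlinarith [sq_nonneg (∑ j ∈ J, v ⬝ᵥ Z j + v ⬝ᵥ c)]
  have e8 : (v ⬝ᵥ m) ^ 2 ≤ 4 * (v ⬝ᵥ gram J Z *ᵥ v)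
      + 2 * (c ⬝ᵥ c / ((N : ℝ) - 1) ^ 2) * (v ⬝ᵥ v) := by
    have h1 : (v ⬝ᵥ m) ^ 2 * ((N : ℝ) - 1) ^ 2
        ≤ (4 * (v ⬝ᵥ gram J Z *ᵥ v) + 2 * (c ⬝ᵥ c / ((N : ℝ) - 1) ^ 2) * (v ⬝ᵥ v))
          * ((N : ℝ) - 1) ^ 2 := by
      have h2 : (4 * (v ⬝ᵥ gram J Z *ᵥ v) + 2 * (c ⬝ᵥ c / ((N : ℝ) - 1) ^ 2) * (v ⬝ᵥ v))
          * ((N : ℝ) - 1) ^ 2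
          = 4 * (v ⬝ᵥ gram J Z *ᵥ v) * ((N : ℝ) - 1) ^ 2 + 2 * ((v ⬝ᵥ v) * (c ⬝ᵥ c)) := by
        field_simp
      rw [h2]
      have h3 : (N : ℝ) ≤ 2 * ((N : ℝ) - 1) := by linarith
      have h4 := mul_le_mul_of_nonneg_left h3 (mul_nonneg hM.le g0)
      nlinarith
    exact le_of_mul_le_mul_right h1 (by positivity)
  have e9 : loewner K lam m i Z * (v ⬝ᵥ gram J Z *ᵥ v + lam * (v ⬝ᵥ v))
      = 4 * (v ⬝ᵥ gram J Z *ᵥ v) + 4 * (lam * (v ⬝ᵥ v))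
        + (K + 1 + 2 * (c ⬝ᵥ c / ((N : ℝ) - 1) ^ 2)) / lam * (v ⬝ᵥ gram J Z *ᵥ v)
        + (K + 1 + 2 * (c ⬝ᵥ c / ((N : ℝ) - 1) ^ 2)) * (v ⬝ᵥ v) := by
    rw [loewner]; field_simp; ring
  have p1 : 0 ≤ (K + 1 + 2 * (c ⬝ᵥ c / ((N : ℝ) - 1) ^ 2)) / lam * (v ⬝ᵥ gram J Z *ᵥ v) := by
    positivity
  have p2 : 0 ≤ 4 * (lam * (v ⬝ᵥ v)) := by positivity
  rw [e9]
  nlinarith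

/-- The bound on the second moment of the factor `loewner`. -/
noncomputable def loewnerConst (K lam g : ℝ) : ℝ :=
  2 * (4 + (K + 1) / lam) ^ 2 + 8 / lam ^ 2 * (16 * ((K + 1) * g) ^ 2 + 12 * (K * g ^ 2))

lemma loewnerConst_nonneg {K lam g : ℝ} (hK : 0 ≤ K) : 0 ≤ loewnerConst K lam g := by
  unfold loewnerConst; positivity

/-- The second moment of the factor `loewner` is bounded uniformly in the dimension. -/
lemma Concentrated.meanLE_loewner_sq (h : Concentrated π m S K) {lam : ℝ} (hl : 0 < lam)
    (hN : 2 ≤ N) {g : ℝ} (hg : (n : ℝ) ≤ g * N) (i : Fin N) :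
    MeanLE (Measure.pi fun _ : Fin N => π) (fun Z => loewner K lam m i Z ^ 2)
      (loewnerConst K lam g) := by
  have hN' : (2 : ℝ) ≤ N := by exact_mod_cast hN
  have hM : 0 < (N : ℝ) - 1 := by linarith
  have hK := h.nonneg
  have hcard : ((Finset.univ.erase i).card : ℝ) = (N : ℝ) - 1 := by
    rw [Finset.card_erase_of_mem (Finset.mem_univ i), Finset.card_univ, Fintype.card_fin,
      Nat.cast_sub (by omega)]
    simp
  have h4 := (h.meanLE_centredSum_four (Finset.univ.erase i)).const_mul
    (a := 8 / lam ^ 2 / ((N : ℝ) - 1) ^ 4) (by positivity)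
  have := (MeanLE.const (μ := Measure.pi fun _ : Fin N => π)
    (c := 2 * (4 + (K + 1) / lam) ^ 2) (by positivity)).add h4
  have hg0 : 0 ≤ g := by
    by_contra hneg
    push Not at hneg
    nlinarith [Nat.cast_nonneg (α := ℝ) n]
  have hn2 : (n : ℝ) ≤ 2 * g * ((N : ℝ) - 1) := by nlinarith
  have hn2' : (n : ℝ) ^ 2 ≤ (2 * g * ((N : ℝ) - 1)) ^ 2 :=
    pow_le_pow_left₀ (Nat.cast_nonneg _) hn2 2
  refine (this.weaken ?_).mono (by fun_prop) (fun Z => sq_nonneg _) fun Z => ?_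
  · rw [hcard]
    refine add_le_add le_rfl ?_
    rw [div_mul_eq_mul_div, mul_div_assoc]
    refine mul_le_mul_of_nonneg_left ?_ (by positivity)
    rw [div_le_iff₀ (by positivity)]
    have a1 : 4 * (((N : ℝ) - 1) * ((K + 1) * n)) ^ 2
        ≤ 16 * ((K + 1) * g) ^ 2 * ((N : ℝ) - 1) ^ 4 := by
      have := mul_le_mul_of_nonneg_left hn2'
        (show 0 ≤ 4 * (((N : ℝ) - 1) * (K + 1)) ^ 2 by positivity)
      nlinarith
    have a2 : 3 * (((N : ℝ) - 1) * (K * n ^ 2)) ≤ 12 * (K * g ^ 2) * ((N : ℝ) - 1) ^ 4 := by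
      have b1 := mul_le_mul_of_nonneg_left hn2' (show 0 ≤ 3 * (((N : ℝ) - 1) * K) by positivity)
      have b2 : ((N : ℝ) - 1) ^ 3 ≤ ((N : ℝ) - 1) ^ 4 :=
        pow_le_pow_right₀ (by linarith) (by norm_num)
      have b3 := mul_le_mul_of_nonneg_left b2 (show 0 ≤ 12 * (K * g ^ 2) by positivity)
      nlinarith
    linarith
  · rw [loewner]
    set c := centredSum m (Finset.univ.erase i) Z ⬝ᵥ centredSum m (Finset.univ.erase i) Z
    have e : 4 + (K + 1 + 2 * (c / ((N : ℝ) - 1) ^ 2)) / lam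
        = (4 + (K + 1) / lam) + 2 * c / (lam * ((N : ℝ) - 1) ^ 2) := by
      field_simp; ring
    have e2 : 8 / lam ^ 2 / ((N : ℝ) - 1) ^ 4 * c ^ 2
        = 2 * (2 * c / (lam * ((N : ℝ) - 1) ^ 2)) ^ 2 := by
      field_simp; ring
    rw [e, e2]
    nlinarith [sq_nonneg ((4 + (K + 1) / lam) - 2 * c / (lam * ((N : ℝ) - 1) ^ 2))]

end Gram

end LinearESN

namespace LinearESN

/-! ### Concentration of the normalised trace around the fixed point -/

section FixedPointConvergence

variable {n N : ℕ}

/-- The removal of one sample changes the resolvent by a matrix of rank one. -/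
lemma res_erase_sub {lam : ℝ} (hl : 0 < lam) (i : Fin N) (Z : Fin N → Fin n → ℝ) :
    res lam (Finset.univ.erase i) Z - res lam Finset.univ Z
      = (1 / (N : ℝ) / (1 + loo lam i Z (Z i))) •
        Matrix.vecMulVec (res lam (Finset.univ.erase i) Z *ᵥ Z i)
          (res lam (Finset.univ.erase i) Z *ᵥ Z i) := by
  refine Matrix.ext_of_mulVec_single fun j => ?_
  rw [Matrix.sub_mulVec, res_mulVec hl i, Matrix.smul_mulVec, Matrix.vecMulVec_mulVec,
    mulVec_dot (res_transpose hl _ Z)]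
  simp only [sub_sub_cancel, op_smul_eq_smul, smul_smul]
  congr 1
  ring

lemma loo_mul_N (lam : ℝ) (i : Fin N) (Z : Fin N → Fin n → ℝ) (y : Fin n → ℝ) :
    y ⬝ᵥ res lam (Finset.univ.erase i) Z *ᵥ y = N * loo lam i Z y := by
  have : (N : ℝ) ≠ 0 := by
    have := i.pos
    positivity
  rw [loo]; field_simp

lemma loo_frac_le {lam : ℝ} (hl : 0 < lam) (i : Fin N) (Z : Fin N → Fin n → ℝ) :
    loo lam i Z (Z i) / (1 + loo lam i Z (Z i)) ≤ 1 := by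
  have := loo_nonneg hl i Z (Z i)
  rw [div_le_one (by linarith)]
  linarith

variable {π : Measure (Fin n → ℝ)} [IsProbabilityMeasure π] {m : Fin n → ℝ}
  {S : Matrix (Fin n) (Fin n) ℝ} {K lam : ℝ}

/-- The normalised trace `N⁻¹ Tr(S Q)`. -/
noncomputable def resTrace (S : Matrix (Fin n) (Fin n) ℝ) (lam : ℝ) (J : Finset (Fin N))
    (Z : Fin N → Fin n → ℝ) : ℝ :=
  1 / (N : ℝ) * (S * res lam J Z).trace

lemma resTrace_nonneg (hS : S.PosSemidef) (hl : 0 < lam) (J : Finset (Fin N))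
    (Z : Fin N → Fin n → ℝ) : 0 ≤ resTrace S lam J Z :=
  mul_nonneg (by positivity) (trace_mul_nonneg hS (res_posSemidef hl J Z))

lemma continuous_resTrace (hl : 0 < lam) (J : Finset (Fin N)) :
    Continuous fun Z : Fin N → Fin n → ℝ => resTrace S lam J Z := by
  have := continuous_res (n := n) hl J
  unfold resTrace
  exact continuous_const.mul (continuous_const.matrix_mul this).matrix_trace

lemma resTrace_erase_sub (hl : 0 < lam) (i : Fin N) (Z : Fin N → Fin n → ℝ) :
    resTrace S lam (Finset.univ.erase i) Z - resTrace S lam Finset.univ Z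
      = 1 / (N : ℝ) * (1 / (N : ℝ) / (1 + loo lam i Z (Z i))
        * ((res lam (Finset.univ.erase i) Z *ᵥ Z i) ⬝ᵥ
          S *ᵥ (res lam (Finset.univ.erase i) Z *ᵥ Z i))) := by
  rw [resTrace, resTrace, ← mul_sub, ← Matrix.trace_sub, ← mul_sub, res_erase_sub hl,
    mul_smul_comm, Matrix.trace_smul, trace_mul_vecMulVec, smul_eq_mul]

lemma resTrace_le_erase (hS : S.PosSemidef) (hl : 0 < lam) (i : Fin N) (Z : Fin N → Fin n → ℝ) :
    resTrace S lam Finset.univ Z ≤ resTrace S lam (Finset.univ.erase i) Z := by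
  rw [← sub_nonneg, resTrace_erase_sub hl]
  have h1 := loo_nonneg hl i Z (Z i)
  have h2 := psd_nonneg hS (res lam (Finset.univ.erase i) Z *ᵥ Z i)
  positivity

/-- The increment of the trace is `N⁻²` times the `S`-energy of `Q₋ z_i`, which `le_loewner` bounds by
the leave-one-out form in the denominator. -/
lemma Concentrated.resTrace_erase_sub_le (h : Concentrated π m S K) (hl : 0 < lam) (hN : 2 ≤ N)
    (i : Fin N) (Z : Fin N → Fin n → ℝ) :
    resTrace S lam (Finset.univ.erase i) Z - resTrace S lam Finset.univ Z
      ≤ loewner K lam m i Z / N := by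
  have hN' : (0 : ℝ) < N := by positivity
  rw [resTrace_erase_sub hl]
  have h1 := loo_nonneg hl i Z (Z i)
  have h2 := ridge_conj_le (gram_posSemidef _ Z) hl (h.le_loewner hl hN i Z) (Z i)
  change (res lam (Finset.univ.erase i) Z *ᵥ Z i) ⬝ᵥ
    S *ᵥ (res lam (Finset.univ.erase i) Z *ᵥ Z i) ≤ loewner K lam m i Z
      * (Z i ⬝ᵥ res lam (Finset.univ.erase i) Z *ᵥ Z i) at h2
  rw [loo_mul_N] at h2
  have h3 := h.one_le_loewner hl i Z
  have h4 := loo_frac_le hl i Z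
  set q := loo lam i Z (Z i)
  set L := loewner K lam m i Z
  calc 1 / (N : ℝ) * (1 / (N : ℝ) / (1 + q) * ((res lam (Finset.univ.erase i) Z *ᵥ Z i) ⬝ᵥ
          S *ᵥ (res lam (Finset.univ.erase i) Z *ᵥ Z i)))
      ≤ 1 / (N : ℝ) * (1 / (N : ℝ) / (1 + q) * (L * (N * q))) := by gcongr
    _ = L / N * (q / (1 + q)) := by field_simp
    _ ≤ L / N * 1 := by gcongr
    _ = L / N := mul_one _

lemma Concentrated.resTrace_erase_le (h : Concentrated π m S K) (hl : 0 < lam) (hN : 2 ≤ N)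
    {g : ℝ} (hg : (n : ℝ) ≤ g * N) (i : Fin N) (Z : Fin N → Fin n → ℝ) :
    resTrace S lam (Finset.univ.erase i) Z ≤ g * loewner K lam m i Z := by
  have hN' : (0 : ℝ) < N := by positivity
  have h1 := trace_mul_ridge_le (gram_posSemidef _ Z) hl (h.le_loewner hl hN i Z) h.transpose
  have h3 := h.one_le_loewner hl i Z
  rw [resTrace, one_div, inv_mul_le_iff₀ hN']
  refine h1.trans ?_
  nlinarith

/-! ### Relations between the deterministic resolvent `Q̄` and the fixed point -/

variable {δ : ℝ}

lemma resolvent_eq (lam δ : ℝ) (S : Matrix (Fin n) (Fin n) ℝ) :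
    resolvent lam δ S = ridge lam ((1 / (1 + δ)) • S) := rfl

lemma smul_psd (hS : S.PosSemidef) (hδ : 0 ≤ δ) : ((1 / (1 + δ)) • S).PosSemidef :=
  hS.smul (by positivity)

lemma resolvent_posSemidef (hS : S.PosSemidef) (hl : 0 < lam) (hδ : 0 ≤ δ) :
    (resolvent lam δ S).PosSemidef :=
  ridge_posSemidef (smul_psd hS hδ) hl

lemma mul_resolvent (hS : S.PosSemidef) (hl : 0 < lam) (hδ : 0 ≤ δ) :
    S * resolvent lam δ S = (1 + δ) • (1 - lam • resolvent lam δ S) := by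
  rw [resolvent_eq, ← mul_ridge (smul_psd hS hδ) hl, smul_mul_assoc, smul_smul,
    mul_one_div_cancel (by positivity), one_smul]

lemma resolvent_mul (hS : S.PosSemidef) (hl : 0 < lam) (hδ : 0 ≤ δ) :
    resolvent lam δ S * S = (1 + δ) • (1 - lam • resolvent lam δ S) := by
  rw [resolvent_eq, ← ridge_mul (smul_psd hS hδ) hl, mul_smul_comm, smul_smul,
    mul_one_div_cancel (by positivity), one_smul]

lemma one_sub_resolvent_psd (hS : S.PosSemidef) (hl : 0 < lam) (hδ : 0 ≤ δ) :
    (1 - lam • resolvent lam δ S).PosSemidef := by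
  have hp := resolvent_posSemidef hS hl hδ
  refine psd_of_nonneg (by simp [psd_transpose hp]) fun v => ?_
  have := one_sub_ridge_nonneg (smul_psd hS hδ) hl v
  rw [Matrix.sub_mulVec, Matrix.one_mulVec, Matrix.smul_mulVec, dotProduct_sub, dotProduct_smul,
    smul_eq_mul]
  exact this

/-- The mixed trace `N⁻¹ Tr(S Q Q̄)`. -/
noncomputable def mixTrace (S : Matrix (Fin n) (Fin n) ℝ) (lam δ : ℝ) (J : Finset (Fin N))
    (Z : Fin N → Fin n → ℝ) : ℝ :=
  1 / (N : ℝ) * (S * (res lam J Z * resolvent lam δ S)).trace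

/-- The mixed quadratic form `N⁻¹ yᵀ Q₋ Q̄ y` of a fresh sample `y`. -/
noncomputable def mixLoo (S : Matrix (Fin n) (Fin n) ℝ) (lam δ : ℝ) (i : Fin N)
    (Z : Fin N → Fin n → ℝ) (y : Fin n → ℝ) : ℝ :=
  1 / (N : ℝ) * (y ⬝ᵥ (res lam (Finset.univ.erase i) Z * resolvent lam δ S) *ᵥ y)

lemma mixTrace_nonneg (hS : S.PosSemidef) (hl : 0 < lam) (hδ : 0 ≤ δ) (J : Finset (Fin N))
    (Z : Fin N → Fin n → ℝ) : 0 ≤ mixTrace S lam δ J Z := by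
  refine mul_nonneg (by positivity) ?_
  rw [← mul_assoc, Matrix.trace_mul_cycle, resolvent_mul hS hl hδ]
  exact trace_mul_nonneg ((one_sub_resolvent_psd hS hl hδ).smul (by positivity))
    (res_posSemidef hl J Z)

lemma mixTrace_le (hS : S.PosSemidef) (hl : 0 < lam) (hδ : 0 ≤ δ) (J : Finset (Fin N))
    (Z : Fin N → Fin n → ℝ) : lam * mixTrace S lam δ J Z ≤ resTrace S lam J Z := by
  have e : resTrace S lam J Z - lam * mixTrace S lam δ J Z
      = 1 / (N : ℝ) * (1 / (1 + δ)) * ((S * resolvent lam δ S * S) * res lam J Z).trace := by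
    have : (S * resolvent lam δ S * S) * res lam J Z
        = S * ((1 + δ) • (1 - lam • resolvent lam δ S)) * res lam J Z := by
      rw [← resolvent_mul hS hl hδ, mul_assoc S]
    rw [this, resTrace, mixTrace]
    simp only [mul_smul_comm, smul_mul_assoc, mul_sub, mul_one, sub_mul, Matrix.trace_sub,
      Matrix.trace_smul, smul_eq_mul]
    have e2 : (S * resolvent lam δ S * res lam J Z).trace
        = (S * (res lam J Z * resolvent lam δ S)).trace := by
      rw [← Matrix.trace_transpose, Matrix.transpose_mul, Matrix.transpose_mul,
        psd_transpose hS, psd_transpose (resolvent_posSemidef hS hl hδ), res_transpose hl,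
        ← mul_assoc, Matrix.trace_mul_comm]
    rw [e2]
    field_simp
  have : 0 ≤ resTrace S lam J Z - lam * mixTrace S lam δ J Z := by
    rw [e]
    refine mul_nonneg (by positivity) (trace_mul_nonneg ?_ (res_posSemidef hl J Z))
    have := (resolvent_posSemidef hS hl hδ).mul_mul_conjTranspose_same S
    simpa [psd_transpose hS] using this
  linarith

/-- Here the bounded matrix `Q̄ S = (1 + δ) (1 - lam Q̄)` takes the place of `S`, so no random factor
enters. -/
lemma mixTrace_erase_sub (hS : S.PosSemidef) (hl : 0 < lam) (hδ : 0 ≤ δ) (i : Fin N)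
    (Z : Fin N → Fin n → ℝ) :
    |mixTrace S lam δ (Finset.univ.erase i) Z - mixTrace S lam δ Finset.univ Z|
      ≤ (1 + δ) / (lam * N) := by
  have hN' : (0 : ℝ) < N := by
    have := i.pos
    positivity
  have hp := resolvent_posSemidef hS hl hδ
  set y := res lam (Finset.univ.erase i) Z *ᵥ Z i with hy
  have e : mixTrace S lam δ (Finset.univ.erase i) Z - mixTrace S lam δ Finset.univ Z
      = 1 / (N : ℝ) * (1 / (N : ℝ) / (1 + loo lam i Z (Z i)) * ((1 + δ) *
        (y ⬝ᵥ y - lam * (y ⬝ᵥ resolvent lam δ S *ᵥ y)))) := by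
    rw [mixTrace, mixTrace, ← mul_sub, ← Matrix.trace_sub, ← mul_sub, ← sub_mul,
      res_erase_sub hl, ← mul_assoc, Matrix.trace_mul_cycle, resolvent_mul hS hl hδ,
      mul_smul_comm, Matrix.trace_smul, trace_mul_vecMulVec, Matrix.smul_mulVec,
      Matrix.sub_mulVec, Matrix.one_mulVec, Matrix.smul_mulVec, dotProduct_smul, dotProduct_sub,
      dotProduct_smul]
    simp only [smul_eq_mul]
    rfl
  have h1 := loo_nonneg hl i Z (Z i)
  have h2 : 0 ≤ y ⬝ᵥ y - lam * (y ⬝ᵥ resolvent lam δ S *ᵥ y) :=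
    one_sub_ridge_nonneg (smul_psd hS hδ) hl y
  have h3 := psd_nonneg hp y
  have h4 : lam * (y ⬝ᵥ y) ≤ N * loo lam i Z (Z i) := by
    rw [← loo_mul_N]
    exact ridge_normSq_le (gram_posSemidef _ Z) hl (Z i)
  have h5 := loo_frac_le hl i Z
  rw [e, abs_of_nonneg (by positivity)]
  set q := loo lam i Z (Z i)
  have h6 : y ⬝ᵥ y - lam * (y ⬝ᵥ resolvent lam δ S *ᵥ y) ≤ N * q / lam := by
    rw [le_div_iff₀ hl]
    nlinarith [mul_nonneg hl.le h3]
  calc 1 / (N : ℝ) * (1 / (N : ℝ) / (1 + q) * ((1 + δ) *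
        (y ⬝ᵥ y - lam * (y ⬝ᵥ resolvent lam δ S *ᵥ y))))
      ≤ 1 / (N : ℝ) * (1 / (N : ℝ) / (1 + q) * ((1 + δ) * (N * q / lam))) := by gcongr
    _ = (1 + δ) / (lam * N) * (q / (1 + q)) := by field_simp
    _ ≤ (1 + δ) / (lam * N) * 1 := by gcongr
    _ = (1 + δ) / (lam * N) := mul_one _

/-- The exact self-consistency relation satisfied by the leave-one-out forms. -/
lemma self_consistency (hS : S.PosSemidef) (hl : 0 < lam) (hδ : 0 ≤ δ) (hN : 0 < N)
    (hfix : FixedPoint N lam S δ) (Z : Fin N → Fin n → ℝ) :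
    1 / (N : ℝ) * ∑ i, (1 + lam * mixLoo S lam δ i Z (Z i)) / (1 + loo lam i Z (Z i))
      = (1 + lam * mixTrace S lam δ Finset.univ Z) / (1 + δ) := by
  have hN' : (0 : ℝ) < N := by positivity
  have hp := resolvent_posSemidef hS hl hδ
  set Qb := resolvent lam δ S with hQb
  set Q := res lam Finset.univ Z with hQ
  set A := gram Finset.univ Z with hA
  have hAQ : A * Q = 1 - lam • Q := mul_ridge (gram_posSemidef _ Z) hl
  -- With `A = N⁻¹ Z Zᵀ`, the trace of `(1 - lam Q̄) A Q` is computed in two ways: from `A Q = 1 - lam Q`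
  -- and the fixed-point equation, and as a sum over the samples that make up `A`.
  have hPb : (1 - lam • Qb) = (1 / (1 + δ)) • (Qb * S) := by
    rw [hQb, resolvent_mul hS hl hδ, smul_smul, one_div_mul_cancel (by positivity), one_smul]
  have hfix' : (S * Qb).trace = N * δ := by
    have : δ = 1 / (N : ℝ) * (S * Qb).trace := hfix
    conv_rhs => rw [this]
    field_simp
  have hmix : (S * (Q * Qb)).trace = N * mixTrace S lam δ Finset.univ Z := by
    rw [mixTrace]; field_simp; rfl
  have a1 : ((1 - lam • Qb) * (A * Q)).trace
      = 1 / (1 + δ) * (N * δ - lam * (N * mixTrace S lam δ Finset.univ Z)) := by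
    rw [hAQ, hPb, mul_sub, mul_one, mul_smul_comm, Matrix.trace_sub, Matrix.trace_smul,
      Matrix.trace_smul, smul_mul_assoc, Matrix.trace_smul, Matrix.trace_mul_comm, hfix',
      Matrix.trace_mul_cycle, Matrix.trace_mul_cycle, mul_assoc, hmix]
    simp only [smul_eq_mul]
    ring
  have a2 : ((1 - lam • Qb) * (A * Q)).trace
      = ∑ i, (loo lam i Z (Z i) - lam * mixLoo S lam δ i Z (Z i)) / (1 + loo lam i Z (Z i)) := by
    rw [← mul_assoc, Matrix.trace_mul_cycle, hA, gram, mul_smul_comm, Finset.mul_sum,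
      Matrix.trace_smul, Matrix.trace_sum, smul_eq_mul, Finset.mul_sum]
    refine Finset.sum_congr rfl fun i _ => ?_
    rw [trace_mul_vecMulVec, ← Matrix.mulVec_mulVec, dot_res_mulVec_self hl, Matrix.sub_mulVec,
      Matrix.one_mulVec, Matrix.smul_mulVec, Matrix.mulVec_sub, Matrix.mulVec_smul,
      Matrix.mulVec_mulVec, dotProduct_sub, dotProduct_smul, smul_eq_mul, loo_mul_N, mixLoo, hQb]
    field_simp
  have a3 : ∀ i, (loo lam i Z (Z i) - lam * mixLoo S lam δ i Z (Z i)) / (1 + loo lam i Z (Z i))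
      = 1 - (1 + lam * mixLoo S lam δ i Z (Z i)) / (1 + loo lam i Z (Z i)) := by
    intro i
    have := loo_nonneg hl i Z (Z i)
    field_simp
    ring
  rw [a1] at a2
  simp only [a3, Finset.sum_sub_distrib, Finset.sum_const, Finset.card_univ, Fintype.card_fin,
    nsmul_eq_mul, mul_one] at a2
  have a4 : ∑ i, (1 + lam * mixLoo S lam δ i Z (Z i)) / (1 + loo lam i Z (Z i))
      = N - 1 / (1 + δ) * (N * δ - lam * (N * mixTrace S lam δ Finset.univ Z)) := by linarith
  rw [a4]
  field_simp
  ring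

/-- The normalised trace is close to the fixed point as soon as the leave-one-out forms are close to
their conditional means. -/
lemma abs_resTrace_sub_le (hS : S.PosSemidef) (hl : 0 < lam) (hδ : 0 ≤ δ) (hN : 0 < N)
    (hfix : FixedPoint N lam S δ) (Z : Fin N → Fin n → ℝ) :
    |resTrace S lam Finset.univ Z - δ| ≤ (1 + δ) * (1 / (N : ℝ) * ∑ i,
      (1 + resTrace S lam Finset.univ Z)
        * (lam * |mixLoo S lam δ i Z (Z i) - mixTrace S lam δ Finset.univ Z|
          + |loo lam i Z (Z i) - resTrace S lam Finset.univ Z|)) := by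
  have hN' : (0 : ℝ) < N := by positivity
  have hsc := self_consistency hS hl hδ hN hfix Z
  have hR := mixTrace_nonneg hS hl hδ Finset.univ Z
  have hRD := mixTrace_le hS hl hδ Finset.univ Z
  have hD := resTrace_nonneg hS hl Finset.univ Z
  set D := resTrace S lam Finset.univ Z
  set R := mixTrace S lam δ Finset.univ Z
  have e1 : (1 + lam * R) * (D - δ) / ((1 + δ) * (1 + D)) = 1 / (N : ℝ) * ∑ i,
      ((1 + lam * mixLoo S lam δ i Z (Z i)) / (1 + loo lam i Z (Z i))
        - (1 + lam * R) / (1 + D)) := by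
    rw [Finset.sum_sub_distrib, mul_sub (1 / (N : ℝ)), hsc]
    simp only [Finset.sum_const, Finset.card_univ, Fintype.card_fin, nsmul_eq_mul]
    field_simp
    ring
  have e2 : ∀ i, |(1 + lam * mixLoo S lam δ i Z (Z i)) / (1 + loo lam i Z (Z i))
        - (1 + lam * R) / (1 + D)|
      ≤ lam * |mixLoo S lam δ i Z (Z i) - R| + |loo lam i Z (Z i) - D| := by
    intro i
    have hq := loo_nonneg hl i Z (Z i)
    set q := loo lam i Z (Z i)
    set r := mixLoo S lam δ i Z (Z i)
    have : (1 + lam * r) / (1 + q) - (1 + lam * R) / (1 + D)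
        = lam * (r - R) * (1 / (1 + q)) - (q - D) * ((1 + lam * R) / (1 + D) * (1 / (1 + q))) := by
      field_simp
      ring
    have f1 : 1 / (1 + q) ≤ 1 := by rw [div_le_one (by positivity)]; linarith
    have f2 : (1 + lam * R) / (1 + D) ≤ 1 := by rw [div_le_one (by positivity)]; linarith
    have f3 : 0 ≤ (1 + lam * R) / (1 + D) := by positivity
    have f4 : 0 ≤ 1 / (1 + q) := by positivity
    rw [this]
    refine (abs_sub _ _).trans (add_le_add ?_ ?_)
    · rw [abs_mul, abs_mul, abs_of_pos hl, abs_of_nonneg f4]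
      exact mul_le_of_le_one_right (by positivity) f1
    · rw [abs_mul, abs_of_nonneg (mul_nonneg f3 f4)]
      exact mul_le_of_le_one_right (by positivity) (mul_le_one₀ f2 f4 f1)
  have e3 : |D - δ| ≤ (1 + δ) * (1 + D) * |(1 + lam * R) * (D - δ) / ((1 + δ) * (1 + D))| := by
    rw [abs_div, abs_mul, abs_of_nonneg (show 0 ≤ 1 + lam * R by positivity),
      abs_of_nonneg (show 0 ≤ (1 + δ) * (1 + D) by positivity), mul_div_cancel₀ _ (by positivity)]
    exact le_mul_of_one_le_left (abs_nonneg _) (by linarith [mul_nonneg hl.le hR])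
  refine e3.trans ?_
  rw [e1, mul_assoc, ← Finset.mul_sum]
  refine mul_le_mul_of_nonneg_left ?_ (by positivity)
  rw [abs_mul, abs_of_nonneg (show 0 ≤ 1 / (N : ℝ) by positivity), mul_left_comm]
  refine mul_le_mul_of_nonneg_left ?_ (by positivity)
  refine mul_le_mul_of_nonneg_left ?_ (by positivity)
  exact (Finset.abs_sum_le_sum_abs _ _).trans (Finset.sum_le_sum fun i _ => e2 i)

end FixedPointConvergence

end LinearESN

namespace LinearESN

/-! ### Rate of convergence of the normalised trace -/

section FixedPointRate

variable {n N : ℕ} {π : Measure (Fin n → ℝ)} [IsProbabilityMeasure π] {m : Fin n → ℝ}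
  {S : Matrix (Fin n) (Fin n) ℝ} {K lam δ : ℝ}

lemma continuous_res_comp {X : Type*} [TopologicalSpace X] (hl : 0 < lam) (J : Finset (Fin N))
    {f : X → Fin N → Fin n → ℝ} (hf : Continuous f) : Continuous fun x => res lam J (f x) :=
  (continuous_res hl J).comp hf

lemma continuous_resTrace_comp {X : Type*} [TopologicalSpace X] (hl : 0 < lam)
    (J : Finset (Fin N)) {f : X → Fin N → Fin n → ℝ} (hf : Continuous f) :
    Continuous fun x => resTrace S lam J (f x) :=
  (continuous_resTrace hl J).comp hf

lemma continuous_quad_comp {X : Type*} [TopologicalSpace X] {M : X → Matrix (Fin n) (Fin n) ℝ}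
    {f g : X → Fin n → ℝ} (hf : Continuous f) (hM : Continuous M) (hg : Continuous g) :
    Continuous fun x => f x ⬝ᵥ M x *ᵥ g x :=
  hf.dotProduct (hM.matrix_mulVec hg)

lemma continuous_loo (hl : 0 < lam) (i : Fin N) :
    Continuous fun p : (Fin N → Fin n → ℝ) × (Fin n → ℝ) => loo lam i p.1 p.2 :=
  continuous_const.mul (continuous_quad_comp continuous_snd
    (continuous_res_comp hl _ continuous_fst) continuous_snd)

lemma continuous_mixLoo (hl : 0 < lam) (i : Fin N) :
    Continuous fun p : (Fin N → Fin n → ℝ) × (Fin n → ℝ) => mixLoo S lam δ i p.1 p.2 :=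
  continuous_const.mul (continuous_quad_comp continuous_snd
    ((continuous_res_comp hl _ continuous_fst).matrix_mul continuous_const) continuous_snd)

lemma continuous_mixTrace (hl : 0 < lam) (J : Finset (Fin N)) :
    Continuous fun Z : Fin N → Fin n → ℝ => mixTrace S lam δ J Z :=
  continuous_const.mul (continuous_const.matrix_mul
    ((continuous_res hl J).matrix_mul continuous_const)).matrix_trace

lemma loo_update (i : Fin N) (Z : Fin N → Fin n → ℝ) (a y : Fin n → ℝ) :
    loo lam i (Function.update Z i a) y = loo lam i Z y := by
  rw [loo, loo, res_erase_update]

lemma mixLoo_update (i : Fin N) (Z : Fin N → Fin n → ℝ) (a y : Fin n → ℝ) :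
    mixLoo S lam δ i (Function.update Z i a) y = mixLoo S lam δ i Z y := by
  rw [mixLoo, mixLoo, res_erase_update]

lemma resTrace_update (i : Fin N) (Z : Fin N → Fin n → ℝ) (a : Fin n → ℝ) :
    resTrace S lam (Finset.univ.erase i) (Function.update Z i a)
      = resTrace S lam (Finset.univ.erase i) Z := by
  rw [resTrace, resTrace, res_erase_update]

lemma mixTrace_update (i : Fin N) (Z : Fin N → Fin n → ℝ) (a : Fin n → ℝ) :
    mixTrace S lam δ (Finset.univ.erase i) (Function.update Z i a)
      = mixTrace S lam δ (Finset.univ.erase i) Z := by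
  rw [mixTrace, mixTrace, res_erase_update]

lemma nonneg_of_le_mul {g : ℝ} (hN : 2 ≤ N) (hg : (n : ℝ) ≤ g * N) : 0 ≤ g := by
  have hN' : (2 : ℝ) ≤ N := by exact_mod_cast hN
  by_contra hneg
  push Not at hneg
  nlinarith [Nat.cast_nonneg (α := ℝ) n]

lemma trace_mul_sq_le {A : Matrix (Fin n) (Fin n) ℝ} (hS : S.PosSemidef) (hA : A.PosSemidef)
    (hl : 0 < lam) (h : ∀ v, lam * ((A *ᵥ v) ⬝ᵥ (A *ᵥ v)) ≤ v ⬝ᵥ A *ᵥ v) :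
    (S * (A * A)).trace ≤ (S * A).trace / lam := by
  have hp : ((1 / lam) • A - A * A).PosSemidef := by
    refine psd_of_nonneg (by simp [psd_transpose hA]) fun v => ?_
    rw [Matrix.sub_mulVec, Matrix.smul_mulVec, dotProduct_sub, dotProduct_smul, smul_eq_mul,
      ← Matrix.mulVec_mulVec, ← mulVec_dot (psd_transpose hA) v (A *ᵥ v), sub_nonneg, one_div,
      le_inv_mul_iff₀ hl]
    exact h v
  have := trace_mul_nonneg hS hp
  rw [mul_sub, mul_smul_comm, Matrix.trace_sub, Matrix.trace_smul, smul_eq_mul] at this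
  rw [div_eq_inv_mul, ← one_div]
  linarith

/-- Given the other samples, `N⁻¹ yᵀ Q₋ y` is a quadratic form of the fresh sample `y` with conditional
mean `N⁻¹ Tr(S Q₋)` and conditional variance of order `N⁻¹`. -/
lemma Concentrated.meanLE_loo_sq (h : Concentrated π m S K) (hl : 0 < lam) (hN : 2 ≤ N) {g : ℝ}
    (hg : (n : ℝ) ≤ g * N) (i : Fin N) :
    MeanLE ((Measure.pi fun _ : Fin N => π).prod π)
      (fun p => (loo lam i p.1 p.2 - resTrace S lam (Finset.univ.erase i) p.1) ^ 2)
      (K * (1 / lam ^ 2 + g * loewnerConst K lam g / lam) / N) := by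
  have hK := h.nonneg
  have hN' : (0 : ℝ) < N := by positivity
  have hN1 : (1 : ℝ) ≤ N := by exact_mod_cast (by omega : 1 ≤ N)
  have hg0 := nonneg_of_le_mul hN hg
  have hc1 := continuous_loo (n := n) hl i
  have hc2 := continuous_resTrace_comp (S := S) hl (Finset.univ.erase i)
    (continuous_fst (X := Fin N → Fin n → ℝ) (Y := Fin n → ℝ))
  have hL := h.meanLE_loewner_sq hl hN hg i
  refine (MeanLE.prod (π := π) (F := fun Z y => (loo lam i Z y
    - resTrace S lam (Finset.univ.erase i) Z) ^ 2) ((hc1.sub hc2).pow 2).measurable (fun Z => ?_)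
    (((MeanLE.const (c := K * (1 / lam ^ 2) / N) (by positivity)).add
      (hL.const_mul (a := K * g / lam / N) (by positivity))))).weaken (le_of_eq ?_)
  · set J := Finset.univ.erase i
    have hq := h.meanLE_quad (res_posSemidef hl J Z) (a := 1 / lam) (by positivity)
      (fun v => by
        rw [one_div_mul_eq_div]
        exact ridge_quad_le (gram_posSemidef J Z) hl v)
    have hq' := hq.const_mul (a := 1 / (N : ℝ) ^ 2) (by positivity)
    have e : ∀ y : Fin n → ℝ, (loo lam i Z y - resTrace S lam J Z) ^ 2
        = 1 / (N : ℝ) ^ 2 * (y ⬝ᵥ res lam J Z *ᵥ y - (S * res lam J Z).trace) ^ 2 := by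
      intro y
      rw [loo, resTrace]
      ring
    simp only [e]
    refine hq'.weaken ?_
    have t1 := h.resTrace_erase_le hl hN hg i Z
    have t2 := h.one_le_loewner hl i Z
    set L := loewner K lam m i Z
    have t3 : (S * res lam J Z).trace = N * resTrace S lam J Z := by
      rw [resTrace]; field_simp
    have t4 : resTrace S lam J Z ≤ g * L ^ 2 := t1.trans (by nlinarith [mul_nonneg hg0 (sub_nonneg.2 t2)])
    rw [t3]
    calc 1 / (N : ℝ) ^ 2 * (K * ((1 / lam) ^ 2 + 1 / lam * (N * resTrace S lam J Z)))
        ≤ 1 / (N : ℝ) ^ 2 * (K * ((1 / lam) ^ 2 * N + 1 / lam * (N * (g * L ^ 2)))) := by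
          gcongr
          exact le_mul_of_one_le_right (by positivity) hN1
      _ = K * (1 / lam ^ 2) / N + K * g / lam / N * L ^ 2 := by field_simp
  · ring

/-- The analogue of `meanLE_loo_sq` for the matrix `Q₋ Q̄`, which is not symmetric. -/
lemma Concentrated.meanLE_mixLoo_sq (h : Concentrated π m S K) (hl : 0 < lam) (hN : 2 ≤ N) {g : ℝ}
    {d : ℝ} (hg : (n : ℝ) ≤ g * N) (hδ : 0 ≤ δ) (hd : δ ≤ d) (hfix : FixedPoint N lam S δ)
    (i : Fin N) :
    MeanLE ((Measure.pi fun _ : Fin N => π).prod π)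
      (fun p => (mixLoo S lam δ i p.1 p.2 - mixTrace S lam δ (Finset.univ.erase i) p.1) ^ 2)
      (K * (4 / lam ^ 4 + (g * loewnerConst K lam g + d) / lam ^ 3) / N) := by
  have hd0 := hδ.trans hd
  have hK := h.nonneg
  have hS := h.posSemidef
  have hN' : (0 : ℝ) < N := by positivity
  have hN1 : (1 : ℝ) ≤ N := by exact_mod_cast (by omega : 1 ≤ N)
  have hg0 := nonneg_of_le_mul hN hg
  have hc1 := continuous_mixLoo (n := n) (S := S) (δ := δ) hl i
  have hc2 := (continuous_mixTrace (S := S) (δ := δ) hl (Finset.univ.erase i)).comp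
    (continuous_fst (X := Fin N → Fin n → ℝ) (Y := Fin n → ℝ))
  have hL := h.meanLE_loewner_sq hl hN hg i
  refine (MeanLE.prod (π := π) (F := fun Z y => (mixLoo S lam δ i Z y
    - mixTrace S lam δ (Finset.univ.erase i) Z) ^ 2) ((hc1.sub hc2).pow 2).measurable (fun Z => ?_)
    (((MeanLE.const (c := K * (4 / lam ^ 4 + d / lam ^ 3) / N) (by positivity)).add
      (hL.const_mul (a := K * g / lam ^ 3 / N) (by positivity))))).weaken (le_of_eq ?_)
  · set J := Finset.univ.erase i
    have hpb := resolvent_posSemidef hS hl hδ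
    have n1 : ∀ v, lam * ((res lam J Z *ᵥ v) ⬝ᵥ (res lam J Z *ᵥ v)) ≤ v ⬝ᵥ res lam J Z *ᵥ v :=
      ridge_normSq_le (gram_posSemidef J Z) hl
    have n2 : ∀ v, lam * ((resolvent lam δ S *ᵥ v) ⬝ᵥ (resolvent lam δ S *ᵥ v))
        ≤ v ⬝ᵥ resolvent lam δ S *ᵥ v := ridge_normSq_le (smul_psd hS hδ) hl
    have hq := h.meanLE_quad_mul (res_transpose hl J Z) (psd_transpose hpb) (a := 1 / lam ^ 2)
      (by positivity)
      (fun v => by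
        rw [one_div_mul_eq_div]
        exact ridge_normSq_le' (gram_posSemidef J Z) hl v)
      (fun v => by
        rw [one_div_mul_eq_div]
        exact ridge_normSq_le' (smul_psd hS hδ) hl v)
    have hq' := hq.const_mul (a := 1 / (N : ℝ) ^ 2) (by positivity)
    have e : ∀ y : Fin n → ℝ, (mixLoo S lam δ i Z y - mixTrace S lam δ J Z) ^ 2
        = 1 / (N : ℝ) ^ 2 * (y ⬝ᵥ (res lam J Z * resolvent lam δ S) *ᵥ y
          - (S * (res lam J Z * resolvent lam δ S)).trace) ^ 2 := by
      intro y
      rw [mixLoo, mixTrace]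
      ring
    simp only [e]
    refine hq'.weaken ?_
    have t1 := h.resTrace_erase_le hl hN hg i Z
    have t2 := h.one_le_loewner hl i Z
    have s1 := trace_mul_sq_le hS (res_posSemidef hl J Z) hl n1
    have s2 := trace_mul_sq_le hS hpb hl n2
    set L := loewner K lam m i Z
    have t3 : (S * res lam J Z).trace = N * resTrace S lam J Z := by
      rw [resTrace]; field_simp
    have t4 : resTrace S lam J Z ≤ g * L ^ 2 := t1.trans (by nlinarith [mul_nonneg hg0 (sub_nonneg.2 t2)])
    have t5 : (S * resolvent lam δ S).trace = N * δ := by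
      have : δ = 1 / (N : ℝ) * (S * resolvent lam δ S).trace := hfix
      conv_rhs => rw [this]
      field_simp
    rw [t3] at s1
    rw [t5] at s2
    calc 1 / (N : ℝ) ^ 2 * (K * (4 * (1 / lam ^ 2) ^ 2 + 1 / lam ^ 2 *
          ((S * (res lam J Z * res lam J Z)).trace
            + (S * (resolvent lam δ S * resolvent lam δ S)).trace)))
        ≤ 1 / (N : ℝ) ^ 2 * (K * (4 * (1 / lam ^ 2) ^ 2 * N + 1 / lam ^ 2 *
          (N * (g * L ^ 2) / lam + N * d / lam))) := by
          have u1 : 4 * (1 / lam ^ 2) ^ 2 ≤ 4 * (1 / lam ^ 2) ^ 2 * (N : ℝ) :=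
            le_mul_of_one_le_right (by positivity) hN1
          have u2 : (N : ℝ) * resTrace S lam J Z / lam ≤ N * (g * L ^ 2) / lam := by gcongr
          have u3 : (N : ℝ) * δ / lam ≤ N * d / lam := by gcongr
          have u4 := add_le_add (s1.trans u2) (s2.trans u3)
          gcongr
      _ = K * (4 / lam ^ 4 + d / lam ^ 3) / N + K * g / lam ^ 3 / N * L ^ 2 := by field_simp; ring
  · ring

/-- The constant in the rate of convergence of the normalised trace; `d` bounds the fixed point. -/
noncomputable def traceConst (K lam g d : ℝ) : ℝ :=
  (1 + d) * ((1 + g) ^ 2 * loewnerConst K lam g / 2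
    + 2 * (lam ^ 2 * (K * (4 / lam ^ 4 + (g * loewnerConst K lam g + d) / lam ^ 3)) + (1 + d) ^ 2
      + K * (1 / lam ^ 2 + g * loewnerConst K lam g / lam) + loewnerConst K lam g))

lemma mul_le_young {a b η : ℝ} (hη : 0 < η) : a * b ≤ (a ^ 2 / η + η * b ^ 2) / 2 := by
  have : (a ^ 2 / η + η * b ^ 2) / 2 - a * b = (a - η * b) ^ 2 / (2 * η) := by field_simp; ring
  have h2 : 0 ≤ (a - η * b) ^ 2 / (2 * η) := by positivity
  linarith

/-- The normalised trace `N⁻¹ Tr(S Q)` converges to the fixed point at the rate `N^{-1/2}`. -/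
lemma Concentrated.meanLE_resTrace_sub (h : Concentrated π m S K) (hl : 0 < lam) (hN : 2 ≤ N)
    {g d s : ℝ} (hg : (n : ℝ) ≤ g * N) (hδ : 0 ≤ δ) (hd : δ ≤ d) (hfix : FixedPoint N lam S δ)
    (hs : 0 < s) (hsN : (N : ℝ) = s ^ 2) :
    MeanLE (Measure.pi fun _ : Fin N => π) (fun Z => |resTrace S lam Finset.univ Z - δ|)
      (traceConst K lam g d / s) := by
  have hK := h.nonneg
  have hS := h.posSemidef
  have hd0 := hδ.trans hd
  have hN' : (0 : ℝ) < N := by positivity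
  have hN1 : (1 : ℝ) ≤ N := by exact_mod_cast (by omega : 1 ≤ N)
  have hg0 := nonneg_of_le_mul hN hg
  have hl0 := loewnerConst_nonneg (lam := lam) (g := g) hK
  have hcD := continuous_resTrace (S := S) hl (Finset.univ : Finset (Fin N))
  have hcR := continuous_mixTrace (S := S) (δ := δ) hl (Finset.univ : Finset (Fin N))
  have hT : 0 ≤ traceConst K lam g d := by unfold traceConst; positivity
  have hterm : ∀ i : Fin N, MeanLE (Measure.pi fun _ : Fin N => π) (fun Z =>
      (1 + resTrace S lam Finset.univ Z)
        * (lam * |mixLoo S lam δ i Z (Z i) - mixTrace S lam δ Finset.univ Z|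
          + |loo lam i Z (Z i) - resTrace S lam Finset.univ Z|))
      (traceConst K lam g d / (1 + d) / s) := by
    intro i
    -- the leave-one-out forms are close to the leave-one-out traces, and these differ from the full
    -- traces by `O(L / N)`; the factor `1 + N⁻¹ Tr(S Q)`, of order `L`, is split off with weight `s`
    have a1 := MeanLE.coord (f := fun Z y => (loo lam i Z y
      - resTrace S lam (Finset.univ.erase i) Z) ^ 2) i
      (fun Z a y => by simp only [loo_update, resTrace_update]) (h.meanLE_loo_sq hl hN hg i)
    have a2 := MeanLE.coord (f := fun Z y => (mixLoo S lam δ i Z y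
      - mixTrace S lam δ (Finset.univ.erase i) Z) ^ 2) i
      (fun Z a y => by simp only [mixLoo_update, mixTrace_update])
      (h.meanLE_mixLoo_sq hl hN hg hδ hd hfix i)
    have aL := h.meanLE_loewner_sq hl hN hg i
    have hsum := (((a2.const_mul (a := lam ^ 2) (by positivity)).add
      (MeanLE.const (c := (1 + d) ^ 2 / N) (by positivity))).add a1).add
      (aL.const_mul (a := 1 / (N : ℝ)) (by positivity))
    have htot := (aL.const_mul (a := (1 + g) ^ 2 / 2 / s) (by positivity)).add
      (hsum.const_mul (a := 2 * s) (by positivity))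
    have hd1 : 1 + d ≠ 0 := by positivity
    refine (htot.weaken (le_of_eq ?_)).mono ?_ ?_ ?_
    · rw [traceConst, mul_div_cancel_left₀ _ hd1, hsN]
      field_simp
    · have c1 : Continuous fun Z : Fin N → Fin n → ℝ => mixLoo S lam δ i Z (Z i) :=
        (continuous_mixLoo hl i).comp (continuous_id.prodMk (continuous_apply i))
      have c2 : Continuous fun Z : Fin N → Fin n → ℝ => loo lam i Z (Z i) :=
        (continuous_loo hl i).comp (continuous_id.prodMk (continuous_apply i))
      exact ((continuous_const.add hcD).mul ((continuous_const.mul (c1.sub hcR).abs).add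
        (c2.sub hcD).abs)).measurable
    · intro Z
      have := resTrace_nonneg hS hl Finset.univ Z
      positivity
    · intro Z
      have hD := resTrace_nonneg hS hl Finset.univ Z
      have hDD := resTrace_le_erase hS hl i Z
      have t1 := h.resTrace_erase_le hl hN hg i Z
      have t2 := h.one_le_loewner hl i Z
      have t3 := h.resTrace_erase_sub_le hl hN i Z
      have t4 := mixTrace_erase_sub hS hl hδ i Z
      set D := resTrace S lam Finset.univ Z
      set D' := resTrace S lam (Finset.univ.erase i) Z
      set R := mixTrace S lam δ Finset.univ Z
      set R' := mixTrace S lam δ (Finset.univ.erase i) Z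
      set L := loewner K lam m i Z
      set q := loo lam i Z (Z i)
      set r := mixLoo S lam δ i Z (Z i)
      have y1 : |q - D| ≤ |q - D'| + L / N := by
        have := abs_add_le (q - D') (D' - D)
        rw [sub_add_sub_cancel, abs_of_nonneg (sub_nonneg.2 hDD)] at this
        linarith
      have y2 : lam * |r - R| ≤ lam * |r - R'| + (1 + d) / N := by
        have := abs_add_le (r - R') (R' - R)
        rw [sub_add_sub_cancel] at this
        have e : lam * ((1 + δ) / (lam * N)) ≤ (1 + d) / N := by
          rw [← mul_div_assoc, mul_div_mul_left _ _ hl.ne']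
          gcongr
        have := mul_le_mul_of_nonneg_left (this.trans (add_le_add le_rfl t4)) hl.le
        linarith
      have y3 : 1 + D ≤ (1 + g) * L := by nlinarith
      have hNsq : ∀ x : ℝ, 0 ≤ x → (x / N) ^ 2 ≤ x ^ 2 / N := fun x hx => by
        rw [div_pow]
        gcongr
        exact le_self_pow₀ hN1 (by norm_num)
      set y := lam * |r - R'| + (1 + d) / N + (|q - D'| + L / N)
      have y4 : y ^ 2 ≤ 4 * (lam ^ 2 * (r - R') ^ 2 + (1 + d) ^ 2 / N + (q - D') ^ 2
          + 1 / (N : ℝ) * L ^ 2) := by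
        have z1 := hNsq (1 + d) (by positivity)
        have z2 := hNsq L (by linarith)
        have z3 : (lam * |r - R'|) ^ 2 = lam ^ 2 * (r - R') ^ 2 := by rw [mul_pow, sq_abs]
        have z4 := sq_abs (q - D')
        have z5 : 1 / (N : ℝ) * L ^ 2 = L ^ 2 / N := by ring
        have z6 : ∀ a b c e : ℝ, (a + b + (c + e)) ^ 2 ≤ 4 * (a ^ 2 + b ^ 2 + c ^ 2 + e ^ 2) :=
          fun a b c e => by
            nlinarith [sq_nonneg (a - b), sq_nonneg (a - c), sq_nonneg (a - e), sq_nonneg (b - c),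
              sq_nonneg (b - e), sq_nonneg (c - e)]
        have := z6 (lam * |r - R'|) ((1 + d) / N) |q - D'| (L / N)
        rw [z3, z4] at this
        rw [z5]
        linarith
      have hx : 0 ≤ lam * |r - R| + |q - D| := by positivity
      calc (1 + D) * (lam * |r - R| + |q - D|) ≤ ((1 + g) * L) * y := by
            refine mul_le_mul y3 ?_ hx (by positivity)
            linarith
        _ ≤ (((1 + g) * L) ^ 2 / s + s * y ^ 2) / 2 := mul_le_young hs
        _ ≤ (((1 + g) * L) ^ 2 / s + s * (4 * (lam ^ 2 * (r - R') ^ 2 + (1 + d) ^ 2 / N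
            + (q - D') ^ 2 + 1 / (N : ℝ) * L ^ 2))) / 2 := by gcongr
        _ = _ := by ring
  have := (MeanLE.avg (by omega) hterm).const_mul (a := 1 + δ) (by positivity)
  refine (this.weaken ?_).mono ?_ (fun Z => abs_nonneg _) fun Z =>
    abs_resTrace_sub_le hS hl hδ (by omega) hfix Z
  · have hd1 : 1 + d ≠ 0 := by positivity
    calc (1 + δ) * (traceConst K lam g d / (1 + d) / s)
        ≤ (1 + d) * (traceConst K lam g d / (1 + d) / s) := by gcongr
      _ = _ := by field_simp
  · exact (hcD.sub continuous_const).abs.measurable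

/-- The constant in the rate of convergence of the leave-one-out form. -/
noncomputable def looConst (K lam g d : ℝ) : ℝ :=
  (1 + K * (1 / lam ^ 2 + g * loewnerConst K lam g / lam)) / 2 + loewnerConst K lam g
    + traceConst K lam g d

/-- The leave-one-out form `N⁻¹ z_iᵀ Q₋ z_i` is close to the fixed point. -/
lemma Concentrated.meanLE_loo_sub (h : Concentrated π m S K) (hl : 0 < lam) (hN : 2 ≤ N)
    {g d s : ℝ} (hg : (n : ℝ) ≤ g * N) (hδ : 0 ≤ δ) (hd : δ ≤ d) (hfix : FixedPoint N lam S δ)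
    (hs : 0 < s) (hsN : (N : ℝ) = s ^ 2) (i : Fin N) :
    MeanLE (Measure.pi fun _ : Fin N => π) (fun Z => |loo lam i Z (Z i) - δ|)
      (looConst K lam g d / s) := by
  have hN' : (0 : ℝ) < N := by positivity
  have hN1 : (1 : ℝ) ≤ N := by exact_mod_cast (by omega : 1 ≤ N)
  have hs1 : 1 ≤ s := by nlinarith
  have a1 := MeanLE.coord (f := fun Z y => (loo lam i Z y
    - resTrace S lam (Finset.univ.erase i) Z) ^ 2) i
    (fun Z a y => by simp only [loo_update, resTrace_update]) (h.meanLE_loo_sq hl hN hg i)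
  have aL := h.meanLE_loewner_sq hl hN hg i
  have aT := h.meanLE_resTrace_sub hl hN hg hδ hd hfix hs hsN
  have htot := (((MeanLE.const (c := 1 / (2 * s)) (by positivity)).add
    (a1.const_mul (a := s / 2) (by positivity))).add
    (aL.const_mul (a := 1 / s) (by positivity))).add aT
  refine (htot.weaken (le_of_eq ?_)).mono ?_ (fun Z => abs_nonneg _) fun Z => ?_
  · rw [looConst, hsN]
    field_simp
  · exact (((continuous_loo hl i).comp (continuous_id.prodMk (continuous_apply i))).sub
      continuous_const).abs.measurable
  · have hDD := resTrace_le_erase h.posSemidef hl i Z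
    have t2 := h.one_le_loewner hl i Z
    have t3 := h.resTrace_erase_sub_le hl hN i Z
    set D := resTrace S lam Finset.univ Z
    set D' := resTrace S lam (Finset.univ.erase i) Z
    set L := loewner K lam m i Z
    set q := loo lam i Z (Z i)
    have y1 : |q - δ| ≤ |q - D'| + |D' - D| + |D - δ| := by
      calc |q - δ| = |(q - D') + (D' - D) + (D - δ)| := by ring_nf
        _ ≤ _ := abs_add_three _ _ _
    rw [abs_of_nonneg (sub_nonneg.2 hDD)] at y1
    have y2 := mul_le_young (a := 1) (b := |q - D'|) hs
    rw [sq_abs] at y2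
    have y3 : L / N ≤ 1 / s * L ^ 2 := by
      rw [hsN, div_le_iff₀ (by positivity)]
      have : 1 / s * L ^ 2 * s ^ 2 = s * L ^ 2 := by field_simp
      rw [this]
      nlinarith
    have y4 : (1 ^ 2 / s + s * (q - D') ^ 2) / 2 = 1 / (2 * s) + s / 2 * (q - D') ^ 2 := by
      field_simp
    linarith

end FixedPointRate

end LinearESN

namespace LinearESN

/-! ### Deterministic equivalents of quadratic forms of the resolvent -/

section QuadraticForms

/-- An average of terms that split into a small part and a part of mean zero has a small mean. -/
lemma abs_integral_avg_le {Ω : Type*} [MeasurableSpace Ω] {μ : Measure Ω} [IsProbabilityMeasure μ]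
    {N : ℕ} (hN : 0 < N) {X : Ω → ℝ} {F M : Fin N → Ω → ℝ} {c : ℝ}
    (hX : ∀ ω, X ω = 1 / (N : ℝ) * ∑ i, (F i ω + M i ω))
    (hF : ∀ i, MeanLE μ (fun ω => |F i ω|) c) (hFm : ∀ i, Measurable (F i))
    (hM : ∀ i, Integrable (M i) μ) (hM0 : ∀ i, ∫ ω, M i ω ∂μ = 0) : |∫ ω, X ω ∂μ| ≤ c := by
  have hFi : ∀ i, Integrable (F i) μ := fun i =>
    (integrable_norm_iff (hFm i).aestronglyMeasurable).1 (hF i).integrable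
  have hN' : (0 : ℝ) < N := by positivity
  simp only [hX]
  have hi : ∀ i, Integrable (fun ω => F i ω + M i ω) μ := fun i => (hFi i).add (hM i)
  rw [integral_const_mul, integral_finsetSum _ fun i _ => hi i]
  have : ∀ i, ∫ ω, (F i ω + M i ω) ∂μ = ∫ ω, F i ω ∂μ := fun i => by
    rw [integral_add (hFi i) (hM i), hM0, add_zero]
  simp only [this]
  rw [abs_mul, abs_of_nonneg (by positivity), one_div, inv_mul_le_iff₀ hN']
  refine (Finset.abs_sum_le_sum_abs _ _).trans ?_
  refine (Finset.sum_le_sum fun i _ => (hF i).abs_integral_le).trans ?_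
  simp

variable {n N : ℕ} {π : Measure (Fin n → ℝ)} [IsProbabilityMeasure π] {m : Fin n → ℝ}
  {S : Matrix (Fin n) (Fin n) ℝ} {K lam δ : ℝ}

/-- The bound on the fourth moment of `z_iᵀ Q₋ w` when `‖w‖² ≤ B`. -/
noncomputable def linConst (K lam g B : ℝ) : ℝ :=
  8 * (loewnerConst K lam g * B ^ 2 / lam ^ 2) + 8 * (K * (B / lam ^ 2) ^ 2)

/-- The mean of `yᵀ Q₋ w` given the other samples is controlled by its second moment, hence by the
factor `loewner`. -/
lemma Concentrated.meanLE_lin_res (h : Concentrated π m S K) (hl : 0 < lam) (hN : 2 ≤ N) {g B : ℝ}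
    (hg : (n : ℝ) ≤ g * N) {w : Fin n → ℝ} (hw : w ⬝ᵥ w ≤ B) (i : Fin N) :
    MeanLE ((Measure.pi fun _ : Fin N => π).prod π)
      (fun p => (p.2 ⬝ᵥ res lam (Finset.univ.erase i) p.1 *ᵥ w) ^ 4) (linConst K lam g B) := by
  have hK := h.nonneg
  have hB : 0 ≤ B := (dot_self_nonneg w).trans hw
  have hL := h.meanLE_loewner_sq hl hN hg i
  refine (MeanLE.prod (π := π) (F := fun Z y => (y ⬝ᵥ res lam (Finset.univ.erase i) Z *ᵥ w) ^ 4)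
    ((continuous_quad_comp continuous_snd (continuous_res_comp hl _ continuous_fst)
      continuous_const).pow 4).measurable (fun Z => ?_)
    ((hL.const_mul (a := 8 * (B ^ 2 / lam ^ 2)) (by positivity)).add
      (MeanLE.const (c := 8 * (K * (B / lam ^ 2) ^ 2)) (by positivity)))).weaken (le_of_eq ?_)
  · have h1 := h.meanLE_lin_four (res lam (Finset.univ.erase i) Z *ᵥ w)
    simp only [dotProduct_comm _ (res lam (Finset.univ.erase i) Z *ᵥ w)]
    refine h1.weaken ?_
    have h2 := h.mean_sq_le (res lam (Finset.univ.erase i) Z *ᵥ w)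
    have h3 := ridge_conj_le (gram_posSemidef _ Z) hl (h.le_loewner hl hN i Z) w
    have h4 := ridge_quad_le (gram_posSemidef (Finset.univ.erase i) Z) hl w
    have h5 := ridge_normSq_le' (gram_posSemidef (Finset.univ.erase i) Z) hl w
    have h6 := h.one_le_loewner hl i Z
    rw [← res] at h3 h4 h5
    have h7 : (res lam (Finset.univ.erase i) Z *ᵥ w ⬝ᵥ m) ^ 2 ≤ loewner K lam m i Z * (B / lam) := by
      refine h2.trans (h3.trans ?_)
      gcongr
      exact h4.trans (by gcongr)
    have h8 : (res lam (Finset.univ.erase i) Z *ᵥ w) ⬝ᵥ (res lam (Finset.univ.erase i) Z *ᵥ w)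
        ≤ B / lam ^ 2 := h5.trans (by gcongr)
    have h9 : (res lam (Finset.univ.erase i) Z *ᵥ w ⬝ᵥ m) ^ 4
        ≤ (loewner K lam m i Z * (B / lam)) ^ 2 := by
      rw [show ∀ x : ℝ, x ^ 4 = (x ^ 2) ^ 2 from fun x => by ring]
      exact pow_le_pow_left₀ (sq_nonneg _) h7 2
    have h10 := dot_self_nonneg (res lam (Finset.univ.erase i) Z *ᵥ w)
    calc _ ≤ 8 * (loewner K lam m i Z * (B / lam)) ^ 2 + 8 * (K * (B / lam ^ 2) ^ 2) := by gcongr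
      _ = _ := by ring
  · rw [linConst]; ring

/-- The bound on the fourth moment of `wᵀ Q̄ z` when `‖w‖² ≤ B`. -/
noncomputable def linBarConst (K lam d B : ℝ) : ℝ :=
  8 * ((1 + d) * (B / lam)) ^ 2 + 8 * (K * (B / lam ^ 2) ^ 2)

lemma Concentrated.meanLE_lin_resolvent (h : Concentrated π m S K) (hl : 0 < lam)
    {d B : ℝ} (hδ : 0 ≤ δ) (hd : δ ≤ d) {w : Fin n → ℝ} (hw : w ⬝ᵥ w ≤ B) :
    MeanLE π (fun y => ((resolvent lam δ S *ᵥ w) ⬝ᵥ y) ^ 4) (linBarConst K lam d B) := by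
  have hK := h.nonneg
  have hB : 0 ≤ B := (dot_self_nonneg w).trans hw
  have hA := smul_psd h.posSemidef hδ
  refine (h.meanLE_lin_four (resolvent lam δ S *ᵥ w)).weaken ?_
  have h2 := h.mean_sq_le (resolvent lam δ S *ᵥ w)
  have h3 := ridge_energy hA hl w
  have h4 := ridge_quad_le hA hl w
  have h5 := ridge_normSq_le' hA hl w
  rw [← resolvent_eq] at h3 h4 h5
  have h6 := dot_self_nonneg (resolvent lam δ S *ᵥ w)
  rw [Matrix.smul_mulVec, dotProduct_smul, smul_eq_mul] at h3
  have h7 : (resolvent lam δ S *ᵥ w) ⬝ᵥ S *ᵥ (resolvent lam δ S *ᵥ w) ≤ (1 + d) * (B / lam) := by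
    have : (resolvent lam δ S *ᵥ w) ⬝ᵥ S *ᵥ (resolvent lam δ S *ᵥ w)
        ≤ (1 + δ) * (w ⬝ᵥ resolvent lam δ S *ᵥ w) := by
      rw [h3, mul_add, ← mul_assoc, mul_one_div_cancel (by positivity), one_mul]
      have : 0 ≤ (1 + δ) * (lam * ((resolvent lam δ S *ᵥ w) ⬝ᵥ (resolvent lam δ S *ᵥ w))) := by
        positivity
      linarith
    refine this.trans ?_
    have h8 : w ⬝ᵥ w / lam ≤ B / lam := by gcongr
    have h9 : 0 ≤ B / lam := by positivity
    calc (1 + δ) * (w ⬝ᵥ resolvent lam δ S *ᵥ w) ≤ (1 + δ) * (B / lam) := by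
          gcongr; exact h4.trans h8
      _ ≤ _ := by gcongr
  have h8 : (resolvent lam δ S *ᵥ w) ⬝ᵥ (resolvent lam δ S *ᵥ w) ≤ B / lam ^ 2 :=
    h5.trans (by gcongr)
  have h9 : (resolvent lam δ S *ᵥ w ⬝ᵥ m) ^ 4 ≤ ((1 + d) * (B / lam)) ^ 2 := by
    rw [show ∀ x : ℝ, x ^ 4 = (x ^ 2) ^ 2 from fun x => by ring]
    exact pow_le_pow_left₀ (sq_nonneg _) (h2.trans h7) 2
  rw [linBarConst]
  gcongr

/-- The difference is at most `1` and at most `|q - δ|`, so a first moment bound on `q - δ` suffices. -/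
lemma inv_sub_inv_sq_le {q : ℝ} (hq : 0 ≤ q) (hδ : 0 ≤ δ) :
    (1 / (1 + q) - 1 / (1 + δ)) ^ 2 ≤ |q - δ| := by
  have e : 1 / (1 + q) - 1 / (1 + δ) = -((q - δ) * (1 / ((1 + q) * (1 + δ)))) := by
    field_simp; ring
  have h1 : |1 / (1 + q) - 1 / (1 + δ)| ≤ |q - δ| := by
    rw [e, abs_neg, abs_mul, abs_of_nonneg (show 0 ≤ 1 / ((1 + q) * (1 + δ)) by positivity)]
    refine mul_le_of_le_one_right (abs_nonneg _) ?_
    rw [div_le_one (by positivity)]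
    nlinarith
  have h2 : |1 / (1 + q) - 1 / (1 + δ)| ≤ 1 := by
    have a1 : 1 / (1 + q) ≤ 1 := by rw [div_le_one (by positivity)]; linarith
    have a2 : 1 / (1 + δ) ≤ 1 := by rw [div_le_one (by positivity)]; linarith
    have a3 : 0 ≤ 1 / (1 + q) := by positivity
    have a4 : 0 ≤ 1 / (1 + δ) := by positivity
    rw [abs_le]; constructor <;> linarith
  rw [← sq_abs]
  nlinarith [abs_nonneg (1 / (1 + q) - 1 / (1 + δ))]

lemma res_dot_bound (hl : 0 < lam) (J : Finset (Fin N)) (Z : Fin N → Fin n → ℝ) (v w : Fin n → ℝ) :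
    |v ⬝ᵥ res lam J Z *ᵥ w| ≤ (v ⬝ᵥ v + w ⬝ᵥ w / lam ^ 2) / 2 := by
  have h1 := ridge_normSq_le' (gram_posSemidef J Z) hl w
  have h2 := dot_self_nonneg (v - res lam J Z *ᵥ w)
  have h3 := dot_self_nonneg (v + res lam J Z *ᵥ w)
  rw [← res] at h1
  simp only [dotProduct_sub, sub_dotProduct, dotProduct_add, add_dotProduct] at h2 h3
  rw [dotProduct_comm (res lam J Z *ᵥ w) v] at h2 h3
  rw [abs_le]
  constructor <;> linarith

lemma integrable_res_dot (hl : 0 < lam) (J : Finset (Fin N)) (v w : Fin n → ℝ)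
    (μ : Measure (Fin N → Fin n → ℝ)) [IsFiniteMeasure μ] :
    Integrable (fun Z => v ⬝ᵥ res lam J Z *ᵥ w) μ :=
  Integrable.of_bound (continuous_quad_comp continuous_const (continuous_res hl J)
    continuous_const).aestronglyMeasurable _ (ae_of_all _ fun Z => res_dot_bound hl J Z v w)

/-- The constant in the rate for quadratic forms. -/
noncomputable def quadConst (K lam g d B : ℝ) : ℝ :=
  (linBarConst K lam d B + linConst K lam g B) / 4 + looConst K lam g d / 2
    + (1 + B / lam * (1 + linConst K lam g B)) / 2

/-- The mean of `wᵀ Q w` is close to `wᵀ Q̄ w`. -/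
lemma Concentrated.abs_integral_quad_sub_le (h : Concentrated π m S K) (hl : 0 < lam) (hN : 2 ≤ N)
    {g d B t : ℝ} (hg : (n : ℝ) ≤ g * N) (hδ : 0 ≤ δ) (hd : δ ≤ d) (hfix : FixedPoint N lam S δ)
    (ht : 0 < t) (htN : (N : ℝ) = t ^ 4) {w : Fin n → ℝ} (hw : w ⬝ᵥ w ≤ B) :
    |∫ Z, (w ⬝ᵥ resolvent lam δ S *ᵥ w - w ⬝ᵥ res lam Finset.univ Z *ᵥ w)
      ∂(Measure.pi fun _ : Fin N => π)| ≤ quadConst K lam g d B / t := by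
  have hS := h.posSemidef
  have hN' : (0 : ℝ) < N := by positivity
  have hN1 : (1 : ℝ) ≤ N := by exact_mod_cast (by omega : 1 ≤ N)
  have ht1 : 1 ≤ t := by
    by_contra hlt
    push Not at hlt
    have := pow_lt_one₀ ht.le hlt (by norm_num : 4 ≠ 0)
    linarith
  have hp := resolvent_posSemidef hS hl hδ
  set Qb := resolvent lam δ S with hQb
  set u := Qb *ᵥ w with hu
  set v := w - lam • u with hv
  have hB : 0 ≤ B := (dot_self_nonneg w).trans hw
  have hSu : S *ᵥ u = (1 + δ) • v := by
    rw [hu, Matrix.mulVec_mulVec, hQb, mul_resolvent hS hl hδ, Matrix.smul_mulVec,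
      Matrix.sub_mulVec, Matrix.one_mulVec, Matrix.smul_mulVec]
  -- the norm of `(I - lam Q̄) w` is at most that of `w`
  have hvv : v ⬝ᵥ v ≤ B := by
    have e1 : lam * (u ⬝ᵥ u) ≤ w ⬝ᵥ u := ridge_normSq_le (smul_psd hS hδ) hl w
    have e2 : 0 ≤ w ⬝ᵥ u := psd_nonneg hp w
    have : v ⬝ᵥ v = w ⬝ᵥ w - lam * (w ⬝ᵥ u) - lam * (w ⬝ᵥ u - lam * (u ⬝ᵥ u)) := by
      simp only [hv, dotProduct_sub, sub_dotProduct, dotProduct_smul, smul_dotProduct, smul_eq_mul]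
      rw [dotProduct_comm u w]
    rw [this]
    have := mul_nonneg hl.le e2
    have := mul_nonneg hl.le (sub_nonneg.2 e1)
    linarith
  -- By the resolvent identity, `wᵀ (Q̄ - Q) w` is the average over `i` of
  -- `(uᵀ z_i) (z_iᵀ Q w) - vᵀ Q w`. Sherman–Morrison and `q_i ≈ δ` turn the first factor into
  -- `(uᵀ z_i) (z_iᵀ Q₋ w) / (1 + δ)`, whose conditional mean is `vᵀ Q₋ w` as `S u = (1 + δ) v`.
  let a : (Fin n → ℝ) → ℝ := fun y => u ⬝ᵥ y
  let b : Fin N → (Fin N → Fin n → ℝ) → (Fin n → ℝ) → ℝ := fun i Z y =>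
    y ⬝ᵥ res lam (Finset.univ.erase i) Z *ᵥ w
  have hbm : ∀ i, Continuous fun p : (Fin N → Fin n → ℝ) × (Fin n → ℝ) => b i p.1 p.2 := fun i =>
    continuous_quad_comp continuous_snd (continuous_res_comp hl _ continuous_fst) continuous_const
  have hdiag : ∀ i : Fin N, Continuous fun Z : Fin N → Fin n → ℝ => (Z, Z i) := fun i =>
    continuous_id.prodMk (continuous_apply i)
  have hbZ : ∀ i, Continuous fun Z : Fin N → Fin n → ℝ => b i Z (Z i) := fun i =>
    (hbm i).comp (hdiag i)
  have hqZ : ∀ i, Continuous fun Z : Fin N → Fin n → ℝ => loo lam i Z (Z i) := fun i =>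
    (continuous_loo hl i).comp (hdiag i)
  have haZ : ∀ i, Continuous fun Z : Fin N → Fin n → ℝ => a (Z i) := fun i => by fun_prop
  have hbup : ∀ i Z c y, b i (Function.update Z i c) y = b i Z y := fun i Z c y => by
    simp only [b, res_erase_update]
  have hres : ∀ i, Continuous fun Z : Fin N → Fin n → ℝ =>
      v ⬝ᵥ res lam (Finset.univ.erase i) Z *ᵥ w := fun i =>
    continuous_quad_comp continuous_const (continuous_res hl _) continuous_const
  have hresu : Continuous fun Z : Fin N → Fin n → ℝ => v ⬝ᵥ res lam Finset.univ Z *ᵥ w :=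
    continuous_quad_comp continuous_const (continuous_res hl _) continuous_const
  have hb4 : ∀ i, MeanLE (Measure.pi fun _ : Fin N => π) (fun Z => b i Z (Z i) ^ 4)
      (linConst K lam g B) := fun i =>
    MeanLE.coord (f := fun Z y => b i Z y ^ 4) i (fun Z c y => by simp only [hbup])
      (h.meanLE_lin_res hl hN hg hw i)
  have hLB : 0 ≤ linBarConst K lam d B := (h.meanLE_lin_resolvent hl hδ hd hw).2.2.1
  have ha4' : MeanLE ((Measure.pi fun _ : Fin N => π).prod π) (fun p => a p.2 ^ 4)
      (linBarConst K lam d B) :=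
    MeanLE.prod (F := fun _ y => a y ^ 4) (by fun_prop)
      (fun Z => h.meanLE_lin_resolvent hl hδ hd hw) (MeanLE.const hLB)
  have ha4 : ∀ i, MeanLE (Measure.pi fun _ : Fin N => π) (fun Z => a (Z i) ^ 4)
      (linBarConst K lam d B) := fun i =>
    MeanLE.coord (f := fun _ y => a y ^ 4) i (fun Z c y => rfl) ha4'
  refine abs_integral_avg_le (by omega)
    (F := fun i Z => a (Z i) * b i Z (Z i) * (1 / (1 + loo lam i Z (Z i)) - 1 / (1 + δ))
      + (v ⬝ᵥ res lam (Finset.univ.erase i) Z *ᵥ w - v ⬝ᵥ res lam Finset.univ Z *ᵥ w))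
    (M := fun i Z => a (Z i) * b i Z (Z i) / (1 + δ)
      - v ⬝ᵥ res lam (Finset.univ.erase i) Z *ᵥ w) ?_ ?_ ?_ ?_ ?_
  · intro Z
    have e1 : ∀ i, (a (Z i) * b i Z (Z i) * (1 / (1 + loo lam i Z (Z i)) - 1 / (1 + δ))
      + (v ⬝ᵥ res lam (Finset.univ.erase i) Z *ᵥ w - v ⬝ᵥ res lam Finset.univ Z *ᵥ w))
      + (a (Z i) * b i Z (Z i) / (1 + δ) - v ⬝ᵥ res lam (Finset.univ.erase i) Z *ᵥ w)
      = (u ⬝ᵥ Z i) * (Z i ⬝ᵥ res lam Finset.univ Z *ᵥ w) - v ⬝ᵥ res lam Finset.univ Z *ᵥ w := by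
      intro i
      rw [dot_res_mulVec_self hl]
      simp only [a, b]
      ring
    simp only [e1]
    rw [Finset.sum_sub_distrib, mul_sub, ← gram_quad]
    simp only [Finset.sum_const, Finset.card_univ, Fintype.card_fin, nsmul_eq_mul]
    rw [← mul_assoc, one_div_mul_cancel hN'.ne', one_mul]
    have e2 : gram Finset.univ Z *ᵥ (res lam Finset.univ Z *ᵥ w)
        = w - lam • (res lam Finset.univ Z *ᵥ w) := by
      rw [eq_sub_iff_add_eq]
      exact reg_mulVec_ridge (gram_posSemidef _ Z) hl w
    rw [e2, hv]
    simp only [dotProduct_sub, sub_dotProduct, dotProduct_smul, smul_dotProduct, smul_eq_mul]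
    rw [dotProduct_comm u w]
    ring
  · intro i
    have hq := h.meanLE_loo_sub hl hN hg hδ hd hfix (pow_pos ht 2) (by rw [htN]; ring) i
    have htot := ((((ha4 i).add (hb4 i)).const_mul (a := 1 / (4 * t)) (by positivity)).add
      (hq.const_mul (a := t / 2) (by positivity))).add
      ((((MeanLE.const (μ := Measure.pi fun _ : Fin N => π) (c := 1) zero_le_one).add
        (hb4 i)).const_mul (a := B / lam / (2 * t)) (by positivity)).add
        (MeanLE.const (c := 1 / (2 * t)) (by positivity)))
    refine (htot.weaken (le_of_eq ?_)).mono ?_ (fun Z => abs_nonneg _) fun Z => ?_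
    · rw [quadConst]
      field_simp
      ring
    · refine Continuous.measurable ?_
      refine ((((haZ i).mul (hbZ i)).mul ((continuous_const.div (continuous_const.add (hqZ i))
        fun Z => ?_).sub continuous_const)).add ((hres i).sub hresu)).abs
      exact (add_pos_of_pos_of_nonneg one_pos (loo_nonneg hl i Z (Z i))).ne'
    · have hq0 := loo_nonneg hl i Z (Z i)
      have hρ := inv_sub_inv_sq_le hq0 hδ
      set q := loo lam i Z (Z i) with hqdef
      set ρ := 1 / (1 + q) - 1 / (1 + δ)
      set A := a (Z i)
      set b' := b i Z (Z i) with hb'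
      have f1 : |A * b' * ρ| ≤ 1 / (4 * t) * (A ^ 4 + b' ^ 4) + t / 2 * |q - δ| := by
        have y := mul_le_young (a := |A * b'|) (b := |ρ|) ht
        rw [← abs_mul, sq_abs, sq_abs] at y
        have y2 : (A * b') ^ 2 ≤ (A ^ 4 + b' ^ 4) / 2 := by nlinarith [sq_nonneg (A ^ 2 - b' ^ 2)]
        calc |A * b' * ρ| ≤ ((A * b') ^ 2 / t + t * ρ ^ 2) / 2 := y
          _ ≤ ((A ^ 4 + b' ^ 4) / 2 / t + t * |q - δ|) / 2 := by gcongr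
          _ = _ := by field_simp; ring
      set x := res lam (Finset.univ.erase i) Z *ᵥ Z i with hx
      have f2 : v ⬝ᵥ res lam (Finset.univ.erase i) Z *ᵥ w - v ⬝ᵥ res lam Finset.univ Z *ᵥ w
          = 1 / (N : ℝ) * b' / (1 + q) * (v ⬝ᵥ x) := by
        rw [res_mulVec hl i, dotProduct_sub, dotProduct_smul, smul_eq_mul, sub_sub_cancel]
      have f3 : (v ⬝ᵥ x) ^ 2 ≤ B * (N * q / lam) := by
        refine (dot_cauchy_schwarz v x).trans (mul_le_mul hvv ?_ (dot_self_nonneg x) hB)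
        rw [le_div_iff₀ hl, mul_comm, hqdef, ← loo_mul_N]
        exact ridge_normSq_le (gram_posSemidef _ Z) hl (Z i)
      have f4 : (1 / (N : ℝ) * b' / (1 + q) * (v ⬝ᵥ x)) ^ 2 ≤ B / lam * b' ^ 2 / N := by
        have g1 : q / (1 + q) ^ 2 ≤ 1 := by
          rw [div_le_one (by positivity)]; nlinarith
        calc (1 / (N : ℝ) * b' / (1 + q) * (v ⬝ᵥ x)) ^ 2
            = (1 / (N : ℝ) * b' / (1 + q)) ^ 2 * (v ⬝ᵥ x) ^ 2 := by ring
          _ ≤ (1 / (N : ℝ) * b' / (1 + q)) ^ 2 * (B * (N * q / lam)) := by gcongr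
          _ = B / lam * b' ^ 2 / N * (q / (1 + q) ^ 2) := by field_simp
          _ ≤ B / lam * b' ^ 2 / N * 1 := by gcongr
          _ = _ := mul_one _
      have f5 : |1 / (N : ℝ) * b' / (1 + q) * (v ⬝ᵥ x)|
          ≤ B / lam / (2 * t) * (1 + b' ^ 4) + 1 / (2 * t) := by
        have y := mul_le_young (a := 1) (b := |1 / (N : ℝ) * b' / (1 + q) * (v ⬝ᵥ x)|) ht
        rw [one_mul, sq_abs] at y
        have y2 : b' ^ 2 ≤ 1 + b' ^ 4 := by nlinarith [sq_nonneg (b' ^ 2 - 1)]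
        have y3 : t ^ 2 ≤ (N : ℝ) := by
          rw [htN]; exact pow_le_pow_right₀ ht1 (by norm_num)
        calc |1 / (N : ℝ) * b' / (1 + q) * (v ⬝ᵥ x)|
            ≤ (1 ^ 2 / t + t * (1 / (N : ℝ) * b' / (1 + q) * (v ⬝ᵥ x)) ^ 2) / 2 := y
          _ ≤ (1 ^ 2 / t + t * (B / lam * b' ^ 2 / N)) / 2 := by gcongr
          _ ≤ (1 ^ 2 / t + t * (B / lam * (1 + b' ^ 4) / t ^ 2)) / 2 := by gcongr
          _ = _ := by field_simp; ring
      rw [f2]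
      exact (abs_add_le _ _).trans (add_le_add f1 f5)
  · intro i
    refine Continuous.measurable ?_
    refine ((((haZ i).mul (hbZ i)).mul ((continuous_const.div (continuous_const.add (hqZ i))
        fun Z => ?_).sub continuous_const)).add ((hres i).sub hresu))
    exact (add_pos_of_pos_of_nonneg one_pos (loo_nonneg hl i Z (Z i))).ne'
  · intro i
    refine Integrable.sub (Integrable.div_const ?_ _) (integrable_res_dot hl _ v w _)
    refine (((ha4 i).add (hb4 i)).add (MeanLE.const zero_le_one)).integrable.mono'
      ((haZ i).mul (hbZ i)).aestronglyMeasurable (ae_of_all _ fun Z => ?_)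
    rw [Real.norm_eq_abs, abs_le]
    set A := a (Z i)
    set b' := b i Z (Z i)
    constructor <;>
    nlinarith [sq_nonneg (A - b'), sq_nonneg (A + b'), sq_nonneg (A ^ 2 - 1 / 2),
      sq_nonneg (b' ^ 2 - 1 / 2)]
  · intro i
    have i1 : Integrable (fun p : (Fin N → Fin n → ℝ) × (Fin n → ℝ) => a p.2 * b i p.1 p.2)
        ((Measure.pi fun _ : Fin N => π).prod π) := by
      refine ((ha4'.add (h.meanLE_lin_res hl hN hg hw i)).add (MeanLE.const zero_le_one)).integrable.mono'
        (Continuous.aestronglyMeasurable ?_) (ae_of_all _ fun p => ?_)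
      · exact (show Continuous fun p : (Fin N → Fin n → ℝ) × (Fin n → ℝ) => a p.2 by
          fun_prop).mul (hbm i)
      · rw [Real.norm_eq_abs, abs_le]
        simp only [← show b i p.1 p.2 = p.2 ⬝ᵥ res lam (Finset.univ.erase i) p.1 *ᵥ w from rfl]
        set A := a p.2
        set b' := b i p.1 p.2
        constructor <;>
        nlinarith [sq_nonneg (A - b'), sq_nonneg (A + b'), sq_nonneg (A ^ 2 - 1 / 2),
          sq_nonneg (b' ^ 2 - 1 / 2)]
    have i2 : Integrable (fun Z : Fin N → Fin n → ℝ => a (Z i) * b i Z (Z i))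
        (Measure.pi fun _ : Fin N => π) := by
      refine (((ha4 i).add (hb4 i)).add (MeanLE.const zero_le_one)).integrable.mono'
        ((haZ i).mul (hbZ i)).aestronglyMeasurable (ae_of_all _ fun Z => ?_)
      rw [Real.norm_eq_abs, abs_le]
      set A := a (Z i)
      set b' := b i Z (Z i)
      constructor <;>
      nlinarith [sq_nonneg (A - b'), sq_nonneg (A + b'), sq_nonneg (A ^ 2 - 1 / 2),
        sq_nonneg (b' ^ 2 - 1 / 2)]
    rw [integral_sub (i2.div_const _) (integrable_res_dot hl _ v w _), integral_div,
      integral_coord (f := fun Z y => a y * b i Z y) i (fun Z c y => by simp only [hbup])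
        ((show Continuous fun p : (Fin N → Fin n → ℝ) × (Fin n → ℝ) => a p.2 by
          fun_prop).mul (hbm i)).measurable,
      integral_prod _ i1]
    have e : ∀ Z : Fin N → Fin n → ℝ, ∫ y, a y * b i Z y ∂π
        = (1 + δ) * (v ⬝ᵥ res lam (Finset.univ.erase i) Z *ᵥ w) := by
      intro Z
      simp only [a, b]
      simp only [dotProduct_comm _ (res lam (Finset.univ.erase i) Z *ᵥ w)]
      rw [h.integral_lin_mul, ← mulVec_dot h.transpose, hSu, smul_dotProduct, smul_eq_mul,
        dotProduct_comm]
    simp only [e]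
    rw [integral_const_mul, mul_div_cancel_left₀ _ (by positivity), sub_self]

end QuadraticForms

end LinearESN

namespace LinearESN

/-! ### Test error and training error -/

section TestError

variable {n N : ℕ} {π : Measure (Fin n → ℝ)} [IsProbabilityMeasure π] {m : Fin n → ℝ}
  {S : Matrix (Fin n) (Fin n) ℝ} {K lam δ : ℝ}

/-- The constant in the comparison of test and training forms. -/
noncomputable def testConst (K lam g d B : ℝ) : ℝ :=
  loewnerConst K lam g + 2 * linConst K lam g B + 1
    + (1 + d) ^ 2 * (linConst K lam g B + looConst K lam g d)

/-- The quadratic form `(Q w)ᵀ (N⁻¹ Z Zᵀ) (Q w)` averaged over the sample. -/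
lemma gram_res_quad (hl : 0 < lam) (Z : Fin N → Fin n → ℝ) (w : Fin n → ℝ) :
    (res lam Finset.univ Z *ᵥ w) ⬝ᵥ gram Finset.univ Z *ᵥ (res lam Finset.univ Z *ᵥ w)
      = 1 / (N : ℝ) * ∑ i, ((Z i ⬝ᵥ res lam (Finset.univ.erase i) Z *ᵥ w)
        / (1 + loo lam i Z (Z i))) ^ 2 := by
  rw [gram_quad]
  congr 1
  refine Finset.sum_congr rfl fun i _ => ?_
  rw [dotProduct_comm _ (Z i), dot_res_mulVec_self hl, pow_two]

/-- A fresh feature sees `(1 + δ)²` times the energy seen by the training features, which are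
correlated with the resolvent. -/
lemma Concentrated.abs_integral_test_sub_le (h : Concentrated π m S K) (hl : 0 < lam) (hN : 2 ≤ N)
    {g d B t : ℝ} (hg : (n : ℝ) ≤ g * N) (hδ : 0 ≤ δ) (hd : δ ≤ d) (hfix : FixedPoint N lam S δ)
    (ht : 0 < t) (htN : (N : ℝ) = t ^ 4) {w : Fin n → ℝ} (hw : w ⬝ᵥ w ≤ B) :
    |∫ p : (Fin N → Fin n → ℝ) × (Fin n → ℝ), ((p.2 ⬝ᵥ res lam Finset.univ p.1 *ᵥ w) ^ 2
      - (1 + δ) ^ 2 * ((res lam Finset.univ p.1 *ᵥ w) ⬝ᵥ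
        gram Finset.univ p.1 *ᵥ (res lam Finset.univ p.1 *ᵥ w)))
      ∂((Measure.pi fun _ : Fin N => π).prod π)| ≤ testConst K lam g d B / t := by
  have hS := h.posSemidef
  have hK := h.nonneg
  have hN' : (0 : ℝ) < N := by positivity
  have hN1 : (1 : ℝ) ≤ N := by exact_mod_cast (by omega : 1 ≤ N)
  have ht1 : 1 ≤ t := by
    by_contra hlt
    push Not at hlt
    have := pow_lt_one₀ ht.le hlt (by norm_num : 4 ≠ 0)
    linarith
  have hd0 := hδ.trans hd
  have hB : 0 ≤ B := (dot_self_nonneg w).trans hw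
  let b : Fin N → (Fin N → Fin n → ℝ) → (Fin n → ℝ) → ℝ := fun i Z y =>
    y ⬝ᵥ res lam (Finset.univ.erase i) Z *ᵥ w
  have hbm : ∀ i, Continuous fun p : (Fin N → Fin n → ℝ) × (Fin n → ℝ) => b i p.1 p.2 := fun i =>
    continuous_quad_comp continuous_snd (continuous_res_comp hl _ continuous_fst) continuous_const
  have hbu : Continuous fun p : (Fin N → Fin n → ℝ) × (Fin n → ℝ) =>
      p.2 ⬝ᵥ res lam Finset.univ p.1 *ᵥ w :=
    continuous_quad_comp continuous_snd (continuous_res_comp hl _ continuous_fst) continuous_const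
  have hdiag : ∀ i : Fin N, Continuous fun Z : Fin N → Fin n → ℝ => (Z, Z i) := fun i =>
    continuous_id.prodMk (continuous_apply i)
  have hbZ : ∀ i, Continuous fun Z : Fin N → Fin n → ℝ => b i Z (Z i) := fun i =>
    (hbm i).comp (hdiag i)
  have hqZ : ∀ i, Continuous fun Z : Fin N → Fin n → ℝ => loo lam i Z (Z i) := fun i =>
    (continuous_loo hl i).comp (hdiag i)
  have hbup : ∀ i Z c y, b i (Function.update Z i c) y = b i Z y := fun i Z c y => by
    simp only [b, res_erase_update]
  have hb4' : ∀ i, MeanLE ((Measure.pi fun _ : Fin N => π).prod π) (fun p => b i p.1 p.2 ^ 4)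
      (linConst K lam g B) := fun i => h.meanLE_lin_res hl hN hg hw i
  have hb4 : ∀ i, MeanLE (Measure.pi fun _ : Fin N => π) (fun Z => b i Z (Z i) ^ 4)
      (linConst K lam g B) := fun i =>
    MeanLE.coord (f := fun Z y => b i Z y ^ 4) i (fun Z c y => by simp only [hbup]) (hb4' i)
  have sq_le : ∀ x : ℝ, x ^ 2 ≤ 1 + x ^ 4 := fun x => by nlinarith [sq_nonneg (x ^ 2 - 1)]
  have hint1 : ∀ i, Integrable (fun p : (Fin N → Fin n → ℝ) × (Fin n → ℝ) => b i p.1 p.2 ^ 2)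
      ((Measure.pi fun _ : Fin N => π).prod π) := fun i =>
    ((MeanLE.const zero_le_one).add (hb4' i)).integrable.mono'
      ((hbm i).pow 2).aestronglyMeasurable (ae_of_all _ fun p => by
        rw [Real.norm_eq_abs, abs_of_nonneg (sq_nonneg _)]; exact sq_le _)
  have hint2 : ∀ i, Integrable (fun Z : Fin N → Fin n → ℝ => b i Z (Z i) ^ 2)
      (Measure.pi fun _ : Fin N => π) := fun i =>
    ((MeanLE.const zero_le_one).add (hb4 i)).integrable.mono'
      ((hbZ i).pow 2).aestronglyMeasurable (ae_of_all _ fun p => by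
        rw [Real.norm_eq_abs, abs_of_nonneg (sq_nonneg _)]; exact sq_le _)
  -- the error of leaving out the sample `i` in the resolvent seen by the fresh feature `y`
  let e : Fin N → (Fin N → Fin n → ℝ) → (Fin n → ℝ) → ℝ := fun i Z y =>
    1 / (N : ℝ) * b i Z (Z i) / (1 + loo lam i Z (Z i))
      * (y ⬝ᵥ res lam (Finset.univ.erase i) Z *ᵥ Z i)
  have hec : ∀ i, Continuous fun p : (Fin N → Fin n → ℝ) × (Fin n → ℝ) => e i p.1 p.2 := fun i => by
    refine ((continuous_const.mul ((hbZ i).comp continuous_fst)).div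
      (continuous_const.add ((hqZ i).comp continuous_fst)) fun p => ?_).mul
      (continuous_quad_comp continuous_snd (continuous_res_comp hl _ continuous_fst)
        ((continuous_apply i).comp continuous_fst))
    exact (add_pos_of_pos_of_nonneg one_pos (loo_nonneg hl i p.1 (p.1 i))).ne'
  have he : ∀ i, MeanLE ((Measure.pi fun _ : Fin N => π).prod π) (fun p => e i p.1 p.2 ^ 2)
      ((loewnerConst K lam g + linConst K lam g B) / (2 * N)) := by
    intro i
    have hL := h.meanLE_loewner_sq hl hN hg i
    refine (MeanLE.prod (π := π) (F := fun Z y => e i Z y ^ 2) ((hec i).pow 2).measurable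
      (fun Z => ?_) ((hL.add (hb4 i)).const_mul (a := 1 / (2 * (N : ℝ))) (by positivity))).weaken
      (le_of_eq (by ring))
    set x := res lam (Finset.univ.erase i) Z *ᵥ Z i with hx
    have i1 : Integrable (fun y : Fin n → ℝ => (x ⬝ᵥ y) * (x ⬝ᵥ y)) π := h.integrable_lin_mul x x
    have e1 : ∀ y, e i Z y ^ 2 = (1 / (N : ℝ) * b i Z (Z i) / (1 + loo lam i Z (Z i))) ^ 2
        * ((x ⬝ᵥ y) * (x ⬝ᵥ y)) := by
      intro y
      simp only [e]
      rw [← hx, dotProduct_comm y x]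
      ring
    have hq0 := loo_nonneg hl i Z (Z i)
    have hxx := ridge_conj_le (gram_posSemidef _ Z) hl (h.le_loewner hl hN i Z) (Z i)
    rw [← res, ← hx] at hxx
    have hxq : Z i ⬝ᵥ x = N * loo lam i Z (Z i) := loo_mul_N lam i Z (Z i)
    rw [hxq] at hxx
    have hL1 := h.one_le_loewner hl i Z
    refine MeanLE.of_integrable (((hec i).comp (continuous_const.prodMk continuous_id)).pow 2).measurable
      (fun y => sq_nonneg _) ?_ ?_
    · simp only [e1]; exact i1.const_mul _
    · simp only [e1]
      rw [integral_const_mul, h.integral_lin_mul]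
      set q := loo lam i Z (Z i)
      set b' := b i Z (Z i)
      set L := loewner K lam m i Z
      have g1 : q / (1 + q) ^ 2 ≤ 1 := by
        rw [div_le_one (by positivity)]; nlinarith
      calc (1 / (N : ℝ) * b' / (1 + q)) ^ 2 * (x ⬝ᵥ S *ᵥ x)
          ≤ (1 / (N : ℝ) * b' / (1 + q)) ^ 2 * (L * (N * q)) := by gcongr
        _ = L * b' ^ 2 / N * (q / (1 + q) ^ 2) := by field_simp
        _ ≤ L * b' ^ 2 / N * 1 := by gcongr
        _ ≤ 1 / (2 * (N : ℝ)) * (L ^ 2 + b' ^ 4) := by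
          rw [mul_one, one_div, ← div_eq_inv_mul, div_le_div_iff₀ hN' (by positivity)]
          nlinarith [mul_nonneg hN'.le (sq_nonneg (L - b' ^ 2))]
  have hdec : ∀ i (Z : Fin N → Fin n → ℝ) y, y ⬝ᵥ res lam Finset.univ Z *ᵥ w = b i Z y - e i Z y := by
    intro i Z y
    rw [res_mulVec hl i, dotProduct_sub, dotProduct_smul, smul_eq_mul]
  refine abs_integral_avg_le (by omega)
    (F := fun i p => ((p.2 ⬝ᵥ res lam Finset.univ p.1 *ᵥ w) ^ 2 - b i p.1 p.2 ^ 2)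
      + b i p.1 (p.1 i) ^ 2 * (1 - (1 + δ) ^ 2 * (1 / (1 + loo lam i p.1 (p.1 i))) ^ 2))
    (M := fun i p => b i p.1 p.2 ^ 2 - b i p.1 (p.1 i) ^ 2) ?_ ?_ ?_ ?_ ?_
  · intro p
    rw [gram_res_quad hl]
    have e1 : ∀ i, ((p.2 ⬝ᵥ res lam Finset.univ p.1 *ᵥ w) ^ 2 - b i p.1 p.2 ^ 2)
      + b i p.1 (p.1 i) ^ 2 * (1 - (1 + δ) ^ 2 * (1 / (1 + loo lam i p.1 (p.1 i))) ^ 2)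
      + (b i p.1 p.2 ^ 2 - b i p.1 (p.1 i) ^ 2)
      = (p.2 ⬝ᵥ res lam Finset.univ p.1 *ᵥ w) ^ 2 - (1 + δ) ^ 2 *
        ((p.1 i ⬝ᵥ res lam (Finset.univ.erase i) p.1 *ᵥ w) / (1 + loo lam i p.1 (p.1 i))) ^ 2 := by
      intro i; simp only [b]; ring
    simp only [e1]
    rw [Finset.sum_sub_distrib, ← Finset.mul_sum]
    simp only [Finset.sum_const, Finset.card_univ, Fintype.card_fin, nsmul_eq_mul]
    field_simp
  · intro i
    have hq := (h.meanLE_loo_sub hl hN hg hδ hd hfix (pow_pos ht 2) (by rw [htN]; ring) i).comp_fst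
      (π := π)
    have hb1 := (hb4 i).comp_fst (π := π)
    have htot := (((he i).const_mul (a := 2 * t ^ 2) (by positivity)).add
      (((MeanLE.const (c := 1) zero_le_one).add (hb4' i)).const_mul (a := 1 / t)
        (by positivity))).add
      (((hb1.const_mul (a := 1 / t) (by positivity)).add
        (hq.const_mul (a := t) (by positivity))).const_mul (a := (1 + d) ^ 2) (by positivity))
    refine (htot.weaken ?_).mono ?_ (fun Z => abs_nonneg _) fun p => ?_
    · have l1 := loewnerConst_nonneg (lam := lam) (g := g) hK
      have l2 : 0 ≤ linConst K lam g B := (hb4 i).2.2.1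
      have e1 : 2 * t ^ 2 * ((loewnerConst K lam g + linConst K lam g B) / (2 * N))
          ≤ (loewnerConst K lam g + linConst K lam g B) / t := by
        rw [htN]
        have : 2 * t ^ 2 * ((loewnerConst K lam g + linConst K lam g B) / (2 * t ^ 4))
            = (loewnerConst K lam g + linConst K lam g B) / t ^ 2 := by field_simp
        rw [this]
        gcongr
        nlinarith
      refine (add_le_add (add_le_add e1 le_rfl) le_rfl).trans (le_of_eq ?_)
      rw [testConst]
      field_simp
      ring
    · refine Continuous.measurable ?_
      refine (((hbu.pow 2).sub ((hbm i).pow 2)).add ((((hbZ i).comp continuous_fst).pow 2).mul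
        (continuous_const.sub (continuous_const.mul ((continuous_const.div
          (continuous_const.add ((hqZ i).comp continuous_fst)) fun p => ?_).pow 2))))).abs
      exact (add_pos_of_pos_of_nonneg one_pos (loo_nonneg hl i p.1 (p.1 i))).ne'
    · obtain ⟨Z, y⟩ := p
      simp only
      have hq0 := loo_nonneg hl i Z (Z i)
      have hρ := inv_sub_inv_sq_le hq0 hδ
      rw [hdec i]
      set q := loo lam i Z (Z i)
      set x := b i Z y
      set b' := b i Z (Z i)
      set e' := e i Z y
      have f1 : |(x - e') ^ 2 - x ^ 2| ≤ 2 * t ^ 2 * e' ^ 2 + 1 / t * (1 + x ^ 4) := by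
        have y1 := mul_le_young (a := |x|) (b := |e'|) (η := t) ht
        rw [sq_abs, sq_abs, ← abs_mul] at y1
        have y2 : |(x - e') ^ 2 - x ^ 2| ≤ e' ^ 2 + 2 * |x * e'| := by
          have : (x - e') ^ 2 - x ^ 2 = e' ^ 2 - 2 * (x * e') := by ring
          rw [this]
          refine (abs_sub _ _).trans (le_of_eq ?_)
          rw [abs_of_nonneg (sq_nonneg e'), abs_mul, abs_of_pos (by norm_num : (0 : ℝ) < 2)]
        have y3 : (1 + t) * e' ^ 2 ≤ 2 * t ^ 2 * e' ^ 2 :=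
          mul_le_mul_of_nonneg_right (by nlinarith) (sq_nonneg _)
        have y4 : x ^ 2 / t ≤ 1 / t * (1 + x ^ 4) := by
          rw [div_eq_inv_mul, one_div]
          exact mul_le_mul_of_nonneg_left (sq_le x) (by positivity)
        linarith
      set ρ := 1 / (1 + q) - 1 / (1 + δ) with hρdef
      have f2 : |b' ^ 2 * (1 - (1 + δ) ^ 2 * (1 / (1 + q)) ^ 2)|
          ≤ (1 + d) ^ 2 * (1 / t * b' ^ 4 + t * |q - δ|) := by
        have e1 : b' ^ 2 * (1 - (1 + δ) ^ 2 * (1 / (1 + q)) ^ 2)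
            = -((1 + δ) ^ 2 * (b' ^ 2 * ρ * (1 / (1 + q) + 1 / (1 + δ)))) := by
          rw [hρdef]; field_simp; ring
        have a1 : 1 / (1 + q) ≤ 1 := by rw [div_le_one (by positivity)]; linarith
        have a2 : 1 / (1 + δ) ≤ 1 := by rw [div_le_one (by positivity)]; linarith
        have a3 : 0 ≤ 1 / (1 + q) + 1 / (1 + δ) := by positivity
        have y1 := mul_le_young (a := b' ^ 2) (b := |ρ|) ht
        rw [sq_abs] at y1
        rw [e1, abs_neg, abs_mul, abs_of_nonneg (sq_nonneg (1 + δ)), abs_mul,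
          abs_of_nonneg a3, abs_mul, abs_of_nonneg (sq_nonneg b')]
        have y2 : b' ^ 2 * |ρ| * (1 / (1 + q) + 1 / (1 + δ)) ≤ b' ^ 2 * |ρ| * 2 := by
          gcongr; linarith
        have y3 : b' ^ 2 * |ρ| * 2 ≤ 1 / t * b' ^ 4 + t * |q - δ| := by
          have : t * ρ ^ 2 ≤ t * |q - δ| := by gcongr
          have e2 : (b' ^ 2) ^ 2 / t = 1 / t * b' ^ 4 := by ring
          linarith
        calc (1 + δ) ^ 2 * (b' ^ 2 * |ρ| * (1 / (1 + q) + 1 / (1 + δ)))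
            ≤ (1 + δ) ^ 2 * (1 / t * b' ^ 4 + t * |q - δ|) := by gcongr; exact y2.trans y3
          _ ≤ _ := by gcongr
      exact (abs_add_le _ _).trans (add_le_add f1 f2)
  · intro i
    refine Continuous.measurable ?_
    refine (((hbu.pow 2).sub ((hbm i).pow 2)).add ((((hbZ i).comp continuous_fst).pow 2).mul
        (continuous_const.sub (continuous_const.mul ((continuous_const.div
          (continuous_const.add ((hqZ i).comp continuous_fst)) fun p => ?_).pow 2)))))
    exact (add_pos_of_pos_of_nonneg one_pos (loo_nonneg hl i p.1 (p.1 i))).ne'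
  · intro i
    exact (hint1 i).sub ((hint2 i).comp_fst π)
  · intro i
    rw [integral_sub (hint1 i) ((hint2 i).comp_fst π),
      ← integral_coord (f := fun Z y => b i Z y ^ 2) i (fun Z c y => by simp only [hbup])
        ((hbm i).pow 2).measurable,
      integral_fun_fst (fun Z : Fin N → Fin n → ℝ => b i Z (Z i) ^ 2)]
    simp

end TestError

end LinearESN

namespace LinearESN

/-! ### Finite differences in the regularisation -/

section FiniteDifference

/-- The pointwise expansion of `lam ↦ lam Q` passes to the mean. -/
lemma abs_integral_expansion_le {Ω : Type*} [MeasurableSpace Ω] {ρ : Measure Ω} {f₁ f₀ f' : Ω → ℝ}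
    {lam h : ℝ} (i₁ : Integrable f₁ ρ) (i₀ : Integrable f₀ ρ) (i' : Integrable f' ρ)
    (hb : ∀ ω, |(lam + h) * f₁ ω - lam * f₀ ω - h * f' ω| ≤ h ^ 2 * f₀ ω / lam) :
    |(lam + h) * ∫ ω, f₁ ω ∂ρ - lam * ∫ ω, f₀ ω ∂ρ - h * ∫ ω, f' ω ∂ρ|
      ≤ h ^ 2 * (∫ ω, f₀ ω ∂ρ) / lam := by
  have e : (lam + h) * ∫ ω, f₁ ω ∂ρ - lam * ∫ ω, f₀ ω ∂ρ - h * ∫ ω, f' ω ∂ρ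
      = ∫ ω, ((lam + h) * f₁ ω - lam * f₀ ω - h * f' ω) ∂ρ := by
    have hi : Integrable (fun ω => (lam + h) * f₁ ω - lam * f₀ ω) ρ :=
      (i₁.const_mul _).sub (i₀.const_mul _)
    rw [integral_sub hi (i'.const_mul _), integral_sub (i₁.const_mul _) (i₀.const_mul _)]
    simp only [integral_const_mul]
  rw [e]
  refine (abs_integral_le_integral_abs).trans ?_
  have e2 : h ^ 2 * (∫ ω, f₀ ω ∂ρ) / lam = ∫ ω, h ^ 2 * f₀ ω / lam ∂ρ := by
    rw [integral_div, integral_const_mul]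
  rw [e2]
  exact integral_mono (((i₁.const_mul _).sub (i₀.const_mul _)).sub (i'.const_mul _)).abs
    ((i₀.const_mul _).div_const _) hb

/-- A function is controlled by a difference quotient of a nearby function. -/
lemma abs_sub_le_of_difference {a₁ a₀ b₁ b₀ l₁ l₀ h x D e₁ e₀ c c' : ℝ} (hh : 0 < h) (h₁ : 0 ≤ l₁)
    (h₀ : 0 ≤ l₀) (hx : |l₁ * a₁ - l₀ * a₀ - h * x| ≤ c * h ^ 2)
    (hD : |l₁ * b₁ - l₀ * b₀ - h * D| ≤ c' * h ^ 2) (he₁ : |a₁ - b₁| ≤ e₁) (he₀ : |a₀ - b₀| ≤ e₀) :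
    |x - D| ≤ (c + c') * h + (l₁ * e₁ + l₀ * e₀) / h := by
  have k₁ : |l₁ * (a₁ - b₁)| ≤ l₁ * e₁ := by rw [abs_mul, abs_of_nonneg h₁]; gcongr
  have k₀ : |l₀ * (a₀ - b₀)| ≤ l₀ * e₀ := by rw [abs_mul, abs_of_nonneg h₀]; gcongr
  rw [abs_le] at hx hD k₁ k₀
  have hlim : h * ((c + c') * h + (l₁ * e₁ + l₀ * e₀) / h)
      = (c + c') * h ^ 2 + (l₁ * e₁ + l₀ * e₀) := by field_simp
  rw [abs_le]
  constructor
  · refine le_of_mul_le_mul_left ?_ hh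
    rw [mul_neg, hlim]; linarith
  · refine le_of_mul_le_mul_left ?_ hh
    rw [hlim]; linarith

variable {n N : ℕ} {π : Measure (Fin n → ℝ)} [IsProbabilityMeasure π] {m : Fin n → ℝ}
  {S : Matrix (Fin n) (Fin n) ℝ} {K lam δ : ℝ}

lemma res_quad_nonneg (hl : 0 < lam) (Z : Fin N → Fin n → ℝ) (w : Fin n → ℝ) :
    0 ≤ w ⬝ᵥ res lam Finset.univ Z *ᵥ w :=
  psd_nonneg (res_posSemidef hl _ Z) w

lemma res_energy_nonneg (Z : Fin N → Fin n → ℝ) (w : Fin n → ℝ) :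
    0 ≤ (res lam Finset.univ Z *ᵥ w) ⬝ᵥ gram Finset.univ Z *ᵥ (res lam Finset.univ Z *ᵥ w) :=
  psd_nonneg (gram_posSemidef _ Z) _

lemma res_energy_le (hl : 0 < lam) (Z : Fin N → Fin n → ℝ) (w : Fin n → ℝ) :
    (res lam Finset.univ Z *ᵥ w) ⬝ᵥ gram Finset.univ Z *ᵥ (res lam Finset.univ Z *ᵥ w)
      ≤ w ⬝ᵥ w / lam := by
  refine le_trans ?_ (ridge_quad_le (gram_posSemidef Finset.univ Z) hl w)
  rw [ridge_energy (gram_posSemidef Finset.univ Z) hl w]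
  have := mul_nonneg hl.le (dot_self_nonneg (ridge lam (gram Finset.univ Z) *ᵥ w))
  rw [res]; linarith

lemma continuous_res_quad (hl : 0 < lam) :
    Continuous fun p : (Fin N → Fin n → ℝ) × (Fin n → ℝ) =>
      p.2 ⬝ᵥ res lam Finset.univ p.1 *ᵥ p.2 :=
  continuous_quad_comp continuous_snd (continuous_res_comp hl _ continuous_fst) continuous_snd

lemma continuous_res_energy (hl : 0 < lam) :
    Continuous fun p : (Fin N → Fin n → ℝ) × (Fin n → ℝ) =>
      (res lam Finset.univ p.1 *ᵥ p.2) ⬝ᵥ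
        gram Finset.univ p.1 *ᵥ (res lam Finset.univ p.1 *ᵥ p.2) := by
  have hc : Continuous fun p : (Fin N → Fin n → ℝ) × (Fin n → ℝ) =>
      res lam Finset.univ p.1 *ᵥ p.2 :=
    (continuous_res_comp hl _ continuous_fst).matrix_mulVec continuous_snd
  exact continuous_quad_comp hc ((continuous_gram _).comp continuous_fst) hc

lemma integrable_res_quad (hl : 0 < lam) (w : Fin n → ℝ) :
    Integrable (fun Z : Fin N → Fin n → ℝ => w ⬝ᵥ res lam Finset.univ Z *ᵥ w)
      (Measure.pi fun _ : Fin N => π) :=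
  (integrable_const (w ⬝ᵥ w / lam)).mono'
    ((continuous_res_quad hl).comp
      (continuous_id.prodMk continuous_const)).measurable.aestronglyMeasurable
    (ae_of_all _ fun Z => by
      rw [Real.norm_eq_abs]
      exact (abs_of_nonneg (res_quad_nonneg hl Z w)).le.trans
        (ridge_quad_le (gram_posSemidef _ Z) hl w))

lemma integrable_res_energy (hl : 0 < lam) (w : Fin n → ℝ) :
    Integrable (fun Z : Fin N → Fin n → ℝ => (res lam Finset.univ Z *ᵥ w) ⬝ᵥ
        gram Finset.univ Z *ᵥ (res lam Finset.univ Z *ᵥ w)) (Measure.pi fun _ : Fin N => π) :=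
  (integrable_const (w ⬝ᵥ w / lam)).mono'
    ((continuous_res_energy hl).comp
      (continuous_id.prodMk continuous_const)).measurable.aestronglyMeasurable
    (ae_of_all _ fun Z => by
      rw [Real.norm_eq_abs, abs_of_nonneg (res_energy_nonneg Z w)]
      exact res_energy_le hl Z w)

/-- The mean energy `(Q w)ᵀ (N⁻¹ Z Zᵀ) (Q w)`, the derivative of `lam ↦ lam E(wᵀ Q w)`, is close to
any approximate difference quotient `D` of the deterministic equivalent. -/
lemma Concentrated.abs_integral_energy_sub_le (h : Concentrated π m S K) (hl : 0 < lam)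
    (hN : 2 ≤ N) {g d B t η δ' c D : ℝ} (hg : (n : ℝ) ≤ g * N) (hη : 0 < η)
    (hδ : 0 ≤ δ) (hd : δ ≤ d) (hfix : FixedPoint N lam S δ)
    (hδ' : 0 ≤ δ') (hd' : δ' ≤ d) (hfix' : FixedPoint N (lam + η) S δ')
    (ht : 0 < t) (htN : (N : ℝ) = t ^ 4) {w : Fin n → ℝ} (hw : w ⬝ᵥ w ≤ B)
    (hD : |(lam + η) * (w ⬝ᵥ resolvent (lam + η) δ' S *ᵥ w) - lam * (w ⬝ᵥ resolvent lam δ S *ᵥ w)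
      - η * D| ≤ c * η ^ 2) :
    |∫ Z, (res lam Finset.univ Z *ᵥ w) ⬝ᵥ gram Finset.univ Z *ᵥ (res lam Finset.univ Z *ᵥ w)
        ∂(Measure.pi fun _ : Fin N => π) - D|
      ≤ (B / lam ^ 2 + c) * η
        + ((lam + η) * (quadConst K (lam + η) g d B / t) + lam * (quadConst K lam g d B / t))
          / η := by
  have hl' : 0 < lam + η := by linarith
  have i₀ := integrable_res_quad (N := N) (π := π) hl w
  have i₁ := integrable_res_quad (N := N) (π := π) hl' w
  have hexp := abs_integral_expansion_le (lam := lam) (h := η) i₁ i₀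
    (integrable_res_energy (N := N) (π := π) hl w)
    fun Z => ridge_expansion_bound (gram_posSemidef Finset.univ Z) hl hη.le w
  have hdiff : ∀ {l δ : ℝ}, 0 < l → 0 ≤ δ → δ ≤ d → FixedPoint N l S δ →
      |∫ Z, w ⬝ᵥ res l Finset.univ Z *ᵥ w ∂(Measure.pi fun _ : Fin N => π)
        - w ⬝ᵥ resolvent l δ S *ᵥ w| ≤ quadConst K l g d B / t := by
    intro l δ hl hδ hd hfix
    have := h.abs_integral_quad_sub_le hl hN hg hδ hd hfix ht htN hw
    rw [integral_sub (integrable_const _) (integrable_res_quad hl w), integral_const,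
      probReal_univ, one_smul] at this
    rwa [abs_sub_comm]
  refine abs_sub_le_of_difference hη hl'.le hl.le (hexp.trans ?_) hD (hdiff hl' hδ' hd' hfix')
    (hdiff hl hδ hd hfix)
  have hle : ∫ Z, w ⬝ᵥ res lam Finset.univ Z *ᵥ w ∂(Measure.pi fun _ : Fin N => π) ≤ B / lam := by
    refine (integral_mono i₀ (integrable_const (B / lam)) fun Z => ?_).trans (by simp)
    exact (ridge_quad_le (gram_posSemidef _ Z) hl w).trans (by gcongr)
  have e : B / lam ^ 2 * η ^ 2 = η ^ 2 * (B / lam) / lam := by field_simp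
  rw [e]; gcongr

lemma Concentrated.integrable_prod_res_quad (h : Concentrated π m S K) (hl : 0 < lam) :
    Integrable (fun p : (Fin N → Fin n → ℝ) × (Fin n → ℝ) =>
      1 / (N : ℝ) * (p.2 ⬝ᵥ res lam Finset.univ p.1 *ᵥ p.2))
      ((Measure.pi fun _ : Fin N => π).prod π) := by
  have hi : Integrable (fun z : Fin n → ℝ => z ⬝ᵥ z / lam) π := by
    simpa using (h.integrable_quad 1).div_const lam
  refine ((hi.comp_snd (Measure.pi fun _ : Fin N => π)).mono'
    (continuous_res_quad hl).measurable.aestronglyMeasurable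
    (ae_of_all _ fun p => ?_)).const_mul _
  rw [Real.norm_eq_abs]
  exact (abs_of_nonneg (res_quad_nonneg hl _ _)).le.trans
        (ridge_quad_le (gram_posSemidef _ _) hl _)

lemma Concentrated.integrable_prod_res_energy (h : Concentrated π m S K) (hl : 0 < lam) :
    Integrable (fun p : (Fin N → Fin n → ℝ) × (Fin n → ℝ) =>
      1 / (N : ℝ) * ((res lam Finset.univ p.1 *ᵥ p.2) ⬝ᵥ
        gram Finset.univ p.1 *ᵥ (res lam Finset.univ p.1 *ᵥ p.2)))
      ((Measure.pi fun _ : Fin N => π).prod π) := by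
  have hi : Integrable (fun z : Fin n → ℝ => z ⬝ᵥ z / lam) π := by
    simpa using (h.integrable_quad 1).div_const lam
  refine ((hi.comp_snd (Measure.pi fun _ : Fin N => π)).mono'
    (continuous_res_energy hl).measurable.aestronglyMeasurable
    (ae_of_all _ fun p => ?_)).const_mul _
  rw [Real.norm_eq_abs, abs_of_nonneg (res_energy_nonneg _ _)]
  exact res_energy_le hl _ _

lemma Concentrated.integral_prod_res_quad (h : Concentrated π m S K) (hl : 0 < lam) :
    ∫ p : (Fin N → Fin n → ℝ) × (Fin n → ℝ), 1 / (N : ℝ) * (p.2 ⬝ᵥ res lam Finset.univ p.1 *ᵥ p.2)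
      ∂((Measure.pi fun _ : Fin N => π).prod π)
      = ∫ Z, resTrace S lam Finset.univ Z ∂(Measure.pi fun _ : Fin N => π) := by
  rw [integral_prod _ (h.integrable_prod_res_quad hl)]
  simp only [integral_const_mul, h.integral_quad, resTrace]

lemma Concentrated.abs_integral_resTrace_sub_le (h : Concentrated π m S K) (hl : 0 < lam)
    (hN : 2 ≤ N) {g d s : ℝ} (hg : (n : ℝ) ≤ g * N) (hδ : 0 ≤ δ) (hd : δ ≤ d)
    (hfix : FixedPoint N lam S δ) (hs : 0 < s) (hsN : (N : ℝ) = s ^ 2) :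
    |∫ Z, resTrace S lam Finset.univ Z ∂(Measure.pi fun _ : Fin N => π) - δ|
      ≤ traceConst K lam g d / s := by
  have hm := h.meanLE_resTrace_sub hl hN hg hδ hd hfix hs hsN
  have hi : Integrable (fun Z => resTrace S lam Finset.univ Z - δ)
      (Measure.pi fun _ : Fin N => π) :=
    hm.integrable.mono' (((continuous_resTrace hl _).sub
      continuous_const).measurable.aestronglyMeasurable) (ae_of_all _ fun Z => le_rfl)
  have hi2 : Integrable (fun Z => resTrace S lam Finset.univ Z)
      (Measure.pi fun _ : Fin N => π) :=
    (hi.add (integrable_const δ)).congr (ae_of_all _ fun Z => sub_add_cancel _ _)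
  have e : ∫ Z, resTrace S lam Finset.univ Z ∂(Measure.pi fun _ : Fin N => π) - δ
      = ∫ Z, (resTrace S lam Finset.univ Z - δ) ∂(Measure.pi fun _ : Fin N => π) := by
    rw [integral_sub hi2 (integrable_const _)]; simp
  rw [e]
  exact abs_integral_le_integral_abs.trans hm.integral_le

/-- The mean energy of a fresh feature is close to any approximate difference quotient `D` of
`lam ↦ lam δ`. -/
lemma Concentrated.abs_integral_traceEnergy_sub_le (h : Concentrated π m S K) (hl : 0 < lam)
    (hN : 2 ≤ N) {g d s η δ' c D : ℝ} (hg : (n : ℝ) ≤ g * N) (hη : 0 < η)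
    (hδ : 0 ≤ δ) (hd : δ ≤ d) (hfix : FixedPoint N lam S δ)
    (hδ' : 0 ≤ δ') (hd' : δ' ≤ d) (hfix' : FixedPoint N (lam + η) S δ')
    (hs : 1 ≤ s) (hsN : (N : ℝ) = s ^ 2)
    (hD : |(lam + η) * δ' - lam * δ - η * D| ≤ c * η ^ 2) :
    |∫ p : (Fin N → Fin n → ℝ) × (Fin n → ℝ), 1 / (N : ℝ) * ((res lam Finset.univ p.1 *ᵥ p.2) ⬝ᵥ
        gram Finset.univ p.1 *ᵥ (res lam Finset.univ p.1 *ᵥ p.2))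
        ∂((Measure.pi fun _ : Fin N => π).prod π) - D|
      ≤ ((d + traceConst K lam g d) / lam + c) * η
        + ((lam + η) * (traceConst K (lam + η) g d / s) + lam * (traceConst K lam g d / s))
          / η := by
  have hl' : 0 < lam + η := by linarith
  have hs0 : 0 < s := by linarith
  have hexp := abs_integral_expansion_le (lam := lam) (h := η) (h.integrable_prod_res_quad (N := N) hl')
    (h.integrable_prod_res_quad hl) (h.integrable_prod_res_energy hl) fun p => by
      have hb := ridge_expansion_bound (gram_posSemidef Finset.univ p.1) hl hη.le p.2
      rw [← res, ← res] at hb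
      have e1 : ∀ x₁ x₀ x' : ℝ, (lam + η) * (1 / (N : ℝ) * x₁) - lam * (1 / (N : ℝ) * x₀)
          - η * (1 / (N : ℝ) * x') = 1 / (N : ℝ) * ((lam + η) * x₁ - lam * x₀ - η * x') :=
        fun _ _ _ => by ring
      have e2 : ∀ x₀ : ℝ, η ^ 2 * (1 / (N : ℝ) * x₀) / lam = 1 / (N : ℝ) * (η ^ 2 * x₀ / lam) :=
        fun _ => by ring
      rw [e1, e2, abs_mul, abs_of_nonneg (by positivity : (0 : ℝ) ≤ 1 / (N : ℝ))]
      gcongr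
  rw [h.integral_prod_res_quad hl, h.integral_prod_res_quad hl'] at hexp
  have k₁ := h.abs_integral_resTrace_sub_le hl' hN hg hδ' hd' hfix' hs0 hsN
  have k₀ := h.abs_integral_resTrace_sub_le hl hN hg hδ hd hfix hs0 hsN
  refine abs_sub_le_of_difference hη hl'.le hl.le (hexp.trans ?_) hD k₁ k₀
  have htc : 0 ≤ traceConst K lam g d / s := (abs_nonneg _).trans k₀
  have htc' : traceConst K lam g d / s ≤ traceConst K lam g d := by
    refine div_le_self ?_ hs
    have := mul_nonneg htc hs0.le
    rwa [div_mul_cancel₀ _ hs0.ne'] at this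
  have hle : ∫ Z, resTrace S lam Finset.univ Z ∂(Measure.pi fun _ : Fin N => π)
      ≤ d + traceConst K lam g d := by
    have := (abs_le.1 k₀).2
    linarith
  have e : (d + traceConst K lam g d) / lam * η ^ 2
      = η ^ 2 * (d + traceConst K lam g d) / lam := by ring
  rw [e]; gcongr

/-- Solutions of the fixed-point equation are bounded uniformly in the dimension. The mean of the
features may be unbounded, but it enters the trace only through one rank-one term. -/
lemma Concentrated.fixedPoint_le (h : Concentrated π m S K) (hl : 0 < lam) (hN : 2 ≤ N) {g : ℝ}
    (hg : (n : ℝ) ≤ g * N) (hδ : 0 ≤ δ) (hfix : FixedPoint N lam S δ) :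
    δ ≤ 2 * (K + 1) * g / lam + 1 := by
  have hS := h.posSemidef
  have hK := h.nonneg
  have hN2 : (2 : ℝ) ≤ N := by exact_mod_cast hN
  have hN' : (0 : ℝ) < N := by linarith
  set Q := resolvent lam δ S with hQ
  have hQp : Q.PosSemidef := resolvent_posSemidef hS hl hδ
  have hquad : ∀ v, v ⬝ᵥ Q *ᵥ v ≤ v ⬝ᵥ v / lam := ridge_quad_le (smul_psd hS hδ) hl
  have hm : m ⬝ᵥ Q *ᵥ m ≤ 1 + δ := by
    have he := ridge_energy (smul_psd hS hδ) hl m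
    rw [← resolvent_eq, ← hQ, Matrix.smul_mulVec, dotProduct_smul, smul_eq_mul] at he
    have h1 := h.mean_sq_le (Q *ᵥ m)
    have h2 := mul_nonneg hl.le (dot_self_nonneg (Q *ᵥ m))
    rw [dotProduct_comm (Q *ᵥ m) m] at h1
    have h0 := psd_nonneg hQp m
    have h3 : 1 / (1 + δ) * (m ⬝ᵥ Q *ᵥ m) ^ 2 ≤ m ⬝ᵥ Q *ᵥ m := by
      have : 1 / (1 + δ) * (m ⬝ᵥ Q *ᵥ m) ^ 2 ≤ 1 / (1 + δ) * ((Q *ᵥ m) ⬝ᵥ S *ᵥ (Q *ᵥ m)) := by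
        gcongr
      linarith
    by_contra hlt
    push Not at hlt
    rw [one_div, inv_mul_le_iff₀ (by positivity)] at h3
    nlinarith
  have htr : (S * Q).trace ≤ (K + 1) * n / lam + (1 + δ) := by
    have hp : ((K + 1) • (1 : Matrix (Fin n) (Fin n) ℝ) + Matrix.vecMulVec m m - S).PosSemidef := by
      refine psd_of_nonneg ?_ fun v => ?_
      · simp [h.transpose, Matrix.transpose_vecMulVec]
      · have := h.quad_le v
        rw [Matrix.sub_mulVec, Matrix.add_mulVec, Matrix.smul_mulVec, Matrix.one_mulVec,
          Matrix.vecMulVec_mulVec, dotProduct_sub, dotProduct_add, dotProduct_smul]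
        simp only [op_smul_eq_smul, dotProduct_smul, smul_eq_mul]
        rw [dotProduct_comm m v]
        nlinarith
    have h1 := trace_mul_nonneg hp hQp
    have h2 : Q.trace ≤ n / lam := by
      have hp2 : ((1 / lam) • (1 : Matrix (Fin n) (Fin n) ℝ) - Q).PosSemidef := by
        refine psd_of_nonneg (by simp [psd_transpose hQp]) fun v => ?_
        rw [Matrix.sub_mulVec, Matrix.smul_mulVec, Matrix.one_mulVec, dotProduct_sub,
          dotProduct_smul, smul_eq_mul]
        have := hquad v
        rw [div_eq_inv_mul] at this
        rw [one_div]; linarith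
      have := trace_mul_nonneg hp2 (Matrix.PosSemidef.one (n := Fin n) (R := ℝ))
      rw [mul_one, Matrix.trace_sub, Matrix.trace_smul, Matrix.trace_one, Fintype.card_fin,
        smul_eq_mul] at this
      rw [div_eq_inv_mul, ← one_div]; linarith
    rw [Matrix.sub_mul, Matrix.add_mul, Matrix.trace_sub, Matrix.trace_add, Matrix.smul_mul,
      one_mul, Matrix.trace_smul, smul_eq_mul, Matrix.trace_mul_comm (Matrix.vecMulVec m m),
      trace_mul_vecMulVec] at h1
    have h3 : (K + 1) * Q.trace ≤ (K + 1) * n / lam := by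
      rw [mul_div_assoc]; gcongr
    linarith
  have h1 : (N : ℝ) * δ ≤ (K + 1) * (g * N) / lam + (1 + δ) := by
    have e : (N : ℝ) * δ = (S * Q).trace := by
      conv_lhs => rw [hfix]
      rw [← hQ]; field_simp
    rw [e]; refine htr.trans ?_; gcongr
  have h2 : (N : ℝ) * δ ≤ N * ((K + 1) * g / lam + (1 + δ) / 2) := by
    have e : (N : ℝ) * ((K + 1) * g / lam + (1 + δ) / 2)
        = (K + 1) * (g * N) / lam + (1 + δ) * (N / 2) := by ring
    rw [e]
    nlinarith
  have h3 := le_of_mul_le_mul_left h2 hN'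
  have e : 2 * (K + 1) * g / lam = 2 * ((K + 1) * g / lam) := by ring
  rw [e]; linarith

end FiniteDifference

end LinearESN

namespace LinearESN

/-! ### The fixed-point equation in terms of eigenvalues -/

section Spectral

variable {n T : ℕ} {lam κ : ℝ}

/-- Diagonalisation of a matrix along an orthonormal basis of eigenvectors. -/
lemma exists_diagonalisation {M : Matrix (Fin T) (Fin T) ℝ} {μ : Fin T → ℝ}
    (v : OrthonormalBasis (Fin T) ℝ (Vec T)) (hv : ∀ t, M *ᵥ (v t) = μ t • ⇑(v t)) :
    ∃ V : Matrix (Fin T) (Fin T) ℝ, Vᵀ * V = 1 ∧ V * Vᵀ = 1 ∧ M = V * Matrix.diagonal μ * Vᵀ ∧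
      ∀ x t, (Vᵀ *ᵥ x) t = x ⬝ᵥ v t := by
  let V : Matrix (Fin T) (Fin T) ℝ := Matrix.of fun i t => v t i
  have h1 : Vᵀ * V = 1 := by
    ext s t
    have := orthonormal_iff_ite.1 v.orthonormal s t
    rw [Matrix.one_apply, ← this, PiLp.inner_apply]
    simp [Matrix.mul_apply, V, mul_comm]
  have h2 : V * Vᵀ = 1 := mul_eq_one_comm.1 h1
  refine ⟨V, h1, h2, ?_, fun x t => ?_⟩
  · have h3 : M * V = V * Matrix.diagonal μ := by
      ext i t
      have := congrFun (hv t) i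
      rw [Matrix.mul_diagonal]
      simpa [Matrix.mul_apply, Matrix.mulVec, dotProduct, V, mul_comm] using this
    rw [← h3, mul_assoc, h2, mul_one]
  · simp [Matrix.mulVec, dotProduct, V, mul_comm]

/-- Push-through identity. -/
lemma ridge_push_through (A : Matrix (Fin n) (Fin T) ℝ) (hκ : 0 < κ) :
    ridge κ (A * Aᵀ) * A = A * ridge κ (Aᵀ * A) := by
  have hS : (A * Aᵀ).PosSemidef := by
    simpa using Matrix.posSemidef_self_mul_conjTranspose A
  have hM : (Aᵀ * A).PosSemidef := by
    simpa using Matrix.posSemidef_conjTranspose_mul_self A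
  have h1 : (A * Aᵀ + κ • 1) * A = A * (Aᵀ * A + κ • 1) := by
    simp [Matrix.add_mul, Matrix.mul_add, Matrix.mul_assoc]
  calc ridge κ (A * Aᵀ) * A
      = ridge κ (A * Aᵀ) * (A * ((Aᵀ * A + κ • 1) * ridge κ (Aᵀ * A))) := by
        rw [reg_mul_ridge hM hκ, Matrix.mul_one]
    _ = ridge κ (A * Aᵀ) * (A * Aᵀ + κ • 1) * A * ridge κ (Aᵀ * A) := by
        rw [← Matrix.mul_assoc A, ← h1]; simp only [Matrix.mul_assoc]
    _ = A * ridge κ (Aᵀ * A) := by rw [ridge_mul_reg hS hκ, Matrix.one_mul]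

lemma ridge_diagonalisation {M V : Matrix (Fin T) (Fin T) ℝ} {μ : Fin T → ℝ}
    (h1 : Vᵀ * V = 1) (h2 : V * Vᵀ = 1) (hM : M = V * Matrix.diagonal μ * Vᵀ)
    (hμ : ∀ t, 0 ≤ μ t) (hκ : 0 < κ) :
    ridge κ M = V * Matrix.diagonal (fun t => 1 / (μ t + κ)) * Vᵀ := by
  refine Matrix.inv_eq_right_inv ?_
  have e : M + κ • 1 = V * Matrix.diagonal (fun t => μ t + κ) * Vᵀ := by
    have : Matrix.diagonal (fun t => μ t + κ) = Matrix.diagonal μ + κ • (1 : Matrix _ _ ℝ) := by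
      rw [Matrix.smul_one_eq_diagonal, Matrix.diagonal_add]
    rw [this, Matrix.mul_add, Matrix.add_mul, ← hM]
    simp [h2]
  calc (M + κ • 1) * (V * Matrix.diagonal (fun t => 1 / (μ t + κ)) * Vᵀ)
      = V * (Matrix.diagonal (fun t => μ t + κ) * (Vᵀ * V)
          * Matrix.diagonal (fun t => 1 / (μ t + κ))) * Vᵀ := by
        rw [e]; simp only [Matrix.mul_assoc]
    _ = 1 := by
        rw [h1, mul_one, Matrix.diagonal_mul_diagonal]
        have : (fun t => (μ t + κ) * (1 / (μ t + κ))) = fun _ => (1 : ℝ) := by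
          funext t
          have := hμ t
          field_simp
        rw [this, Matrix.diagonal_one, mul_one, h2]

/-- `N⁻¹ ∑ μ / (μ + κ)`. -/
noncomputable def specMean (N : ℕ) (μ : Fin T → ℝ) (κ : ℝ) : ℝ :=
  1 / (N : ℝ) * ∑ t, μ t / (μ t + κ)

/-- `N⁻¹ ∑ μ² / ((μ + κ) (μ + κ'))`. -/
noncomputable def specMix (N : ℕ) (μ : Fin T → ℝ) (κ κ' : ℝ) : ℝ :=
  1 / (N : ℝ) * ∑ t, μ t ^ 2 / ((μ t + κ) * (μ t + κ'))

section Factor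

variable {A : Matrix (Fin n) (Fin T) ℝ} {μ : Fin T → ℝ} {v : OrthonormalBasis (Fin T) ℝ (Vec T)}

lemma eigenvalue_nonneg (hv : ∀ t, (Aᵀ * A) *ᵥ (v t) = μ t • ⇑(v t)) (t : Fin T) : 0 ≤ μ t := by
  have h1 := psd_nonneg (by simpa using Matrix.posSemidef_conjTranspose_mul_self A :
    (Aᵀ * A).PosSemidef) (v t)
  have h2 := orthonormal_iff_ite.1 v.orthonormal t t
  rw [if_pos rfl, PiLp.inner_apply] at h2
  have h3 : ⇑(v t) ⬝ᵥ ⇑(v t) = 1 := by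
    rw [← h2]; simp [dotProduct, pow_two]
  rw [hv, dotProduct_smul, h3] at h1
  simpa using h1

lemma resolvent_eq_smul_ridge (S : Matrix (Fin n) (Fin n) ℝ) {δ : ℝ} (hδ : 0 ≤ δ) :
    resolvent lam δ S = (1 + δ) • ridge (lam * (1 + δ)) S := by
  have h1 : (1 + δ) ≠ 0 := by positivity
  have e : (1 / (1 + δ)) • S + lam • (1 : Matrix (Fin n) (Fin n) ℝ)
      = (1 / (1 + δ)) • (S + (lam * (1 + δ)) • (1 : Matrix (Fin n) (Fin n) ℝ)) := by
    rw [smul_add, smul_smul]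
    congr 2
    field_simp
  rw [resolvent, e, ridge]
  have hu : (1 / (1 + δ)) • (S + (lam * (1 + δ)) • (1 : Matrix (Fin n) (Fin n) ℝ))
      = (Units.mk0 (1 / (1 + δ)) (by positivity)) •
        (S + (lam * (1 + δ)) • (1 : Matrix (Fin n) (Fin n) ℝ)) := rfl
  by_cases hdet : IsUnit (S + (lam * (1 + δ)) • (1 : Matrix (Fin n) (Fin n) ℝ)).det
  · rw [hu, Matrix.inv_smul' _ _ hdet]
    ext i j
    simp [Units.smul_def]
  · have hdet' : ¬ IsUnit ((1 / (1 + δ)) •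
        (S + (lam * (1 + δ)) • (1 : Matrix (Fin n) (Fin n) ℝ))).det := by
      rw [Matrix.det_smul]
      simp only [isUnit_iff_ne_zero, not_not] at hdet ⊢
      rw [hdet, mul_zero]
    rw [Matrix.nonsing_inv_apply_not_isUnit _ hdet, Matrix.nonsing_inv_apply_not_isUnit _ hdet',
      smul_zero]

lemma trace_mul_ridge_eq (hv : ∀ t, (Aᵀ * A) *ᵥ (v t) = μ t • ⇑(v t)) (hκ : 0 < κ) :
    (A * Aᵀ * ridge κ (A * Aᵀ)).trace = ∑ t, μ t / (μ t + κ) := by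
  obtain ⟨V, h1, h2, hM, -⟩ := exists_diagonalisation v hv
  have hμ := eigenvalue_nonneg hv
  have hR := ridge_diagonalisation h1 h2 hM hμ hκ
  calc (A * Aᵀ * ridge κ (A * Aᵀ)).trace
      = (Aᵀ * A * ridge κ (Aᵀ * A)).trace := by
        rw [Matrix.mul_assoc, Matrix.trace_mul_comm, Matrix.mul_assoc, ridge_push_through A hκ,
          Matrix.mul_assoc]
    _ = (V * (Matrix.diagonal μ * (Vᵀ * V) * Matrix.diagonal fun t => 1 / (μ t + κ)) * Vᵀ).trace := by
        rw [hR]; conv_lhs => rw [hM]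
        simp only [Matrix.mul_assoc]
    _ = ∑ t, μ t / (μ t + κ) := by
        rw [Matrix.trace_mul_comm, ← Matrix.mul_assoc, h1, one_mul, mul_one,
          Matrix.diagonal_mul_diagonal, Matrix.trace_diagonal]
        simp [div_eq_mul_inv]

lemma sum_sq_mul_ridge_eq (hv : ∀ t, (Aᵀ * A) *ᵥ (v t) = μ t • ⇑(v t)) (hκ : 0 < κ) :
    ∑ i, ∑ j, (A * Aᵀ * ridge κ (A * Aᵀ)) i j ^ 2 = ∑ t, μ t ^ 2 / (μ t + κ) ^ 2 := by
  obtain ⟨V, h1, h2, hM, -⟩ := exists_diagonalisation v hv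
  have hμ := eigenvalue_nonneg hv
  have hR := ridge_diagonalisation h1 h2 hM hμ hκ
  have hS : (A * Aᵀ).PosSemidef := by
    simpa using Matrix.posSemidef_self_mul_conjTranspose A
  have hMp : (Aᵀ * A).PosSemidef := by
    simpa using Matrix.posSemidef_conjTranspose_mul_self A
  have hP : A * Aᵀ * ridge κ (A * Aᵀ) = A * ridge κ (Aᵀ * A) * Aᵀ := by
    rw [mul_ridge hS hκ, ← ridge_mul hS hκ, ← Matrix.mul_assoc, ridge_push_through A hκ]
  have hPT : (A * ridge κ (Aᵀ * A) * Aᵀ)ᵀ = A * ridge κ (Aᵀ * A) * Aᵀ := by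
    simp [Matrix.transpose_mul, ridge_transpose hMp hκ, Matrix.mul_assoc]
  set D := Matrix.diagonal μ with hD
  set E := Matrix.diagonal fun t => 1 / (μ t + κ) with hE
  calc ∑ i, ∑ j, (A * Aᵀ * ridge κ (A * Aᵀ)) i j ^ 2
      = ((A * ridge κ (Aᵀ * A) * Aᵀ) * (A * ridge κ (Aᵀ * A) * Aᵀ)ᵀ).trace := by
        rw [hP]
        generalize A * ridge κ (Aᵀ * A) * Aᵀ = P
        simp only [Matrix.trace, Matrix.diag_apply, Matrix.mul_apply, Matrix.transpose_apply, pow_two]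
    _ = (Aᵀ * A * ridge κ (Aᵀ * A) * (Aᵀ * A) * ridge κ (Aᵀ * A)).trace := by
        rw [hPT, Matrix.mul_assoc, Matrix.mul_assoc, Matrix.trace_mul_comm]
        simp only [Matrix.mul_assoc]
        rw [Matrix.trace_mul_comm]
        simp only [Matrix.mul_assoc]
    _ = (V * (D * (Vᵀ * V) * E * (Vᵀ * V) * D * (Vᵀ * V) * E) * Vᵀ).trace := by
        rw [hR]; conv_lhs => rw [hM]
        simp only [Matrix.mul_assoc]
    _ = ∑ t, μ t ^ 2 / (μ t + κ) ^ 2 := by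
        rw [Matrix.trace_mul_comm, ← Matrix.mul_assoc, h1, one_mul]
        simp only [mul_one]
        rw [hD, hE]
        simp only [Matrix.diagonal_mul_diagonal, Matrix.trace_diagonal]
        refine Finset.sum_congr rfl fun t _ => ?_
        have := hμ t
        field_simp

/-- `κ wᵀ (A Aᵀ + κ)⁻¹ w`, with the part of `w` in the kernel of `Aᵀ` split off. -/
lemma ridge_quad_eq (hv : ∀ t, (Aᵀ * A) *ᵥ (v t) = μ t • ⇑(v t)) (hκ : 0 < κ) (w : Fin n → ℝ) :
    κ * (w ⬝ᵥ ridge κ (A * Aᵀ) *ᵥ w)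
      = w ⬝ᵥ w - ∑ t, ((Aᵀ *ᵥ w) ⬝ᵥ v t) ^ 2 / (μ t + κ) := by
  obtain ⟨V, h1, h2, hM, hx⟩ := exists_diagonalisation v hv
  have hμ := eigenvalue_nonneg hv
  have hR := ridge_diagonalisation h1 h2 hM hμ hκ
  have hS : (A * Aᵀ).PosSemidef := by
    simpa using Matrix.posSemidef_self_mul_conjTranspose A
  have hP : κ • ridge κ (A * Aᵀ) = 1 - A * ridge κ (Aᵀ * A) * Aᵀ := by
    rw [← ridge_push_through A hκ, Matrix.mul_assoc, ridge_mul hS hκ, sub_sub_cancel]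
  have h3 : κ * (w ⬝ᵥ ridge κ (A * Aᵀ) *ᵥ w) = w ⬝ᵥ (κ • ridge κ (A * Aᵀ)) *ᵥ w := by
    rw [Matrix.smul_mulVec, dotProduct_smul, smul_eq_mul]
  rw [h3, hP, Matrix.sub_mulVec, Matrix.one_mulVec, dotProduct_sub, hR]
  congr 1
  simp only [← hx]
  set y := Vᵀ *ᵥ (Aᵀ *ᵥ w) with hy
  have h4 : w ⬝ᵥ (A * (V * Matrix.diagonal (fun t => 1 / (μ t + κ)) * Vᵀ) * Aᵀ) *ᵥ w
      = y ⬝ᵥ Matrix.diagonal (fun t => 1 / (μ t + κ)) *ᵥ y := by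
    rw [hy]
    simp only [← Matrix.mulVec_mulVec]
    rw [Matrix.dotProduct_mulVec w A, Matrix.dotProduct_mulVec _ V, ← Matrix.mulVec_transpose,
      ← Matrix.mulVec_transpose]
  rw [h4]
  simp only [dotProduct, Matrix.mulVec_diagonal]
  refine Finset.sum_congr rfl fun t _ => ?_
  ring

lemma fixedPoint_iff (hv : ∀ t, (Aᵀ * A) *ᵥ (v t) = μ t • ⇑(v t)) (hl : 0 < lam) {N : ℕ} {δ : ℝ}
    (hδ : 0 ≤ δ) :
    FixedPoint N lam (A * Aᵀ) δ ↔ δ = (1 + δ) * specMean N μ (lam * (1 + δ)) := by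
  have hκ : 0 < lam * (1 + δ) := by positivity
  rw [FixedPoint, resolvent_eq_smul_ridge _ hδ, Matrix.mul_smul, Matrix.trace_smul,
    trace_mul_ridge_eq hv hκ, smul_eq_mul, specMean]
  rw [show 1 / (N : ℝ) * ((1 + δ) * ∑ t, μ t / (μ t + lam * (1 + δ)))
    = (1 + δ) * (1 / (N : ℝ) * ∑ t, μ t / (μ t + lam * (1 + δ))) by ring]

lemma alpha_eq (hv : ∀ t, (Aᵀ * A) *ᵥ (v t) = μ t • ⇑(v t)) (hl : 0 < lam) (N : ℕ) {δ : ℝ}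
    (hδ : 0 ≤ δ) :
    alpha N lam (A * Aᵀ) δ = specMix N μ (lam * (1 + δ)) (lam * (1 + δ)) := by
  have hκ : 0 < lam * (1 + δ) := by positivity
  have e : ((1 / (1 + δ)) • (A * Aᵀ)) * resolvent lam δ (A * Aᵀ)
      = A * Aᵀ * ridge (lam * (1 + δ)) (A * Aᵀ) := by
    rw [resolvent_eq_smul_ridge _ hδ, Matrix.smul_mul, Matrix.mul_smul, smul_smul,
      one_div_mul_cancel (by positivity), one_smul]
  rw [alpha, e, sum_sq_mul_ridge_eq hv hκ, specMix]
  simp only [pow_two]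

lemma resolvent_quad_eq (hv : ∀ t, (Aᵀ * A) *ᵥ (v t) = μ t • ⇑(v t)) (hl : 0 < lam) {δ : ℝ}
    (hδ : 0 ≤ δ) (w : Fin n → ℝ) :
    lam * (w ⬝ᵥ resolvent lam δ (A * Aᵀ) *ᵥ w)
      = w ⬝ᵥ w - ∑ t, ((Aᵀ *ᵥ w) ⬝ᵥ v t) ^ 2 / (μ t + lam * (1 + δ)) := by
  rw [resolvent_eq_smul_ridge _ hδ, Matrix.smul_mulVec, dotProduct_smul, smul_eq_mul, ← mul_assoc,
    ridge_quad_eq hv (by positivity) w]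

end Factor

end Spectral

/-! ### Existence, uniqueness and smoothness of the fixed point -/

section Scalar

variable {T N : ℕ} {μ : Fin T → ℝ} {lam κ κ' δ δ' : ℝ}

lemma specMean_nonneg (hμ : ∀ t, 0 ≤ μ t) (hκ : 0 < κ) : 0 ≤ specMean N μ κ :=
  mul_nonneg (by positivity) (Finset.sum_nonneg fun t _ => div_nonneg (hμ t) (by linarith [hμ t]))

lemma specMix_le_specMean (hμ : ∀ t, 0 ≤ μ t) (hκ : 0 < κ) (hκ' : 0 < κ') :
    specMix N μ κ κ' ≤ specMean N μ κ := by
  refine mul_le_mul_of_nonneg_left (Finset.sum_le_sum fun t _ => ?_) (by positivity)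
  have h0 := hμ t
  rw [div_le_div_iff₀ (by positivity) (by positivity)]
  have : 0 ≤ μ t * (μ t + κ) * κ' := by positivity
  nlinarith

lemma mul_specMean_sub (hμ : ∀ t, 0 ≤ μ t) (hκ : 0 < κ) (hκ' : 0 < κ') :
    κ' * specMean N μ κ' - κ * specMean N μ κ = (κ' - κ) * specMix N μ κ κ' := by
  have e : ∀ t, κ' * (μ t / (μ t + κ')) - κ * (μ t / (μ t + κ))
      = (κ' - κ) * (μ t ^ 2 / ((μ t + κ) * (μ t + κ'))) := by
    intro t
    have h0 := hμ t
    field_simp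
    ring
  unfold specMean specMix
  rw [mul_left_comm, mul_left_comm κ, mul_left_comm (κ' - κ), ← mul_sub, Finset.mul_sum,
    Finset.mul_sum, Finset.mul_sum, ← Finset.sum_sub_distrib]
  simp only [e]

/-- The effective regularisation `κ = lam (1 + δ)` at a fixed point. -/
lemma kappa_eq (hfix : δ = (1 + δ) * specMean N μ (lam * (1 + δ))) :
    lam * (1 + δ) = lam + lam * (1 + δ) * specMean N μ (lam * (1 + δ)) := by
  rw [mul_assoc lam (1 + δ), ← hfix]; ring

lemma inv_le_one_sub_specMix (hμ : ∀ t, 0 ≤ μ t) (hl : 0 < lam) (hδ : 0 ≤ δ)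
    (hfix : δ = (1 + δ) * specMean N μ (lam * (1 + δ))) (hκ' : 0 < κ') :
    1 / (1 + δ) ≤ 1 - specMix N μ (lam * (1 + δ)) κ' := by
  have h1 := specMix_le_specMean (N := N) hμ (by positivity : 0 < lam * (1 + δ)) hκ'
  have h2 : specMean N μ (lam * (1 + δ)) = 1 - 1 / (1 + δ) := by
    set F := specMean N μ (lam * (1 + δ))
    field_simp
    linarith
  linarith

lemma kappa_sub_mul (hμ : ∀ t, 0 ≤ μ t) (hl : 0 < lam) {lam' : ℝ} (hl' : 0 < lam') (hδ : 0 ≤ δ)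
    (hfix : δ = (1 + δ) * specMean N μ (lam * (1 + δ))) (hδ' : 0 ≤ δ')
    (hfix' : δ' = (1 + δ') * specMean N μ (lam' * (1 + δ'))) :
    (lam' * (1 + δ') - lam * (1 + δ))
      * (1 - specMix N μ (lam * (1 + δ)) (lam' * (1 + δ'))) = lam' - lam := by
  have h1 := mul_specMean_sub (N := N) hμ (by positivity : 0 < lam * (1 + δ))
    (by positivity : 0 < lam' * (1 + δ'))
  have h2 := kappa_eq hfix
  have h3 := kappa_eq hfix'
  linarith

lemma specFixedPoint_unique (hμ : ∀ t, 0 ≤ μ t) (hl : 0 < lam) (hδ : 0 ≤ δ)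
    (hfix : δ = (1 + δ) * specMean N μ (lam * (1 + δ))) (hδ' : 0 ≤ δ')
    (hfix' : δ' = (1 + δ') * specMean N μ (lam * (1 + δ'))) : δ' = δ := by
  have h1 := kappa_sub_mul hμ hl hl hδ hfix hδ' hfix'
  have h2 := inv_le_one_sub_specMix hμ hl hδ hfix (by positivity : 0 < lam * (1 + δ'))
  have h3 : 0 < 1 / (1 + δ) := by positivity
  rw [sub_self, mul_eq_zero] at h1
  rcases h1 with h1 | h1
  · have : lam * (δ' - δ) = 0 := by linarith
    rcases mul_eq_zero.1 this with h | h <;> linarith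
  · linarith

lemma exists_specFixedPoint (hμ : ∀ t, 0 ≤ μ t) (hl : 0 < lam) (N : ℕ) :
    ∃ δ, 0 ≤ δ ∧ δ = (1 + δ) * specMean N μ (lam * (1 + δ)) := by
  set b : ℝ := 1 / (N : ℝ) * ∑ t, μ t / lam with hb
  have hb0 : 0 ≤ b := mul_nonneg (by positivity)
    (Finset.sum_nonneg fun t _ => div_nonneg (hμ t) hl.le)
  have hle : ∀ x, 0 ≤ x → (1 + x) * specMean N μ (lam * (1 + x)) ≤ b := by
    intro x hx
    rw [specMean, mul_left_comm, Finset.mul_sum, hb]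
    gcongr with t
    have h0 := hμ t
    rw [← mul_div_assoc, div_le_div_iff₀ (by positivity) hl]
    nlinarith [mul_nonneg h0 h0]
  have hc : ContinuousOn (fun x => x - (1 + x) * specMean N μ (lam * (1 + x))) (Set.Icc 0 b) := by
    unfold specMean
    refine continuousOn_id.sub ((continuousOn_const.add continuousOn_id).mul
      (continuousOn_const.mul (continuousOn_finsetSum _ fun t _ => continuousOn_const.div
        (continuousOn_const.add (continuousOn_const.mul
          (continuousOn_const.add continuousOn_id))) fun x hx => ?_)))
    have h0 := hμ t
    have h1 : 0 < lam * (1 + x) := mul_pos hl (by linarith [hx.1])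
    exact (by linarith : (0 : ℝ) < μ t + lam * (1 + x)).ne'
  have h0 : (0 : ℝ) ∈ Set.Icc ((fun x => x - (1 + x) * specMean N μ (lam * (1 + x))) 0)
      ((fun x => x - (1 + x) * specMean N μ (lam * (1 + x))) b) := by
    constructor
    · have := specMean_nonneg (N := N) hμ (by positivity : 0 < lam * (1 + 0))
      simp only; linarith
    · have := hle b hb0
      simp only; linarith
  obtain ⟨x, hx, hx0⟩ := intermediate_value_Icc hb0 hc h0
  exact ⟨x, hx.1, by simp only at hx0; linarith⟩

lemma eq_zero_of_specFixedPoint_zero {n N T : ℕ} {A : Matrix (Fin n) (Fin T) ℝ} {μ : Fin T → ℝ}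
    {v : OrthonormalBasis (Fin T) ℝ (Vec T)} {lam : ℝ}
    (hv : ∀ t, (Aᵀ * A) *ᵥ (v t) = μ t • ⇑(v t)) (hl : 0 < lam) (hN : 0 < N)
    (h : 0 = (1 + 0) * specMean N μ (lam * (1 + 0))) : A * Aᵀ = 0 := by
  have hμ := eigenvalue_nonneg hv
  obtain ⟨V, -, -, hM, -⟩ := exists_diagonalisation v hv
  have hN' : (0 : ℝ) < N := by exact_mod_cast hN
  have h1 : ∑ t, μ t / (μ t + lam) = 0 := by
    rw [add_zero, one_mul, mul_one, specMean] at h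
    exact (mul_eq_zero.1 h.symm).resolve_left (by positivity)
  have h2 : μ = fun _ => 0 := by
    funext t
    have h3 := (Finset.sum_eq_zero_iff_of_nonneg fun t _ =>
      div_nonneg (hμ t) (by linarith [hμ t] : 0 ≤ μ t + lam)).1 h1 t (Finset.mem_univ t)
    exact (div_eq_zero_iff.1 h3).resolve_right (by linarith [hμ t])
  have h4 : Aᵀ * A = 0 := by rw [hM, h2]; simp
  have h5 : A = 0 := Matrix.conjTranspose_mul_self_eq_zero.1 (by simpa using h4)
  simp [h5]

/-- Sensitivity of the effective regularisation: `dκ/dlam = 1 / (1 - α)`. -/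
lemma abs_kappa_sub_le (hμ : ∀ t, 0 ≤ μ t) (hl : 0 < lam) {h : ℝ} (hh : 0 < h) (hδ : 0 ≤ δ)
    (hfix : δ = (1 + δ) * specMean N μ (lam * (1 + δ))) (hδ' : 0 ≤ δ')
    (hfix' : δ' = (1 + δ') * specMean N μ ((lam + h) * (1 + δ'))) :
    0 ≤ (lam + h) * (1 + δ') - lam * (1 + δ) ∧
    (lam + h) * (1 + δ') - lam * (1 + δ) ≤ h * (1 + δ) ∧
    |(lam + h) * (1 + δ') - lam * (1 + δ)
        - h * (1 / (1 - specMix N μ (lam * (1 + δ)) (lam * (1 + δ))))|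
      ≤ (1 + δ) ^ 2 / lam * h ^ 2 := by
  have hl' : 0 < lam + h := by linarith
  have hκp : 0 < lam * (1 + δ) := by positivity
  have hκp' : 0 < (lam + h) * (1 + δ') := by positivity
  have h1 := kappa_sub_mul hμ hl hl' hδ hfix hδ' hfix'
  have a1 := inv_le_one_sub_specMix hμ hl hδ hfix hκp'
  have a0 := inv_le_one_sub_specMix hμ hl hδ hfix hκp
  rw [add_sub_cancel_left] at h1
  set κ := lam * (1 + δ) with hκ
  set κ' := (lam + h) * (1 + δ') with hκ'
  set x := specMix N μ κ κ' with hx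
  set y := specMix N μ κ κ with hy
  have hpos : 0 < 1 / (1 + δ) := by positivity
  have hx1 : 0 < 1 - x := by linarith
  have hy1 : 0 < 1 - y := by linarith
  have hd0 : 0 ≤ κ' - κ := by
    by_contra hneg
    push Not at hneg
    nlinarith
  have hd1 : κ' - κ ≤ h * (1 + δ) := by
    have : (κ' - κ) * (1 / (1 + δ)) ≤ (κ' - κ) * (1 - x) := by gcongr
    rw [h1, mul_one_div, div_le_iff₀ (by positivity)] at this
    exact this
  refine ⟨hd0, hd1, ?_⟩
  have hxy : x ≤ y := by
    refine mul_le_mul_of_nonneg_left (Finset.sum_le_sum fun t _ => ?_) (by positivity)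
    have := hμ t
    refine div_le_div_of_nonneg_left (by positivity) (by positivity) ?_
    gcongr
    linarith
  have hyx : y - x ≤ h / lam := by
    have e : y - x ≤ (κ' - κ) / κ * specMean N μ κ := by
      rw [hx, hy]; unfold specMix specMean
      rw [← mul_sub, ← Finset.sum_sub_distrib, mul_left_comm ((κ' - κ) / κ),
        Finset.mul_sum _ _ ((κ' - κ) / κ)]
      refine mul_le_mul_of_nonneg_left (Finset.sum_le_sum fun t _ => ?_)
        (by positivity : (0 : ℝ) ≤ 1 / (N : ℝ))
      have h0 := hμ t
      have e : μ t ^ 2 / ((μ t + κ) * (μ t + κ)) - μ t ^ 2 / ((μ t + κ) * (μ t + κ'))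
          = (κ' - κ) * (μ t / (μ t + κ)) * (μ t / ((μ t + κ) * (μ t + κ'))) := by
        field_simp; ring
      rw [e, div_mul_eq_mul_div, div_eq_mul_inv _ κ]
      have h2 : μ t / ((μ t + κ) * (μ t + κ')) ≤ κ⁻¹ := by
        rw [div_le_iff₀ (by positivity), inv_mul_eq_div, le_div_iff₀ hκp]
        nlinarith [mul_nonneg h0 h0, mul_nonneg h0 hκp'.le, mul_nonneg hκp.le hκp'.le]
      gcongr
    have hF : specMean N μ κ ≤ 1 := by
      have h2 : (1 + δ) * specMean N μ κ ≤ (1 + δ) * 1 := by rw [← hfix]; linarith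
      exact le_of_mul_le_mul_left h2 (by positivity)
    have h3 : (κ' - κ) / κ ≤ h / lam := by
      rw [div_le_div_iff₀ hκp hl, hκ]
      calc (κ' - κ) * lam ≤ h * (1 + δ) * lam := by gcongr
        _ = _ := by ring
    calc y - x ≤ (κ' - κ) / κ * specMean N μ κ := e
      _ ≤ (κ' - κ) / κ * 1 := by gcongr
      _ ≤ h / lam := by rw [mul_one]; exact h3
  have e : κ' - κ - h * (1 / (1 - y)) = -((κ' - κ) * ((y - x) / (1 - y))) := by
    field_simp
    linear_combination h1
  rw [e, abs_neg, abs_of_nonneg (mul_nonneg hd0 (div_nonneg (by linarith) hy1.le))]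
  have h4 : (y - x) / (1 - y) ≤ (h / lam) / (1 / (1 + δ)) := by gcongr
  calc (κ' - κ) * ((y - x) / (1 - y)) ≤ (h * (1 + δ)) * ((h / lam) / (1 / (1 + δ))) := by
        gcongr
    _ = _ := by field_simp

/-- The derivative of `lam ↦ lam δ` is `α / (1 - α)`. -/
lemma abs_trace_difference_le (hμ : ∀ t, 0 ≤ μ t) (hl : 0 < lam) {h : ℝ} (hh : 0 < h) (hδ : 0 ≤ δ)
    (hfix : δ = (1 + δ) * specMean N μ (lam * (1 + δ))) (hδ' : 0 ≤ δ')
    (hfix' : δ' = (1 + δ') * specMean N μ ((lam + h) * (1 + δ'))) :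
    |(lam + h) * δ' - lam * δ
        - h * (specMix N μ (lam * (1 + δ)) (lam * (1 + δ))
          / (1 - specMix N μ (lam * (1 + δ)) (lam * (1 + δ))))|
      ≤ (1 + δ) ^ 2 / lam * h ^ 2 := by
  have h1 := (abs_kappa_sub_le hμ hl hh hδ hfix hδ' hfix').2.2
  have a0 := inv_le_one_sub_specMix hμ hl hδ hfix (by positivity : 0 < lam * (1 + δ))
  have hpos : 0 < 1 / (1 + δ) := by positivity
  set y := specMix N μ (lam * (1 + δ)) (lam * (1 + δ))
  have hy : 1 - y ≠ 0 := by linarith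
  convert h1 using 2
  field_simp
  ring

/-- The derivative of `-∑ a² / (μ + κ)` in `lam`. -/
lemma abs_quad_difference_le (hμ : ∀ t, 0 ≤ μ t) (hl : 0 < lam) {h B : ℝ} (hh : 0 < h) (hδ : 0 ≤ δ)
    (hfix : δ = (1 + δ) * specMean N μ (lam * (1 + δ))) (hδ' : 0 ≤ δ')
    (hfix' : δ' = (1 + δ') * specMean N μ ((lam + h) * (1 + δ'))) (a : Fin T → ℝ)
    (ha : ∑ t, a t ^ 2 / (μ t + lam * (1 + δ)) ≤ B) :
    |∑ t, a t ^ 2 / (μ t + lam * (1 + δ)) - ∑ t, a t ^ 2 / (μ t + (lam + h) * (1 + δ'))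
        - h * ((∑ t, a t ^ 2 / (μ t + lam * (1 + δ)) ^ 2)
          / (1 - specMix N μ (lam * (1 + δ)) (lam * (1 + δ))))|
      ≤ 2 * (B / lam) * ((1 + δ) ^ 2 / lam) * h ^ 2 := by
  obtain ⟨h1, h2, h3⟩ := abs_kappa_sub_le hμ hl hh hδ hfix hδ' hfix'
  have hκp : 0 < lam * (1 + δ) := by positivity
  have hκp' : 0 < (lam + h) * (1 + δ') := by positivity
  have hκl : lam ≤ lam * (1 + δ) := by nlinarith
  set y := specMix N μ (lam * (1 + δ)) (lam * (1 + δ))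
  set κ := lam * (1 + δ) with hκ
  set κ' := (lam + h) * (1 + δ') with hκ'
  set E := ∑ t, a t ^ 2 / (μ t + κ) ^ 2 with hE
  have hE0 : 0 ≤ E := Finset.sum_nonneg fun t _ => by positivity
  have hEB : E ≤ B / κ := by
    refine le_trans ?_ (div_le_div_of_nonneg_right ha hκp.le)
    rw [hE, Finset.sum_div]
    refine Finset.sum_le_sum fun t _ => ?_
    have := hμ t
    rw [div_div]
    refine div_le_div_of_nonneg_left (sq_nonneg _) (by positivity) ?_
    nlinarith
  have hB0 : 0 ≤ B := le_trans (Finset.sum_nonneg fun t _ => by have := hμ t; positivity) ha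
  have hdiff : |∑ t, a t ^ 2 / (μ t + κ) - ∑ t, a t ^ 2 / (μ t + κ') - (κ' - κ) * E|
      ≤ (κ' - κ) ^ 2 * (E / κ) := by
    rw [hE, Finset.mul_sum, ← Finset.sum_sub_distrib, ← Finset.sum_sub_distrib, Finset.sum_div,
      Finset.mul_sum]
    refine (Finset.abs_sum_le_sum_abs _ _).trans (Finset.sum_le_sum fun t _ => ?_)
    have h0 := hμ t
    have e : a t ^ 2 / (μ t + κ) - a t ^ 2 / (μ t + κ') - (κ' - κ) * (a t ^ 2 / (μ t + κ) ^ 2)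
        = -((κ' - κ) ^ 2 * (a t ^ 2 / (μ t + κ) ^ 2 / (μ t + κ'))) := by
      field_simp; ring
    rw [e, abs_neg, abs_of_nonneg (by positivity)]
    gcongr
    linarith
  have e : ∑ t, a t ^ 2 / (μ t + κ) - ∑ t, a t ^ 2 / (μ t + κ') - h * (E / (1 - y))
      = (∑ t, a t ^ 2 / (μ t + κ) - ∑ t, a t ^ 2 / (μ t + κ') - (κ' - κ) * E)
        + E * (κ' - κ - h * (1 / (1 - y))) := by ring
  rw [e]
  refine (abs_add_le _ _).trans ?_
  rw [abs_mul, abs_of_nonneg hE0]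
  have hEl : E ≤ B / lam := hEB.trans (by gcongr)
  have k1 : (κ' - κ) ^ 2 * (E / κ) ≤ (h * (1 + δ)) ^ 2 * (B / lam / lam) := by
    gcongr
  have k2 : E * |κ' - κ - h * (1 / (1 - y))| ≤ B / lam * ((1 + δ) ^ 2 / lam * h ^ 2) := by
    gcongr
  calc _ ≤ (h * (1 + δ)) ^ 2 * (B / lam / lam) + B / lam * ((1 + δ) ^ 2 / lam * h ^ 2) :=
        add_le_add (hdiff.trans k1) k2
    _ = _ := by ring

end Scalar

end LinearESN

namespace LinearESN

/-! ### Moments from exponential concentration -/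

section FromTails

/-- Four times the integral of the tail bound against `t³`: a bound for fourth central moments. -/
noncomputable def tailConst (q C s : ℝ) : ℝ :=
  4 * ∫ t in Set.Ioi (0 : ℝ), C * Real.exp (-(t / s) ^ q) * t ^ (3 : ℝ)

lemma integrableOn_tail {q s : ℝ} (C : ℝ) (hq : 0 < q) (hs : 0 < s) :
    IntegrableOn (fun t : ℝ => C * Real.exp (-(t / s) ^ q) * t ^ (3 : ℝ)) (Set.Ioi 0) := by
  have h := (integrableOn_rpow_mul_exp_neg_mul_rpow (p := q) (s := 3) (b := (s ^ q)⁻¹)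
    (by norm_num) hq (by positivity)).const_mul C
  refine (IntegrableOn.congr_fun h (fun t ht => ?_) measurableSet_Ioi)
  have ht0 : (0 : ℝ) < t := ht
  rw [Real.div_rpow ht0.le hs.le]
  have : -(t ^ q / s ^ q) = -(s ^ q)⁻¹ * t ^ q := by ring
  rw [this]; ring

lemma tailConst_nonneg {q C s : ℝ} (hC : 0 ≤ C) : 0 ≤ tailConst q C s := by
  refine mul_nonneg (by norm_num) (setIntegral_nonneg measurableSet_Ioi fun t ht => ?_)
  have ht0 : (0 : ℝ) < t := ht
  positivity

variable {Ω : Type*} [MeasurableSpace Ω] {P : Measure Ω} [IsProbabilityMeasure P] {n : ℕ}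
  {X : Ω → Vec n} {q C s : ℝ}

lemma ExpConcentrated.meanLE_of_lipschitz_one (h : ExpConcentrated P X q C s) (hX : Measurable X)
    (hq : 0 < q) (hC : 0 ≤ C) (hs : 0 < s) {f : Vec n → ℝ} (hf : LipschitzWith 1 f) :
    MeanLE P (fun ω => (f (X ω) - ∫ ω', f (X ω') ∂P) ^ 4) (tailConst q C s) := by
  set a := ∫ ω', f (X ω') ∂P with ha
  have hm : Measurable fun ω => f (X ω) - a := (hf.continuous.measurable.comp hX).sub_const a
  have e4 : ∀ x : ℝ, x ^ 4 = |x| ^ (4 : ℝ) := fun x => by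
    rw [show (4 : ℝ) = (4 : ℕ) by norm_num, Real.rpow_natCast, Even.pow_abs (by decide)]
  have hp : ∀ ω, 0 ≤ (f (X ω) - a) ^ 4 := fun ω => by positivity
  refine ⟨hm.pow_const 4, hp, tailConst_nonneg hC, ?_⟩
  simp only [e4]
  rw [lintegral_rpow_eq_lintegral_meas_le_mul P (ae_of_all _ fun ω => abs_nonneg _)
    hm.abs.aemeasurable (by norm_num), tailConst, ENNReal.ofReal_mul (by norm_num),
    ofReal_integral_eq_lintegral_ofReal (integrableOn_tail C hq hs)]
  · refine mul_le_mul_right (setLIntegral_mono' measurableSet_Ioi fun t ht => ?_) _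
    have ht0 : (0 : ℝ) < t := ht
    rw [ENNReal.ofReal_mul (by positivity), show (4 : ℝ) - 1 = 3 by norm_num]
    gcongr
    rw [← ofReal_measureReal]
    exact ENNReal.ofReal_le_ofReal (h f hf t ht0)
  · refine (ae_restrict_iff' measurableSet_Ioi).2 (ae_of_all _ fun t ht => ?_)
    have ht0 : (0 : ℝ) < t := ht
    simp only [Pi.zero_apply]
    positivity

lemma ExpConcentrated.meanLE_of_lipschitz (h : ExpConcentrated P X q C s) (hX : Measurable X)
    (hq : 0 < q) (hC : 0 ≤ C) (hs : 0 < s) {f : Vec n → ℝ} {a : NNReal} (ha : 0 < a)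
    (hf : LipschitzWith a f) :
    MeanLE P (fun ω => (f (X ω) - ∫ ω', f (X ω') ∂P) ^ 4) ((a : ℝ) ^ 4 * tailConst q C s) := by
  have ha' : (0 : ℝ) < a := ha
  have hg : LipschitzWith 1 fun z => (a : ℝ)⁻¹ * f z := by
    refine LipschitzWith.of_dist_le_mul fun x y => ?_
    have := hf.dist_le_mul x y
    rw [Real.dist_eq] at this ⊢
    rw [← mul_sub, abs_mul, abs_of_pos (inv_pos.2 ha'), inv_mul_le_iff₀ ha']
    simpa using this
  have := (h.meanLE_of_lipschitz_one hX hq hC hs hg).const_mul (a := (a : ℝ) ^ 4) (by positivity)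
  convert this using 2 with ω
  rw [integral_const_mul]
  field_simp

lemma ExpConcentrated.memLp (h : ExpConcentrated P X q C s) (hX : Measurable X)
    (hq : 0 < q) (hC : 0 ≤ C) (hs : 0 < s) {f : Vec n → ℝ} {a : NNReal} (ha : 0 < a)
    (hf : LipschitzWith a f) : MemLp (fun ω => f (X ω)) 4 P := by
  have hm : Measurable fun ω => f (X ω) := hf.continuous.measurable.comp hX
  have h1 : MemLp (fun ω => f (X ω) - ∫ ω', f (X ω') ∂P) 4 P := by
    have h4 : ((4 : ENNReal)).toReal = (4 : ℕ) := by norm_num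
    rw [← integrable_norm_rpow_iff (hm.sub_const _).aestronglyMeasurable (by norm_num)
      (by norm_num), h4]
    simp only [Real.rpow_natCast, Real.norm_eq_abs]
    refine (h.meanLE_of_lipschitz hX hq hC hs ha hf).integrable.congr (ae_of_all _ fun z => ?_)
    simp only
    rw [Even.pow_abs (by decide)]
  have := h1.add (memLp_const (∫ ω', f (X ω') ∂P))
  refine (memLp_congr_ae (ae_of_all _ fun ω => ?_)).1 this
  simp

lemma lipschitzWith_mulVec_norm {p : ℕ} (G : Matrix (Fin p) (Fin n) ℝ) {a : ℝ} (ha : 0 ≤ a)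
    (hG : ∀ v, (G *ᵥ v) ⬝ᵥ (G *ᵥ v) ≤ a * (v ⬝ᵥ v)) :
    LipschitzWith (Real.sqrt a).toNNReal
      fun z : Vec n => ‖(WithLp.toLp 2 (G *ᵥ z.ofLp) : Vec p)‖ := by
  have hsq : ∀ {d : ℕ} (x : Vec d), ‖x‖ ^ 2 = x.ofLp ⬝ᵥ x.ofLp := fun x => by
    rw [EuclideanSpace.real_norm_sq_eq]; simp [dotProduct, pow_two]
  refine LipschitzWith.of_dist_le_mul fun x y => ?_
  rw [Real.dist_eq, Real.coe_toNNReal _ (Real.sqrt_nonneg a), dist_eq_norm]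
  refine (abs_norm_sub_norm_le _ _).trans ?_
  rw [← WithLp.toLp_sub, ← Matrix.mulVec_sub]
  refine abs_le_of_sq_le_sq' ?_ (by positivity) |>.2
  rw [mul_pow, Real.sq_sqrt ha, hsq, hsq]
  exact hG _

lemma lipschitzWith_dot (w : Fin n → ℝ) :
    LipschitzWith (Real.sqrt (w ⬝ᵥ w)).toNNReal fun z : Vec n => w ⬝ᵥ z.ofLp := by
  have hsq : ∀ {d : ℕ} (x : Vec d), ‖x‖ ^ 2 = x.ofLp ⬝ᵥ x.ofLp := fun x => by
    rw [EuclideanSpace.real_norm_sq_eq]; simp [dotProduct, pow_two]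
  refine LipschitzWith.of_dist_le_mul fun x y => ?_
  rw [Real.dist_eq, Real.coe_toNNReal _ (Real.sqrt_nonneg _), dist_eq_norm, ← dotProduct_sub]
  refine abs_le_of_sq_le_sq ?_ (by positivity)
  rw [mul_pow, Real.sq_sqrt (dot_self_nonneg w), hsq]
  exact dot_cauchy_schwarz w _

/-- The law on `Fin n → ℝ` of a random vector. -/
noncomputable def law (P : Measure Ω) (X : Ω → Vec n) : Measure (Fin n → ℝ) :=
  P.map fun ω => (X ω).ofLp

lemma measurable_ofLp (hX : Measurable X) : Measurable fun ω => (X ω).ofLp :=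
  (PiLp.continuous_ofLp 2 _).measurable.comp hX

lemma isProbabilityMeasure_law (hX : Measurable X) : IsProbabilityMeasure (law P X) :=
  Measure.isProbabilityMeasure_map (measurable_ofLp hX).aemeasurable

lemma integral_law (hX : Measurable X) {f : (Fin n → ℝ) → ℝ} (hf : Measurable f) :
    ∫ z, f z ∂(law P X) = ∫ ω, f (X ω).ofLp ∂P :=
  integral_map (measurable_ofLp hX).aemeasurable hf.aestronglyMeasurable

/-- Exponential concentration gives the moment bounds of `Concentrated`. The mean of the features
plays no role in the constant. -/
lemma ExpConcentrated.concentrated (h : ExpConcentrated P X q C s) (hX : Measurable X)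
    (hq : 0 < q) (hC : 0 ≤ C) (hs : 0 < s) :
    Concentrated (law P X) (fun i => ∫ z, z i ∂(law P X)) (secondMoment P X)
      (8 * (tailConst q C s + 1)) := by
  have hK := tailConst_nonneg (q := q) (s := s) hC
  have hsingle : ∀ i : Fin n, Real.sqrt ((Pi.single i 1 : Fin n → ℝ) ⬝ᵥ Pi.single i 1) = 1 := by
    intro i; simp
  have hL4 : ∀ i, MemLp (fun ω => X ω i) 4 P := fun i => by
    have := h.memLp hX hq hC hs (by rw [hsingle]; simp) (lipschitzWith_dot (Pi.single i 1))
    simpa using this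
  have hcm : ∀ i, Measurable fun z : Fin n → ℝ => z i := fun i => measurable_pi_apply i
  have hi1 : ∀ i, Integrable (fun ω => X ω i) P := fun i => (hL4 i).integrable (by norm_num)
  have hi2 : ∀ i j, Integrable (fun ω => X ω i * X ω j) P := fun i j => by
    have h2 : ∀ k, MemLp (fun ω => X ω k) 2 P := fun k => (hL4 k).mono_exponent (by norm_num)
    exact (h2 i).integrable_mul (h2 j)
  constructor
  · intro i
    refine (integrable_map_measure ((hcm i).pow_const 4).aestronglyMeasurable
      (measurable_ofLp hX).aemeasurable).2 ?_
    have h4 : ((4 : ENNReal)).toReal = (4 : ℕ) := by norm_num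
    have := (hL4 i).integrable_norm_rpow (by norm_num) (by norm_num)
    simp only [h4, Real.rpow_natCast, Real.norm_eq_abs] at this
    refine this.congr (ae_of_all _ fun ω => ?_)
    simp only [Function.comp]
    rw [Even.pow_abs (by decide)]
  · intro i; rfl
  · intro i j
    exact integral_law hX ((hcm i).mul (hcm j))
  · positivity
  · intro w
    by_cases hw : w ⬝ᵥ w = 0
    · have : w = 0 := dotProduct_self_eq_zero.1 hw
      simp [this]
    have hw' : 0 < w ⬝ᵥ w := lt_of_le_of_ne (dot_self_nonneg w) (Ne.symm hw)
    have hmean : ∫ ω, w ⬝ᵥ (X ω).ofLp ∂P = w ⬝ᵥ fun i => ∫ z, z i ∂(law P X) := by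
      simp only [dotProduct]
      rw [integral_finsetSum _ fun i _ => (hi1 i).const_mul _]
      simp only [integral_const_mul]
      refine Finset.sum_congr rfl fun i _ => ?_
      rw [integral_law hX (hcm i)]
    have hb := (h.meanLE_of_lipschitz hX hq hC hs (by simpa using hw')
      (lipschitzWith_dot w)).integral_le
    rw [Real.coe_toNNReal _ (Real.sqrt_nonneg _), hmean,
      show √(w ⬝ᵥ w) ^ 4 = (√(w ⬝ᵥ w) ^ 2) ^ 2 by ring, Real.sq_sqrt hw'.le] at hb
    rw [integral_law hX (by simp only [dotProduct]; fun_prop)]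
    simp only [dotProduct_sub] at hb ⊢
    refine hb.trans ?_
    nlinarith [sq_nonneg (w ⬝ᵥ w), mul_nonneg (sq_nonneg (w ⬝ᵥ w)) hK]
  · intro p G a ha hG
    set τ := (secondMoment P X * (Gᵀ * G)).trace with hτ
    have hquad : ∀ z : Fin n → ℝ, (G *ᵥ z) ⬝ᵥ (G *ᵥ z) = ∑ i, ∑ j, (Gᵀ * G) j i * (z i * z j) := by
      intro z
      rw [Matrix.dotProduct_mulVec, ← Matrix.mulVec_transpose, Matrix.mulVec_mulVec]
      simp only [dotProduct, Matrix.mulVec, Finset.sum_mul]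
      rw [Finset.sum_comm]
      exact Finset.sum_congr rfl fun i _ => Finset.sum_congr rfl fun j _ => by ring
    have hτ2 : ∫ ω, (G *ᵥ (X ω).ofLp) ⬝ᵥ (G *ᵥ (X ω).ofLp) ∂P = τ := by
      simp only [hquad]
      rw [integral_finsetSum _ fun i _ => integrable_finsetSum _ fun j _ =>
        (hi2 i j).const_mul _, hτ, Matrix.trace]
      refine Finset.sum_congr rfl fun i _ => ?_
      rw [integral_finsetSum _ fun j _ => (hi2 i j).const_mul _, Matrix.diag_apply,
        Matrix.mul_apply]
      refine Finset.sum_congr rfl fun j _ => ?_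
      rw [integral_const_mul, secondMoment, Matrix.of_apply, mul_comm]
    rw [integral_law hX (by simp only [hquad]; fun_prop)]
    by_cases ha0 : a = 0
    · have hz : ∀ v, (G *ᵥ v) ⬝ᵥ (G *ᵥ v) = 0 := fun v =>
        le_antisymm (by simpa [ha0] using hG v) (dot_self_nonneg _)
      have : τ = 0 := by rw [← hτ2]; simp [hz]
      simp [hz, this, ha0]
    have hap : 0 < a := lt_of_le_of_ne ha (Ne.symm ha0)
    have hLip := lipschitzWith_mulVec_norm G ha hG
    set f : Vec n → ℝ := fun z => ‖(WithLp.toLp 2 (G *ᵥ z.ofLp) : Vec p)‖ with hf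
    have hapos : 0 < (Real.sqrt a).toNNReal := by simpa using hap
    have hfsq : ∀ z, f z ^ 2 = (G *ᵥ z.ofLp) ⬝ᵥ (G *ᵥ z.ofLp) := fun z => by
      rw [hf]; simp only; rw [EuclideanSpace.real_norm_sq_eq]; simp [dotProduct, pow_two]
    have hm4 := h.meanLE_of_lipschitz hX hq hC hs hapos hLip
    have hmL := h.memLp hX hq hC hs hapos hLip
    rw [Real.coe_toNNReal _ (Real.sqrt_nonneg _), show √a ^ 4 = (√a ^ 2) ^ 2 by ring,
      Real.sq_sqrt ha] at hm4
    simp only [← hfsq] at hτ2 ⊢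
    set Y : Ω → ℝ := fun ω => f (X ω) with hY
    set b := ∫ ω, Y ω ∂P with hb
    set k := tailConst q C s with hk
    have hYm : Measurable Y := hLip.continuous.measurable.comp hX
    have hY2 : MemLp Y 2 P := hmL.mono_exponent (by norm_num)
    have hY1 : Integrable Y P := hmL.integrable (by norm_num)
    have hYsq : Integrable (fun ω => Y ω ^ 2) P := hY2.integrable_sq
    have hint4 : Integrable (fun ω => (Y ω - b) ^ 4) P := hm4.integrable
    have hbτ : b ^ 2 ≤ τ := by
      have h0 : 0 ≤ ∫ ω, (Y ω - b) ^ 2 ∂P := integral_nonneg fun ω => sq_nonneg _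
      have e : ∫ ω, (Y ω - b) ^ 2 ∂P = τ - b ^ 2 := by
        have : ∀ ω, (Y ω - b) ^ 2 = (Y ω ^ 2 - 2 * b * Y ω) + b ^ 2 := fun ω => by ring
        simp only [this]
        have hs1 : Integrable (fun ω => Y ω ^ 2 - 2 * b * Y ω) P := hYsq.sub (hY1.const_mul _)
        rw [integral_add hs1 (integrable_const _), integral_sub hYsq (hY1.const_mul _),
          integral_const_mul, integral_const, probReal_univ, one_smul, ← hb, hτ2]
        ring
      linarith
    have hpt : ∀ ω, (Y ω ^ 2 - b ^ 2) ^ 2 ≤ (2 + 8 * b ^ 2 / a) * (Y ω - b) ^ 4 + 8 * b ^ 2 * a := by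
      intro ω
      set x := Y ω - b with hx
      have e : Y ω ^ 2 - b ^ 2 = x * (x + 2 * b) := by rw [hx]; ring
      have h1 : (x + 2 * b) ^ 2 ≤ 2 * x ^ 2 + 8 * b ^ 2 := by nlinarith [sq_nonneg (x - 2 * b)]
      have h2 : x ^ 2 ≤ x ^ 4 / a + a := by
        have : x ^ 2 * a ≤ x ^ 4 + a * a := by nlinarith [sq_nonneg (x ^ 2 - a)]
        rw [← sub_nonneg] at this ⊢
        have e : x ^ 4 / a + a - x ^ 2 = (x ^ 4 + a * a - x ^ 2 * a) / a := by field_simp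
        rw [e]; positivity
      rw [e, mul_pow]
      calc x ^ 2 * (x + 2 * b) ^ 2 ≤ x ^ 2 * (2 * x ^ 2 + 8 * b ^ 2) := by gcongr
        _ = 2 * x ^ 4 + 8 * b ^ 2 * x ^ 2 := by ring
        _ ≤ 2 * x ^ 4 + 8 * b ^ 2 * (x ^ 4 / a + a) := by gcongr
        _ = _ := by ring
    have hdom : Integrable (fun ω => (2 + 8 * b ^ 2 / a) * (Y ω - b) ^ 4 + 8 * b ^ 2 * a) P :=
      (hint4.const_mul _).add (integrable_const _)
    have hintS : Integrable (fun ω => (Y ω ^ 2 - b ^ 2) ^ 2) P :=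
      hdom.mono' (((hYm.pow_const 2).sub_const _).pow_const 2).aestronglyMeasurable
        (ae_of_all _ fun ω => by
          rw [Real.norm_eq_abs, abs_of_nonneg (sq_nonneg _)]; exact hpt ω)
    have h1 : ∫ ω, (Y ω ^ 2 - b ^ 2) ^ 2 ∂P ≤ (2 + 8 * b ^ 2 / a) * (a ^ 2 * k) + 8 * b ^ 2 * a := by
      refine (integral_mono hintS hdom hpt).trans ?_
      rw [integral_add (hint4.const_mul _) (integrable_const _), integral_const_mul, integral_const,
        probReal_univ, one_smul]
      gcongr
      exact hm4.integral_le
    -- the variance is the smallest second moment about a constant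
    have h2 : ∫ ω, (Y ω ^ 2 - τ) ^ 2 ∂P ≤ ∫ ω, (Y ω ^ 2 - b ^ 2) ^ 2 ∂P := by
      have e : ∀ ω, (Y ω ^ 2 - τ) ^ 2 = (Y ω ^ 2 - b ^ 2) ^ 2
          - (2 * (τ - b ^ 2) * Y ω ^ 2 - (τ ^ 2 - b ^ 4)) := fun ω => by ring
      have hs1 : Integrable (fun ω => 2 * (τ - b ^ 2) * Y ω ^ 2 - (τ ^ 2 - b ^ 4)) P :=
        (hYsq.const_mul _).sub (integrable_const _)
      simp only [e]
      rw [integral_sub hintS hs1, integral_sub (hYsq.const_mul _) (integrable_const _),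
        integral_const_mul, hτ2, integral_const, probReal_univ, one_smul]
      nlinarith [sq_nonneg (τ - b ^ 2)]
    refine (h2.trans h1).trans ?_
    have e : (2 + 8 * b ^ 2 / a) * (a ^ 2 * k) + 8 * b ^ 2 * a
        = 2 * k * a ^ 2 + 8 * (k + 1) * a * b ^ 2 := by
      field_simp; ring
    rw [e]
    have h3 : 8 * (k + 1) * a * b ^ 2 ≤ 8 * (k + 1) * a * τ := by gcongr
    have h4 : 2 * k * a ^ 2 ≤ 8 * (k + 1) * a ^ 2 := by gcongr <;> linarith
    linarith

end FromTails

end LinearESN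

namespace LinearESN

/-! ### Averaging over the noise -/

section Noise

/-- Random linear combinations of orthogonal random variables, with independent coefficients. -/
lemma integral_sum_mul_sq {Ω E ι : Type*} [MeasurableSpace Ω] [MeasurableSpace E] [Fintype ι]
    [DecidableEq ι] {ρ : Measure Ω} {η : Measure E} [SFinite ρ] [SFinite η]
    {f : ι → Ω → ℝ} {g : ι → E → ℝ} (hf : ∀ a, MemLp (f a) 2 ρ) (hg : ∀ a, MemLp (g a) 2 η)
    (horth : ∀ a b, a ≠ b → ∫ x, g a x * g b x ∂η = 0) :
    ∫ p : Ω × E, (∑ a, f a p.1 * g a p.2) ^ 2 ∂(ρ.prod η)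
      = ∑ a, (∫ ω, f a ω ^ 2 ∂ρ) * ∫ x, g a x ^ 2 ∂η := by
  have e : ∀ p : Ω × E, (∑ a, f a p.1 * g a p.2) ^ 2
      = ∑ a, ∑ b, (f a p.1 * f b p.1) * (g a p.2 * g b p.2) := by
    intro p
    rw [pow_two, Finset.sum_mul_sum]
    exact Finset.sum_congr rfl fun a _ => Finset.sum_congr rfl fun b _ => by ring
  have hi : ∀ a b, Integrable (fun p : Ω × E => (f a p.1 * f b p.1) * (g a p.2 * g b p.2))
      (ρ.prod η) := fun a b =>
    Integrable.mul_prod (f := fun ω => f a ω * f b ω) (g := fun x => g a x * g b x)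
      ((hf a).integrable_mul (hf b)) ((hg a).integrable_mul (hg b))
  simp only [e]
  rw [integral_finsetSum _ fun a _ => integrable_finsetSum _ fun b _ => hi a b]
  refine Finset.sum_congr rfl fun a _ => ?_
  rw [integral_finsetSum _ fun b _ => hi a b, Finset.sum_eq_single a]
  · rw [integral_prod_mul (fun ω => f a ω * f a ω) fun x => g a x * g a x]
    simp only [pow_two]
  · intro b _ hb
    rw [integral_prod_mul (fun ω => f a ω * f b ω) fun x => g a x * g b x, horth a b hb.symm,
      mul_zero]
  · simp

variable {N : ℕ} {ν : Measure ℝ} [IsProbabilityMeasure ν] {σ : ℝ}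

lemma memLp_noise (hν2 : MemLp id 2 ν) (j : Fin N) :
    MemLp (fun e : Fin N → ℝ => e j) 2 (Measure.pi fun _ : Fin N => ν) :=
  hν2.comp_measurePreserving (measurePreserving_eval (fun _ : Fin N => ν) j)

lemma integral_noise (hν0 : ∫ e, e ∂ν = 0) (j : Fin N) :
    ∫ e : Fin N → ℝ, e j ∂(Measure.pi fun _ : Fin N => ν) = 0 := by
  have := integral_comp_eval (μ := fun _ : Fin N => ν) (i := j) (f := fun x : ℝ => x)
    measurable_id.aestronglyMeasurable
  rw [this, hν0]

lemma integral_noise_mul (hν0 : ∫ e, e ∂ν = 0) {j k : Fin N} (hjk : j ≠ k) :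
    ∫ e : Fin N → ℝ, e j * e k ∂(Measure.pi fun _ : Fin N => ν) = 0 := by
  have e1 : ∀ e : Fin N → ℝ, e j * e k
      = ∏ i, (if i = j then e i else 1) * (if i = k then e i else 1) := by
    intro e
    rw [Finset.prod_mul_distrib, Finset.prod_ite_eq' Finset.univ j,
      Finset.prod_ite_eq' Finset.univ k]
    simp
  simp only [e1]
  rw [integral_fintype_prod_eq_prod
    (f := fun (i : Fin N) (x : ℝ) => (if i = j then x else 1) * (if i = k then x else 1))]
  refine Finset.prod_eq_zero (Finset.mem_univ j) ?_
  simp [hjk, hν0]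

lemma integral_noise_sq (hνσ : ∫ e, e ^ 2 ∂ν = σ ^ 2) (j : Fin N) :
    ∫ e : Fin N → ℝ, e j ^ 2 ∂(Measure.pi fun _ : Fin N => ν) = σ ^ 2 := by
  have := integral_comp_eval (μ := fun _ : Fin N => ν) (i := j) (f := fun x : ℝ => x ^ 2)
    (by fun_prop)
  rw [this, hνσ]

variable {Ω : Type*} [MeasurableSpace Ω] {ρ : Measure Ω} [IsProbabilityMeasure ρ]

lemma integral_noise_form_sq (hν2 : MemLp id 2 ν) (hν0 : ∫ e, e ∂ν = 0)
    (hνσ : ∫ e, e ^ 2 ∂ν = σ ^ 2) {c : Fin N → Ω → ℝ} (hc : ∀ j, MemLp (c j) 2 ρ) :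
    ∫ p : Ω × (Fin N → ℝ), (∑ j, c j p.1 * p.2 j) ^ 2 ∂(ρ.prod (Measure.pi fun _ : Fin N => ν))
      = σ ^ 2 * ∑ j, ∫ ω, c j ω ^ 2 ∂ρ := by
  refine (integral_sum_mul_sq (η := Measure.pi fun _ : Fin N => ν) hc (g := fun j e => e j)
    (fun j => memLp_noise hν2 j) fun a b hab => integral_noise_mul hν0 hab).trans ?_
  rw [Finset.mul_sum]
  refine Finset.sum_congr rfl fun j _ => ?_
  rw [integral_noise_sq hνσ, mul_comm]

/-- Squared error of a prediction with deterministic part `b`, training noise `∑ c_j e_j` and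
independent test noise. -/
lemma integral_error_sq (hν2 : MemLp id 2 ν) (hν0 : ∫ e, e ∂ν = 0)
    (hνσ : ∫ e, e ^ 2 ∂ν = σ ^ 2) {b : Ω → ℝ} (hb : MemLp b 2 ρ) {c : Fin N → Ω → ℝ}
    (hc : ∀ j, MemLp (c j) 2 ρ) :
    ∫ p : Ω × ((Fin N → ℝ) × ℝ), (b p.1 + (∑ j, c j p.1 * p.2.1 j) - p.2.2) ^ 2
        ∂(ρ.prod ((Measure.pi fun _ : Fin N => ν).prod ν))
      = (∫ ω, b ω ^ 2 ∂ρ) + σ ^ 2 * (∑ j, ∫ ω, c j ω ^ 2 ∂ρ) + σ ^ 2 := by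
  let f : Option (Option (Fin N)) → Ω → ℝ := fun a => match a with
    | none => b
    | some none => fun _ => -1
    | some (some j) => c j
  let g : Option (Option (Fin N)) → (Fin N → ℝ) × ℝ → ℝ := fun a => match a with
    | none => fun _ => 1
    | some none => fun x => x.2
    | some (some j) => fun x => x.1 j
  have hν0' := hν0
  have hsnd : ∫ x : (Fin N → ℝ) × ℝ, x.2 ∂((Measure.pi fun _ : Fin N => ν).prod ν) = 0 := by
    rw [integral_fun_snd (f := fun x : ℝ => x), hν0, smul_zero]
  have hfst : ∀ j, ∫ x : (Fin N → ℝ) × ℝ, x.1 j ∂((Measure.pi fun _ : Fin N => ν).prod ν) = 0 := by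
    intro j
    rw [integral_fun_fst (f := fun x : Fin N → ℝ => x j), integral_noise hν0, smul_zero]
  have hmix : ∀ j, ∫ x : (Fin N → ℝ) × ℝ, x.1 j * x.2 ∂((Measure.pi fun _ : Fin N => ν).prod ν)
      = 0 := by
    intro j
    rw [integral_prod_mul (fun x : Fin N → ℝ => x j) fun x : ℝ => x, hν0, mul_zero]
  have hmul : ∀ j k, j ≠ k → ∫ x : (Fin N → ℝ) × ℝ, x.1 j * x.1 k
      ∂((Measure.pi fun _ : Fin N => ν).prod ν) = 0 := by
    intro j k hjk
    rw [integral_fun_fst (f := fun x : Fin N → ℝ => x j * x k), integral_noise_mul hν0 hjk,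
      smul_zero]
  have key := integral_sum_mul_sq (ρ := ρ) (η := (Measure.pi fun _ : Fin N => ν).prod ν)
    (f := f) (g := g) ?_ ?_ ?_
  · have e : ∀ p : Ω × ((Fin N → ℝ) × ℝ), ∑ a, f a p.1 * g a p.2
        = b p.1 + (∑ j, c j p.1 * p.2.1 j) - p.2.2 := by
      intro p
      rw [Fintype.sum_option, Fintype.sum_option]
      simp only [f, g]
      ring
    simp only [e] at key
    rw [key, Fintype.sum_option, Fintype.sum_option]
    simp only [f, g]
    have h1 : ∫ x : (Fin N → ℝ) × ℝ, x.2 ^ 2 ∂((Measure.pi fun _ : Fin N => ν).prod ν) = σ ^ 2 := by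
      rw [integral_fun_snd (f := fun x : ℝ => x ^ 2), hνσ, probReal_univ, one_smul]
    have h2 : ∀ j, ∫ x : (Fin N → ℝ) × ℝ, x.1 j ^ 2 ∂((Measure.pi fun _ : Fin N => ν).prod ν)
        = σ ^ 2 := by
      intro j
      rw [integral_fun_fst (f := fun x : Fin N → ℝ => x j ^ 2), integral_noise_sq hνσ,
        probReal_univ, one_smul]
    simp only [h1, h2]
    rw [← Finset.sum_mul]
    simp
    ring
  · rintro (_ | _ | j)
    · exact hb
    · exact memLp_const _
    · exact hc j
  · rintro (_ | _ | j)
    · exact memLp_const _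
    · exact hν2.comp_snd _
    · exact (memLp_noise hν2 j).comp_fst _
  · rintro (_ | _ | j) (_ | _ | k) hab
    · exact absurd rfl hab
    · simpa [g] using hsnd
    · simpa [g] using hfst k
    · simpa [g] using hsnd
    · exact absurd rfl hab
    · simpa [g, mul_comm] using hmix k
    · simpa [g] using hfst j
    · simpa [g] using hmix j
    · exact hmul j k (by simpa using hab)

end Noise

/-! ### The model in terms of the features -/

section Model

/-- Regrouping of independent inputs and noises. -/
lemma measurePreserving_regroup {α β ι : Type*} [Fintype ι] [MeasurableSpace α] [MeasurableSpace β]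
    (μ : Measure α) (ν : Measure β) [IsProbabilityMeasure μ] [IsProbabilityMeasure ν] :
    MeasurePreserving
      (fun w : (ι → α × β) × (α × β) => (((fun i => (w.1 i).1), w.2.1), ((fun i => (w.1 i).2), w.2.2)))
      ((Measure.pi fun _ : ι => μ.prod ν).prod (μ.prod ν))
      (((Measure.pi fun _ : ι => μ).prod μ).prod ((Measure.pi fun _ : ι => ν).prod ν)) := by
  have h1 := (measurePreserving_arrowProdEquivProdArrow α β ι (fun _ => μ) fun _ => ν).prod
    (MeasurePreserving.id (μ.prod ν))
  set A := Measure.pi fun _ : ι => μ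
  set B := Measure.pi fun _ : ι => ν
  have h2 : MeasurePreserving (fun x : ((ι → α) × (ι → β)) × (α × β) =>
      (((x.1.1, x.2.1), (x.1.2, x.2.2)) : ((ι → α) × α) × ((ι → β) × β)))
      ((A.prod B).prod (μ.prod ν)) ((A.prod μ).prod (B.prod ν)) := by
    have k1 := measurePreserving_prodAssoc A B (μ.prod ν)
    have k2 := (MeasurePreserving.id A).prod ((measurePreserving_prodAssoc B μ ν).symm)
    have k3 := (MeasurePreserving.id A).prod
      ((Measure.measurePreserving_swap (μ := B) (ν := μ)).prod (MeasurePreserving.id ν))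
    have k4 := (MeasurePreserving.id A).prod (measurePreserving_prodAssoc μ B ν)
    have k5 := (measurePreserving_prodAssoc A μ (B.prod ν)).symm
    exact k5.comp (k4.comp (k3.comp (k2.comp k1)))
  exact h2.comp h1

variable {n N T : ℕ} {π : Measure (Fin n → ℝ)} [IsProbabilityMeasure π] {m : Fin n → ℝ}
  {S : Matrix (Fin n) (Fin n) ℝ} {K lam : ℝ}

lemma feature_ofLp (W : Matrix (Fin n) (Fin n) ℝ) (wIn : Fin n → ℝ) (u : Vec T) :
    (feature W wIn u).ofLp = responseMatrix T W wIn *ᵥ u.ofLp := by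
  ext i
  simp only [feature, responseMatrix, Matrix.mulVec, dotProduct, Matrix.of_apply, Finset.sum_apply,
    Pi.smul_apply, smul_eq_mul]
  refine Fintype.sum_equiv Fin.revPerm _ _ fun t => ?_
  simp [mul_comm]

lemma measurable_feature (W : Matrix (Fin n) (Fin n) ℝ) (wIn : Fin n → ℝ) :
    Measurable (feature (T := T) W wIn) := by
  have : Continuous (feature (T := T) W wIn) := by unfold feature; fun_prop
  exact this.measurable

/-- The noise enters the prediction through these coefficients. -/
noncomputable def noiseCoeff (lam : ℝ) (j : Fin N) (Z : Fin N → Fin n → ℝ) (z : Fin n → ℝ) : ℝ :=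
  1 / (N : ℝ) * (Z j ⬝ᵥ res lam Finset.univ Z *ᵥ z)

lemma readout_dot (hl : 0 < lam) (Z : Fin N → Vec n) (w z : Fin n → ℝ) (e : Fin N → ℝ) :
    readout lam Z (fun i => w ⬝ᵥ (Z i).ofLp + e i) ⬝ᵥ z
      = w ⬝ᵥ z - lam * (z ⬝ᵥ res lam Finset.univ (fun i => (Z i).ofLp) *ᵥ w)
        + ∑ j, noiseCoeff lam j (fun i => (Z i).ofLp) z * e j := by
  set Y : Fin N → Fin n → ℝ := fun i => (Z i).ofLp with hY
  have hG := gram_posSemidef Finset.univ Y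
  have e1 : (1 / (N : ℝ)) • ((Matrix.of fun i j => Z j i : Matrix (Fin n) (Fin N) ℝ)
      * (Matrix.of fun i j => Z j i : Matrix (Fin n) (Fin N) ℝ)ᵀ) = gram Finset.univ Y := by
    rw [gram]
    congr 1
    ext a b
    simp [Matrix.mul_apply, Matrix.sum_apply, Matrix.vecMulVec_apply, hY]
  have e2 : (1 / (N : ℝ)) • ((Matrix.of fun i j => Z j i : Matrix (Fin n) (Fin N) ℝ)
      *ᵥ fun i => w ⬝ᵥ (Z i).ofLp + e i)
      = gram Finset.univ Y *ᵥ w + (1 / (N : ℝ)) • ∑ j, e j • Y j := by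
    rw [gram, Matrix.smul_mulVec, ← smul_add, Matrix.sum_mulVec, ← Finset.sum_add_distrib]
    congr 1
    ext a
    simp only [Matrix.mulVec, dotProduct, Matrix.of_apply, Finset.sum_apply, Pi.add_apply,
      Pi.smul_apply, smul_eq_mul, Matrix.vecMulVec_apply]
    refine Finset.sum_congr rfl fun j _ => ?_
    rw [mul_add, Finset.mul_sum, mul_comm (Z j a) (e j)]
    congr 1
    exact Finset.sum_congr rfl fun b _ => by simp only [hY]; ring
  have hT := res_transpose hl Finset.univ Y
  unfold readout
  simp only [e1, e2]
  change (res lam Finset.univ Y *ᵥ _) ⬝ᵥ z = _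
  rw [Matrix.mulVec_add, add_dotProduct]
  congr 1
  · have : res lam Finset.univ Y *ᵥ (gram Finset.univ Y *ᵥ w)
        = w - lam • (res lam Finset.univ Y *ᵥ w) := by
      rw [Matrix.mulVec_mulVec, res, ridge_mul hG hl, Matrix.sub_mulVec, Matrix.one_mulVec,
        Matrix.smul_mulVec]
    rw [this, sub_dotProduct, smul_dotProduct, smul_eq_mul, dotProduct_comm w z,
      dotProduct_comm _ z]
  · rw [mulVec_dot hT, smul_dotProduct, sum_dotProduct, smul_eq_mul, Finset.mul_sum]
    refine Finset.sum_congr rfl fun j _ => ?_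
    rw [smul_dotProduct, noiseCoeff, smul_eq_mul]
    ring

lemma sum_noiseCoeff_sq (Z : Fin N → Fin n → ℝ) (z : Fin n → ℝ) :
    ∑ j, noiseCoeff lam j Z z ^ 2 = 1 / (N : ℝ) * ((res lam Finset.univ Z *ᵥ z) ⬝ᵥ
      gram Finset.univ Z *ᵥ (res lam Finset.univ Z *ᵥ z)) := by
  rw [gram_quad, Finset.mul_sum, Finset.mul_sum]
  refine Finset.sum_congr rfl fun j _ => ?_
  rw [noiseCoeff, dotProduct_comm _ (Z j)]
  ring

lemma Concentrated.memLp_noiseCoeff (h : Concentrated π m S K) (hl : 0 < lam) (j : Fin N) :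
    MemLp (fun p : (Fin N → Fin n → ℝ) × (Fin n → ℝ) => noiseCoeff lam j p.1 p.2) 2
      ((Measure.pi fun _ : Fin N => π).prod π) := by
  have hc : Continuous fun p : (Fin N → Fin n → ℝ) × (Fin n → ℝ) => noiseCoeff lam j p.1 p.2 :=
    continuous_const.mul (continuous_quad_comp ((continuous_apply j).comp continuous_fst)
      (continuous_res_comp hl _ continuous_fst) continuous_snd)
  rw [memLp_two_iff_integrable_sq hc.measurable.aestronglyMeasurable]
  refine (h.integrable_prod_res_energy (N := N) hl).mono'
    (hc.pow 2).measurable.aestronglyMeasurable (ae_of_all _ fun p => ?_)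
  rw [← sum_noiseCoeff_sq, Real.norm_eq_abs, abs_of_nonneg (sq_nonneg _)]
  exact Finset.single_le_sum (f := fun j => noiseCoeff lam j p.1 p.2 ^ 2)
    (fun i _ => sq_nonneg _) (Finset.mem_univ j)

lemma Concentrated.memLp_bias (h : Concentrated π m S K) (hl : 0 < lam) (w : Fin n → ℝ) :
    MemLp (fun p : (Fin N → Fin n → ℝ) × (Fin n → ℝ) =>
      p.2 ⬝ᵥ res lam Finset.univ p.1 *ᵥ w) 2 ((Measure.pi fun _ : Fin N => π).prod π) := by
  have hc : Continuous fun p : (Fin N → Fin n → ℝ) × (Fin n → ℝ) =>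
      p.2 ⬝ᵥ res lam Finset.univ p.1 *ᵥ w :=
    continuous_quad_comp continuous_snd (continuous_res_comp hl _ continuous_fst) continuous_const
  have hi : Integrable (fun z : Fin n → ℝ => z ⬝ᵥ z * (w ⬝ᵥ w / lam ^ 2)) π := by
    simpa using (h.integrable_quad 1).mul_const (w ⬝ᵥ w / lam ^ 2)
  rw [memLp_two_iff_integrable_sq hc.measurable.aestronglyMeasurable]
  refine (hi.comp_snd (Measure.pi fun _ : Fin N => π)).mono'
    (hc.pow 2).measurable.aestronglyMeasurable (ae_of_all _ fun p => ?_)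
  rw [Real.norm_eq_abs, abs_of_nonneg (sq_nonneg _)]
  refine (dot_cauchy_schwarz _ _).trans ?_
  have h1 := ridge_normSq_le' (gram_posSemidef Finset.univ p.1) hl w
  have h2 := dot_self_nonneg p.2
  exact mul_le_mul_of_nonneg_left h1 h2

variable {F : Vec T → Vec n} {P : Measure (Vec T)} [IsProbabilityMeasure P] {ν : Measure ℝ}
  [IsProbabilityMeasure ν] {σ : ℝ} {θ : Vec T} {w : Fin n → ℝ}

lemma measurePreserving_features (hF : Measurable F) :
    MeasurePreserving (fun p : (Fin N → Vec T) × Vec T =>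
        (((fun i => (F (p.1 i)).ofLp), (F p.2).ofLp) : (Fin N → Fin n → ℝ) × (Fin n → ℝ)))
      ((Measure.pi fun _ : Fin N => P).prod P)
      ((Measure.pi fun _ : Fin N => law P F).prod (law P F)) := by
  have := isProbabilityMeasure_law (P := P) hF
  have h1 : MeasurePreserving (fun u => (F u).ofLp) P (law P F) := ⟨measurable_ofLp hF, rfl⟩
  exact (measurePreserving_pi (fun _ : Fin N => P) (fun _ => law P F) fun _ => h1).prod h1

lemma prediction_eq (hl : 0 < lam) (hw : ∀ u : Vec T, θ ⬝ᵥ u = w ⬝ᵥ (F u).ofLp) (U : Fin N → Vec T)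
    (e : Fin N → ℝ) (u' : Vec T) :
    prediction F lam θ U e u' = θ ⬝ᵥ u'
      + -lam * ((F u').ofLp ⬝ᵥ res lam Finset.univ (fun i => (F (U i)).ofLp) *ᵥ w)
      + ∑ j, noiseCoeff lam j (fun i => (F (U i)).ofLp) (F u').ofLp * e j := by
  unfold prediction teacher
  simp only [hw]
  rw [readout_dot hl]
  ring

lemma meanPrediction_eq (hl : 0 < lam) (hw : ∀ u : Vec T, θ ⬝ᵥ u = w ⬝ᵥ (F u).ofLp)
    (hν2 : MemLp id 2 ν) (hν0 : ∫ e, e ∂ν = 0) (U : Fin N → Vec T) (u' : Vec T) :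
    meanPrediction F lam θ ν U u' = θ ⬝ᵥ u'
      + -lam * ((F u').ofLp ⬝ᵥ res lam Finset.univ (fun i => (F (U i)).ofLp) *ᵥ w) := by
  unfold meanPrediction
  simp only [prediction_eq hl hw]
  have hi : ∀ j : Fin N, Integrable (fun e : Fin N → ℝ =>
      noiseCoeff lam j (fun i => (F (U i)).ofLp) (F u').ofLp * e j)
      (Measure.pi fun _ : Fin N => ν) := fun j =>
    ((memLp_noise hν2 j).integrable (by norm_num)).const_mul _
  rw [integral_add (integrable_const _) (integrable_finsetSum _ fun j _ => hi j),
    integral_finsetSum _ fun j _ => hi j]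
  simp [integral_const_mul, integral_noise hν0]

lemma biasSq_eq (hF : Measurable F) (hl : 0 < lam) (hw : ∀ u : Vec T, θ ⬝ᵥ u = w ⬝ᵥ (F u).ofLp)
    (hν2 : MemLp id 2 ν) (hν0 : ∫ e, e ∂ν = 0) :
    biasSq N F lam θ P ν = lam ^ 2 * ∫ p : (Fin N → Fin n → ℝ) × (Fin n → ℝ),
      (p.2 ⬝ᵥ res lam Finset.univ p.1 *ᵥ w) ^ 2
        ∂((Measure.pi fun _ : Fin N => law P F).prod (law P F)) := by
  have hc : Continuous fun p : (Fin N → Fin n → ℝ) × (Fin n → ℝ) =>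
      (p.2 ⬝ᵥ res lam Finset.univ p.1 *ᵥ w) ^ 2 :=
    (continuous_quad_comp continuous_snd (continuous_res_comp hl _ continuous_fst)
      continuous_const).pow 2
  rw [← (measurePreserving_features (N := N) (P := P) hF).map_eq, integral_map
    (measurePreserving_features (N := N) (P := P) hF).measurable.aemeasurable
    hc.measurable.aestronglyMeasurable, ← integral_const_mul, biasSq]
  simp only [meanPrediction_eq hl hw hν2 hν0]
  congr 1
  ext p
  ring

lemma predVariance_eq (hF : Measurable F) (hl : 0 < lam) (hw : ∀ u : Vec T, θ ⬝ᵥ u = w ⬝ᵥ (F u).ofLp)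
    (h : Concentrated (law P F) m S K)
    (hν2 : MemLp id 2 ν) (hν0 : ∫ e, e ∂ν = 0) (hνσ : ∫ e, e ^ 2 ∂ν = σ ^ 2) :
    predVariance N F lam θ P ν = σ ^ 2 * ∫ p : (Fin N → Fin n → ℝ) × (Fin n → ℝ),
      1 / (N : ℝ) * ((res lam Finset.univ p.1 *ᵥ p.2) ⬝ᵥ
        gram Finset.univ p.1 *ᵥ (res lam Finset.univ p.1 *ᵥ p.2))
        ∂((Measure.pi fun _ : Fin N => law P F).prod (law P F)) := by
  have := isProbabilityMeasure_law (P := P) hF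
  have hmp := measurePreserving_features (N := N) (P := P) hF
  have hc := fun j : Fin N => (h.memLp_noiseCoeff (N := N) hl j)
  have hc' := fun j : Fin N => (hc j).comp_measurePreserving hmp
  have key := integral_noise_form_sq hν2 hν0 hνσ hc'
  unfold predVariance
  simp only [meanPrediction_eq hl hw hν2 hν0, prediction_eq hl hw, add_sub_cancel_left]
  simp only [Function.comp] at key
  rw [key]
  congr 1
  simp only [← sum_noiseCoeff_sq]
  rw [integral_finsetSum _ fun j _ => (hc j).integrable_sq]
  refine Finset.sum_congr rfl fun j _ => ?_
  rw [← hmp.map_eq, integral_map hmp.measurable.aemeasurable]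
  rw [hmp.map_eq]
  exact (hc j).integrable_sq.aestronglyMeasurable

/-- Decomposition of the risk. -/
lemma risk_eq (hF : Measurable F) (hl : 0 < lam) (hw : ∀ u : Vec T, θ ⬝ᵥ u = w ⬝ᵥ (F u).ofLp)
    (h : Concentrated (law P F) m S K)
    (hν2 : MemLp id 2 ν) (hν0 : ∫ e, e ∂ν = 0) (hνσ : ∫ e, e ^ 2 ∂ν = σ ^ 2) :
    risk N F lam θ P ν = biasSq N F lam θ P ν + predVariance N F lam θ P ν + σ ^ 2 := by
  have := isProbabilityMeasure_law (P := P) hF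
  have hmp := measurePreserving_features (N := N) (P := P) hF
  have hc' := fun j : Fin N => (h.memLp_noiseCoeff (N := N) hl j).comp_measurePreserving hmp
  have hb' := ((h.memLp_bias (N := N) hl w).const_mul (-lam)).comp_measurePreserving hmp
  have hv := integral_noise_form_sq hν2 hν0 hνσ hc'
  have hr := integral_error_sq hν2 hν0 hνσ hb' hc'
  rw [← hv] at hr
  have hmr := measurePreserving_regroup (ι := Fin N) P ν
  have hV : predVariance N F lam θ P ν = ∫ p : ((Fin N → Vec T) × Vec T) × (Fin N → ℝ),
      (∑ j, noiseCoeff lam j (fun i => (F (p.1.1 i)).ofLp) (F p.1.2).ofLp * p.2 j) ^ 2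
      ∂(((Measure.pi fun _ : Fin N => P).prod P).prod (Measure.pi fun _ : Fin N => ν)) := by
    unfold predVariance
    simp only [meanPrediction_eq hl hw hν2 hν0, prediction_eq hl hw, add_sub_cancel_left]
  have hB : biasSq N F lam θ P ν = ∫ p : (Fin N → Vec T) × Vec T,
      (-lam * ((F p.2).ofLp ⬝ᵥ res lam Finset.univ (fun i => (F (p.1 i)).ofLp) *ᵥ w)) ^ 2
      ∂((Measure.pi fun _ : Fin N => P).prod P) := by
    unfold biasSq
    simp only [meanPrediction_eq hl hw hν2 hν0, add_sub_cancel_left]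
  rw [hV, hB]
  refine Eq.trans ?_ hr
  rw [← hmr.map_eq, integral_map hmr.measurable.aemeasurable]
  · unfold risk
    refine integral_congr_ae (ae_of_all _ fun p => ?_)
    simp only [Function.comp, prediction_eq hl hw, teacher]
    ring
  · rw [hmr.map_eq]
    have hbm := hb'.aestronglyMeasurable
    refine ((hbm.comp_fst.add (Finset.aestronglyMeasurable_fun_sum _ fun j _ =>
      (hc' j).aestronglyMeasurable.comp_fst.mul ?_)).sub ?_).pow 2
    · exact ((measurable_pi_apply j).comp
        (measurable_fst.comp measurable_snd)).aestronglyMeasurable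
    · exact (measurable_snd.comp measurable_snd).aestronglyMeasurable

end Model

end LinearESN

namespace LinearESN

/-! ### Deterministic equivalents of bias and variance -/

section Equivalents

variable {n N T : ℕ} {π : Measure (Fin n → ℝ)} [IsProbabilityMeasure π] {m : Fin n → ℝ}
  {A : Matrix (Fin n) (Fin T) ℝ} {μ : Fin T → ℝ} {v : OrthonormalBasis (Fin T) ℝ (Vec T)}
  {K lam δ g : ℝ}

/-- A bound for the fixed point that does not depend on the dimension. -/
noncomputable def fixedPointBound (K lam g : ℝ) : ℝ := 2 * (K + 1) * g / lam + 1

lemma Concentrated.exists_fixedPoint_add (h : Concentrated π m (A * Aᵀ) K)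
    (hv : ∀ t, (Aᵀ * A) *ᵥ (v t) = μ t • ⇑(v t)) (hl : 0 < lam) (hN : 2 ≤ N)
    (hg : (n : ℝ) ≤ g * N) {η : ℝ} (hη : 0 < η) :
    ∃ δ', 0 ≤ δ' ∧ δ' ≤ fixedPointBound K lam g ∧ FixedPoint N (lam + η) (A * Aᵀ) δ' := by
  have hl' : 0 < lam + η := by linarith
  obtain ⟨δ', h0, h1⟩ := exists_specFixedPoint (eigenvalue_nonneg hv) hl' N
  have hfix := (fixedPoint_iff hv hl' h0).2 h1
  refine ⟨δ', h0, (h.fixedPoint_le hl' hN hg h0 hfix).trans ?_, hfix⟩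
  have hg0 := nonneg_of_le_mul hN hg
  have hK := h.nonneg
  rw [fixedPointBound]
  gcongr
  linarith

/-- The mean energy of a fresh feature approaches `α / (1 - α)`. -/
lemma Concentrated.abs_traceEnergy_sub_le (h : Concentrated π m (A * Aᵀ) K)
    (hv : ∀ t, (Aᵀ * A) *ᵥ (v t) = μ t • ⇑(v t)) (hl : 0 < lam) (hN : 2 ≤ N)
    (hg : (n : ℝ) ≤ g * N) (hδ : 0 ≤ δ) (hfix : FixedPoint N lam (A * Aᵀ) δ) {η s : ℝ} (hη : 0 < η)
    (hs : 1 ≤ s) (hsN : (N : ℝ) = s ^ 2) :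
    |∫ p : (Fin N → Fin n → ℝ) × (Fin n → ℝ), 1 / (N : ℝ) * ((res lam Finset.univ p.1 *ᵥ p.2) ⬝ᵥ
        gram Finset.univ p.1 *ᵥ (res lam Finset.univ p.1 *ᵥ p.2))
        ∂((Measure.pi fun _ : Fin N => π).prod π)
        - specMix N μ (lam * (1 + δ)) (lam * (1 + δ))
          / (1 - specMix N μ (lam * (1 + δ)) (lam * (1 + δ)))|
      ≤ ((fixedPointBound K lam g + traceConst K lam g (fixedPointBound K lam g)) / lam
          + (1 + fixedPointBound K lam g) ^ 2 / lam) * η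
        + ((lam + η) * traceConst K (lam + η) g (fixedPointBound K lam g)
          + lam * traceConst K lam g (fixedPointBound K lam g)) / η / s := by
  have hd := h.fixedPoint_le hl hN hg hδ hfix
  rw [← fixedPointBound] at hd
  obtain ⟨δ', hδ', hd', hfix'⟩ := h.exists_fixedPoint_add hv hl hN hg hη
  have hspec := (fixedPoint_iff hv hl hδ).1 hfix
  have hspec' := (fixedPoint_iff hv (by linarith) hδ').1 hfix'
  have hD := abs_trace_difference_le (eigenvalue_nonneg hv) hl hη hδ hspec hδ' hspec'
  have hD' := hD.trans (by gcongr : (1 + δ) ^ 2 / lam * η ^ 2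
    ≤ (1 + fixedPointBound K lam g) ^ 2 / lam * η ^ 2)
  refine (h.abs_integral_traceEnergy_sub_le hl hN hg hη hδ hd hfix hδ' hd' hfix' hs hsN hD').trans
    (le_of_eq ?_)
  ring

/-- The constant in front of the step `η` of the difference quotient in the approximation of the
bias. -/
noncomputable def biasSlope (K lam g B : ℝ) : ℝ :=
  lam ^ 2 * ((1 + fixedPointBound K lam g) ^ 2
    * (B / lam ^ 2 + 2 * (B / lam) * ((1 + fixedPointBound K lam g) ^ 2 / lam)))

/-- The constant in front of the vanishing term in the approximation of the bias, for a fixed step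
`η` of the difference quotient. -/
noncomputable def biasConst (K lam g B η : ℝ) : ℝ :=
  lam ^ 2 * (testConst K lam g (fixedPointBound K lam g) B
    + (1 + fixedPointBound K lam g) ^ 2
      * (((lam + η) * quadConst K (lam + η) g (fixedPointBound K lam g) B
        + lam * quadConst K lam g (fixedPointBound K lam g) B) / η))

/-- The bias approaches its deterministic equivalent. -/
lemma Concentrated.abs_bias_sub_le (h : Concentrated π m (A * Aᵀ) K)
    (hv : ∀ t, (Aᵀ * A) *ᵥ (v t) = μ t • ⇑(v t)) (hl : 0 < lam) (hN : 2 ≤ N)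
    (hg : (n : ℝ) ≤ g * N) (hδ : 0 ≤ δ) (hfix : FixedPoint N lam (A * Aᵀ) δ) {η t B : ℝ}
    (hη : 0 < η) (ht : 0 < t) (htN : (N : ℝ) = t ^ 4) {w : Fin n → ℝ} (hw : w ⬝ᵥ w ≤ B) :
    |lam ^ 2 * ∫ p : (Fin N → Fin n → ℝ) × (Fin n → ℝ), (p.2 ⬝ᵥ res lam Finset.univ p.1 *ᵥ w) ^ 2
        ∂((Measure.pi fun _ : Fin N => π).prod π)
        - (1 + δ) ^ 2 / (1 - specMix N μ (lam * (1 + δ)) (lam * (1 + δ)))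
          * ∑ i, lam ^ 2 / (μ i + lam * (1 + δ)) ^ 2 * ((Aᵀ *ᵥ w) ⬝ᵥ v i) ^ 2|
      ≤ biasSlope K lam g B * η + biasConst K lam g B η / t := by
  have hd := h.fixedPoint_le hl hN hg hδ hfix
  rw [← fixedPointBound] at hd
  set d := fixedPointBound K lam g with hdd
  have hl' : 0 < lam + η := by linarith
  obtain ⟨δ', hδ', hd', hfix'⟩ := h.exists_fixedPoint_add hv hl hN hg hη
  have hspec := (fixedPoint_iff hv hl hδ).1 hfix
  have hspec' := (fixedPoint_iff hv hl' hδ').1 hfix'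
  have hμ := eigenvalue_nonneg hv
  set a : Fin T → ℝ := fun i => (Aᵀ *ᵥ w) ⬝ᵥ v i with ha
  have q0 := resolvent_quad_eq hv hl hδ w
  have q1 := resolvent_quad_eq hv hl' hδ' w
  have hB0 : 0 ≤ B := (dot_self_nonneg w).trans hw
  have hsum : ∑ i, a i ^ 2 / (μ i + lam * (1 + δ)) ≤ B := by
    have := mul_nonneg hl.le (psd_nonneg (resolvent_posSemidef h.posSemidef hl hδ) w)
    rw [q0] at this
    linarith
  have hD := abs_quad_difference_le hμ hl hη hδ hspec hδ' hspec' a hsum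
  set y := specMix N μ (lam * (1 + δ)) (lam * (1 + δ)) with hy
  set D := (∑ i, a i ^ 2 / (μ i + lam * (1 + δ)) ^ 2) / (1 - y) with hDdef
  have hD' : |(lam + η) * (w ⬝ᵥ resolvent (lam + η) δ' (A * Aᵀ) *ᵥ w)
      - lam * (w ⬝ᵥ resolvent lam δ (A * Aᵀ) *ᵥ w) - η * D|
      ≤ 2 * (B / lam) * ((1 + d) ^ 2 / lam) * η ^ 2 := by
    rw [q0, q1, sub_sub_sub_cancel_left]
    refine hD.trans ?_
    gcongr
  have h1 := h.abs_integral_energy_sub_le hl hN hg hη hδ hd hfix hδ' hd' hfix' ht htN hw hD'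
  have h2 := h.abs_integral_test_sub_le hl hN hg hδ hd hfix ht htN hw
  have hi2 := ((integrable_res_energy (N := N) (π := π) hl w).comp_fst π).const_mul ((1 + δ) ^ 2)
  rw [integral_sub (h.memLp_bias (N := N) hl w).integrable_sq hi2, integral_const_mul,
    integral_fun_fst (fun Z : Fin N → Fin n → ℝ => (res lam Finset.univ Z *ᵥ w) ⬝ᵥ
      gram Finset.univ Z *ᵥ (res lam Finset.univ Z *ᵥ w)), probReal_univ, one_smul] at h2
  set I := ∫ p : (Fin N → Fin n → ℝ) × (Fin n → ℝ), (p.2 ⬝ᵥ res lam Finset.univ p.1 *ᵥ w) ^ 2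
        ∂((Measure.pi fun _ : Fin N => π).prod π)
  set J := ∫ Z, (res lam Finset.univ Z *ᵥ w) ⬝ᵥ gram Finset.univ Z *ᵥ (res lam Finset.univ Z *ᵥ w)
        ∂(Measure.pi fun _ : Fin N => π)
  have e : lam ^ 2 * I - (1 + δ) ^ 2 / (1 - y)
      * ∑ i, lam ^ 2 / (μ i + lam * (1 + δ)) ^ 2 * a i ^ 2
      = lam ^ 2 * ((I - (1 + δ) ^ 2 * J) + (1 + δ) ^ 2 * (J - D)) := by
    have : ∑ i, lam ^ 2 / (μ i + lam * (1 + δ)) ^ 2 * a i ^ 2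
        = lam ^ 2 * ∑ i, a i ^ 2 / (μ i + lam * (1 + δ)) ^ 2 := by
      rw [Finset.mul_sum]
      exact Finset.sum_congr rfl fun i _ => by ring
    rw [this, hDdef]
    ring
  rw [e, abs_mul, abs_of_nonneg (sq_nonneg lam)]
  have h3 : |(1 + δ) ^ 2 * (J - D)| ≤ (1 + d) ^ 2
      * ((B / lam ^ 2 + 2 * (B / lam) * ((1 + d) ^ 2 / lam)) * η
        + ((lam + η) * (quadConst K (lam + η) g d B / t) + lam * (quadConst K lam g d B / t))
          / η) := by
    rw [abs_mul, abs_of_nonneg (sq_nonneg (1 + δ))]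
    gcongr
  calc lam ^ 2 * |(I - (1 + δ) ^ 2 * J) + (1 + δ) ^ 2 * (J - D)|
      ≤ lam ^ 2 * (testConst K lam g d B / t + (1 + d) ^ 2
      * ((B / lam ^ 2 + 2 * (B / lam) * ((1 + d) ^ 2 / lam)) * η
        + ((lam + η) * (quadConst K (lam + η) g d B / t) + lam * (quadConst K lam g d B / t))
          / η)) := by
        gcongr
        exact (abs_add_le _ _).trans (add_le_add h2 h3)
    _ = _ := by
        rw [biasSlope, biasConst, ← hdd]
        ring

end Equivalents

/-! ### Passing to the limit -/

section Limit

/-- Differences of size `η` cost an error of order `η`; for each fixed `η` the rest vanishes. -/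
lemma tendsto_zero_of_forall_le {a t : ℕ → ℝ} {c : ℝ} (ht : Tendsto t atTop atTop)
    (h : ∀ η : ℝ, 0 < η → ∃ C, ∀ᶠ k in atTop, |a k| ≤ c * η + C / t k) :
    Tendsto a atTop (𝓝 0) := by
  rw [Metric.tendsto_nhds]
  intro ε hε
  obtain ⟨C, hC⟩ := h (ε / (2 * (|c| + 1))) (by positivity)
  have hlim : Tendsto (fun k => C / t k) atTop (𝓝 0) := ht.const_div_atTop C
  filter_upwards [hC, hlim.eventually (gt_mem_nhds (half_pos hε))] with k h1 h2
  rw [Real.dist_eq, sub_zero]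
  have h3 : c * (ε / (2 * (|c| + 1))) ≤ ε / 2 := by
    rw [← mul_div_assoc, div_le_div_iff₀ (by positivity) (by positivity)]
    nlinarith [le_abs_self c]
  linarith

end Limit

/-! ### The reservoir -/

section Reservoir

variable {n T : ℕ} {φ : ℝ}

lemma one_le_leak (hφ : 0 < φ) (hφ1 : φ ≤ 1) (t : Fin T) : 1 ≤ φ ^ ((t : ℤ) + 1 - (T : ℤ)) :=
  one_le_zpow_of_nonpos₀ hφ hφ1 (by have := t.2; omega)

variable {R : Matrix (Fin n) (Fin T) ℝ}

/-- As `Rᵀ R` is invertible, the linear form `θᵀ u` factors through the features `R u`; the leak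
makes `R` expanding, so that the norm does not grow. -/
lemma exists_feature_weight (hφ : 0 < φ) (hφ1 : φ ≤ 1) (hR : Rᵀ * R = leakMatrix T φ) (θ : Vec T) :
    ∃ w : Fin n → ℝ, Rᵀ *ᵥ w = θ ∧ w ⬝ᵥ w ≤ ‖θ‖ ^ 2 := by
  set x : Fin T → ℝ := fun t => θ t / φ ^ ((t : ℤ) + 1 - (T : ℤ)) with hx
  have h1 : Rᵀ *ᵥ (R *ᵥ x) = θ := by
    rw [Matrix.mulVec_mulVec, hR, leakMatrix]
    ext t
    have := one_le_leak hφ hφ1 t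
    rw [Matrix.mulVec_diagonal, hx]
    field_simp
  refine ⟨R *ᵥ x, h1, ?_⟩
  rw [Matrix.dotProduct_mulVec, ← Matrix.mulVec_transpose, h1, EuclideanSpace.real_norm_sq_eq]
  refine Finset.sum_le_sum fun t _ => ?_
  have := one_le_leak hφ hφ1 t
  rw [hx, ← mul_div_assoc, ← pow_two]
  exact div_le_self (sq_nonneg _) this

variable {P : Measure (Vec T)} [IsProbabilityMeasure P] {F : Vec T → Vec n} {m : Fin n → ℝ}
  {S : Matrix (Fin n) (Fin n) ℝ} {K : ℝ}

/-- The inputs are linear images of the features, hence have second moments. -/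
lemma Concentrated.memLp_input (h : Concentrated (law P F) m S K) (hF : Measurable F)
    (hFR : ∀ u, (F u).ofLp = R *ᵥ u.ofLp) (hφ : 0 < φ) (hφ1 : φ ≤ 1)
    (hR : Rᵀ * R = leakMatrix T φ) (t : Fin T) : MemLp (fun u : Vec T => u t) 2 P := by
  have := isProbabilityMeasure_law (P := P) hF
  have h1 : MeasurePreserving (fun u => (F u).ofLp) P (law P F) := ⟨measurable_ofLp hF, rfl⟩
  obtain ⟨w, hw, -⟩ := exists_feature_weight hφ hφ1 hR (EuclideanSpace.single t (1 : ℝ))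
  have h2 := ((h.memLp_lin w).mono_exponent (by norm_num : (2 : ENNReal) ≤ 4)).comp_measurePreserving
    h1
  refine (memLp_congr_ae (ae_of_all _ fun u => ?_)).1 h2
  simp only [Function.comp, hFR]
  rw [Matrix.dotProduct_mulVec, ← Matrix.mulVec_transpose, hw]
  simp

lemma secondMoment_posSemidef (hu : ∀ t, MemLp (fun u : Vec T => u t) 2 P) :
    (secondMoment P (id : Vec T → Vec T)).PosSemidef := by
  refine psd_of_nonneg ?_ fun x => ?_
  · ext i j
    simp [secondMoment, mul_comm]
  · have hi : ∀ i j, Integrable (fun u : Vec T => u i * u j) P := fun i j =>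
      (hu i).integrable_mul (hu j)
    have e : x ⬝ᵥ secondMoment P (id : Vec T → Vec T) *ᵥ x = ∫ u, (∑ i, x i * u i) ^ 2 ∂P := by
      have e1 : ∀ u : Vec T, (∑ i, x i * u i) ^ 2 = ∑ i, ∑ j, x i * x j * (u i * u j) := by
        intro u
        rw [pow_two, Finset.sum_mul_sum]
        exact Finset.sum_congr rfl fun a _ => Finset.sum_congr rfl fun b _ => by ring
      simp only [e1]
      rw [integral_finsetSum _ fun i _ => integrable_finsetSum _ fun j _ => (hi i j).const_mul _]
      simp only [dotProduct, Matrix.mulVec, Finset.mul_sum]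
      refine Finset.sum_congr rfl fun i _ => ?_
      rw [integral_finsetSum _ fun j _ => (hi i j).const_mul _]
      refine Finset.sum_congr rfl fun j _ => ?_
      rw [integral_const_mul]
      simp only [secondMoment, Matrix.of_apply, id]
      ring
    rw [e]
    exact integral_nonneg fun u => sq_nonneg _

lemma secondMoment_feature (hu : ∀ t, MemLp (fun u : Vec T => u t) 2 P)
    (hFR : ∀ u, (F u).ofLp = R *ᵥ u.ofLp) :
    secondMoment P F = R * secondMoment P (id : Vec T → Vec T) * Rᵀ := by
  have hi : ∀ i j, Integrable (fun u : Vec T => u i * u j) P := fun i j =>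
    (hu i).integrable_mul (hu j)
  ext a b
  have e1 : ∀ u : Vec T, F u a * F u b = ∑ j, ∑ i, R a i * R b j * (u i * u j) := by
    intro u
    rw [hFR]
    simp only [Matrix.mulVec, dotProduct]
    rw [Finset.sum_mul_sum, Finset.sum_comm]
    exact Finset.sum_congr rfl fun i _ => Finset.sum_congr rfl fun j _ => by ring
  simp only [secondMoment, Matrix.of_apply, Matrix.mul_apply, Matrix.transpose_apply,
    Finset.sum_mul, id]
  simp only [e1]
  rw [integral_finsetSum _ fun i _ => integrable_finsetSum _ fun j _ => (hi j i).const_mul _]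
  refine Finset.sum_congr rfl fun j _ => ?_
  rw [integral_finsetSum _ fun i _ => (hi i j).const_mul _]
  refine Finset.sum_congr rfl fun i _ => ?_
  rw [integral_const_mul]
  ring

lemma transpose_sqrt {Su : Matrix (Fin T) (Fin T) ℝ} : (CFC.sqrt Su)ᵀ = CFC.sqrt Su :=
  psd_transpose (Matrix.nonneg_iff_posSemidef.1 (CFC.sqrt_nonneg Su))

end Reservoir

end LinearESN


open LinearESN in
theorem corollary1
    (n N T : ℕ → ℕ) (γ : ℝ) (hγ : 0 < γ)
    (hN0 : ∀ k, 0 < N k)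
    (hn : Tendsto n atTop atTop) (hN : Tendsto N atTop atTop)
    (hnN : Tendsto (fun k => (n k : ℝ) / (N k : ℝ)) atTop (𝓝 γ))
    (lam : ℝ) (hlam : 0 < lam)
    -- the reservoir and its leak factor
    (φ : ℝ) (hφ : 0 < φ) (hφ1 : φ ≤ 1)
    (W : ∀ k, Matrix (Fin (n k)) (Fin (n k)) ℝ) (wIn : ∀ k, Fin (n k) → ℝ)
    (hW : ∀ k, (responseMatrix (T k) (W k) (wIn k))ᵀ * responseMatrix (T k) (W k) (wIn k)
      = leakMatrix (T k) φ)
    -- the teacher: input law, noise law, ground truth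
    (P : ∀ k, Measure (Vec (T k))) [∀ k, IsProbabilityMeasure (P k)]
    (ν : ℕ → Measure ℝ) [∀ k, IsProbabilityMeasure (ν k)]
    (σ : ℝ) (hν2 : ∀ k, MemLp id 2 (ν k)) (hν0 : ∀ k, ∫ e, e ∂(ν k) = 0)
    (hνσ : ∀ k, ∫ e, e ^ 2 ∂(ν k) = σ ^ 2)
    (θ : ∀ k, Vec (T k)) (hθ : ∃ M : ℝ, ∀ k, ‖θ k‖ ≤ M)
    -- concentration of the feature vectors, with constants independent of the dimension
    (hconc : ∃ q C s : ℝ, 0 < q ∧ 0 < C ∧ 0 < s ∧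
      ∀ k, ExpConcentrated (P k) (feature (W k) (wIn k)) q C s)
    -- eigenpairs
    (μ : ∀ k, Fin (T k) → ℝ) (v : ∀ k, OrthonormalBasis (Fin (T k)) ℝ (Vec (T k)))
    (hv : ∀ k t, memoryMatrix φ (secondMoment (P k) id) *ᵥ (v k t) = μ k t • ⇑(v k t)) :
    ∃ δ : ℕ → ℝ,
      -- `δ k` is the unique nonnegative solution of the fixed-point equation, positive if `Σ_z ≠ 0`
      (∀ k, 0 ≤ δ k ∧ FixedPoint (N k) lam (secondMoment (P k) (feature (W k) (wIn k))) (δ k)) ∧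
      (∀ k, ∀ d : ℝ, 0 ≤ d →
        FixedPoint (N k) lam (secondMoment (P k) (feature (W k) (wIn k))) d → d = δ k) ∧
      (∀ k, secondMoment (P k) (feature (W k) (wIn k)) ≠ 0 → 0 < δ k) ∧
      -- decomposition of the risk
      (∀ k, risk (N k) (feature (W k) (wIn k)) lam (θ k) (P k) (ν k)
        = biasSq (N k) (feature (W k) (wIn k)) lam (θ k) (P k) (ν k)
          + predVariance (N k) (feature (W k) (wIn k)) lam (θ k) (P k) (ν k) + σ ^ 2) ∧
      -- asymptotic bias
      Tendsto (fun k =>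
        biasSq (N k) (feature (W k) (wIn k)) lam (θ k) (P k) (ν k)
          - (1 + δ k) ^ 2
              / (1 - alpha (N k) lam (secondMoment (P k) (feature (W k) (wIn k))) (δ k))
            * ∑ t, lam ^ 2 / (μ k t + lam * (1 + δ k)) ^ 2
                * (θ k ⬝ᵥ (CFC.sqrt (secondMoment (P k) id) *ᵥ (v k t))) ^ 2)
        atTop (𝓝 0) ∧
      -- asymptotic variance
      Tendsto (fun k =>
        predVariance (N k) (feature (W k) (wIn k)) lam (θ k) (P k) (ν k)
          - σ ^ 2
              / ((N k : ℝ)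
                * (1 - alpha (N k) lam (secondMoment (P k) (feature (W k) (wIn k))) (δ k)))
            * ∑ t, μ k t ^ 2 / (μ k t + lam * (1 + δ k)) ^ 2)
        atTop (𝓝 0) := by
  obtain ⟨q, C, s, hq, hC, hs, hcon⟩ := hconc
  obtain ⟨M, hM⟩ := hθ
  set F : ∀ k, Vec (T k) → Vec (n k) := fun k => feature (W k) (wIn k) with hF
  have hFm : ∀ k, Measurable (F k) := fun k => measurable_feature _ _
  have hFR : ∀ k, ∀ u, (F k u).ofLp = responseMatrix (T k) (W k) (wIn k) *ᵥ u.ofLp :=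
    fun k u => feature_ofLp _ _ u
  have hprob : ∀ k, IsProbabilityMeasure (law (P k) (F k)) := fun k =>
    isProbabilityMeasure_law (hFm k)
  set K := 8 * (tailConst q C s + 1)
  have hc := fun k => (hcon k).concentrated (hFm k) hq hC.le hs
  have hu := fun k => (hc k).memLp_input (hFm k) (hFR k) hφ hφ1 (hW k)
  have hSu := fun k => secondMoment_posSemidef (hu k)
  set A : ∀ k, Matrix (Fin (n k)) (Fin (T k)) ℝ := fun k =>
    responseMatrix (T k) (W k) (wIn k) * CFC.sqrt (secondMoment (P k) id) with hA
  have hAA : ∀ k, secondMoment (P k) (F k) = A k * (A k)ᵀ := by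
    intro k
    rw [secondMoment_feature (hu k) (hFR k), hA]
    simp only [Matrix.transpose_mul, transpose_sqrt]
    rw [← Matrix.mul_assoc, Matrix.mul_assoc (responseMatrix _ _ _) (CFC.sqrt _) (CFC.sqrt _),
      CFC.sqrt_mul_sqrt_self _ (Matrix.nonneg_iff_posSemidef.2 (hSu k))]
  have hAM : ∀ k, (A k)ᵀ * A k = memoryMatrix φ (secondMoment (P k) id) := by
    intro k
    rw [hA, memoryMatrix, ← hW k]
    simp only [Matrix.transpose_mul, transpose_sqrt, Matrix.mul_assoc]
  have hvA : ∀ k t, ((A k)ᵀ * A k) *ᵥ (v k t) = μ k t • ⇑(v k t) := fun k t => by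
    rw [hAM, hv]
  have hμ := fun k => eigenvalue_nonneg (hvA k)
  choose w hw hwB using fun k => exists_feature_weight hφ hφ1 (hW k) (θ k)
  have hwB' : ∀ k, w k ⬝ᵥ w k ≤ M ^ 2 := fun k =>
    (hwB k).trans (pow_le_pow_left₀ (norm_nonneg _) (hM k) 2)
  have hwθ : ∀ k, ∀ u : Vec (T k), θ k ⬝ᵥ u = w k ⬝ᵥ (F k u).ofLp := fun k u => by
    rw [hFR, Matrix.dotProduct_mulVec, ← Matrix.mulVec_transpose, hw]
  have hcoef : ∀ k t, ((A k)ᵀ *ᵥ w k) ⬝ᵥ v k t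
      = θ k ⬝ᵥ (CFC.sqrt (secondMoment (P k) id) *ᵥ (v k t)) := fun k t => by
    rw [hA]
    simp only [Matrix.transpose_mul, transpose_sqrt]
    rw [← Matrix.mulVec_mulVec, hw, mulVec_dot transpose_sqrt]
  choose δ hδ0 hδ using fun k => exists_specFixedPoint (hμ k) hlam (N k)
  have hfix : ∀ k, FixedPoint (N k) lam (A k * (A k)ᵀ) (δ k) := fun k =>
    (fixedPoint_iff (hvA k) hlam (hδ0 k)).2 (hδ k)
  have hα : ∀ k, alpha (N k) lam (A k * (A k)ᵀ) (δ k)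
      = specMix (N k) (μ k) (lam * (1 + δ k)) (lam * (1 + δ k)) := fun k =>
    alpha_eq (hvA k) hlam (N k) (hδ0 k)
  -- eventually `N ≥ 2` and `n ≤ (γ + 1) N`
  have hev : ∀ᶠ k in atTop, 2 ≤ N k ∧ (n k : ℝ) ≤ (γ + 1) * N k := by
    filter_upwards [hN.eventually_ge_atTop 2, hnN.eventually (gt_mem_nhds (lt_add_one γ))]
      with k h1 h2
    have hpos : (0 : ℝ) < N k := by exact_mod_cast hN0 k
    exact ⟨h1, ((div_lt_iff₀ hpos).1 h2).le⟩
  have hsN : Tendsto (fun k => Real.sqrt (N k)) atTop atTop :=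
    Real.tendsto_sqrt_atTop.comp (tendsto_natCast_atTop_atTop.comp hN)
  have htN : Tendsto (fun k => Real.sqrt (Real.sqrt (N k))) atTop atTop :=
    Real.tendsto_sqrt_atTop.comp hsN
  refine ⟨δ, fun k => ⟨hδ0 k, ?_⟩, fun k d hd hd2 => ?_, fun k hk => ?_, fun k => ?_, ?_, ?_⟩
  · rw [hAA]; exact hfix k
  · rw [hAA] at hd2
    exact specFixedPoint_unique (hμ k) hlam (hδ0 k) (hδ k) hd
      ((fixedPoint_iff (hvA k) hlam hd).1 hd2)
  · refine lt_of_le_of_ne (hδ0 k) fun h0 => hk ?_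
    rw [hAA]
    exact eq_zero_of_specFixedPoint_zero (hvA k) hlam (hN0 k) (by have := hδ k; rwa [← h0] at this)
  · have := hprob k
    exact risk_eq (hFm k) hlam (hwθ k) (hc k) (hν2 k) (hν0 k) (hνσ k)
  · refine tendsto_zero_of_forall_le (c := biasSlope K lam (γ + 1) (M ^ 2)) htN fun η hη =>
      ⟨biasConst K lam (γ + 1) (M ^ 2) η, ?_⟩
    filter_upwards [hev] with k hk
    have := hprob k
    have hck := hc k
    have hpos : (0 : ℝ) < N k := by exact_mod_cast hN0 k
    rw [hAA] at hck
    have key := hck.abs_bias_sub_le (hvA k) hlam hk.1 hk.2 (hδ0 k) (hfix k) hη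
      (Real.sqrt_pos.2 (Real.sqrt_pos.2 hpos))
      (by rw [show √√(N k : ℝ) ^ 4 = (√√(N k : ℝ) ^ 2) ^ 2 by ring,
        Real.sq_sqrt (Real.sqrt_nonneg _), Real.sq_sqrt hpos.le]) (hwB' k)
    rw [biasSq_eq (hFm k) hlam (hwθ k) (hν2 k) (hν0 k), hAA, hα]
    simpa only [hcoef] using key
  · refine tendsto_zero_of_forall_le (c := σ ^ 2 * (((fixedPointBound K lam (γ + 1)
      + traceConst K lam (γ + 1) (fixedPointBound K lam (γ + 1))) / lam
      + (1 + fixedPointBound K lam (γ + 1)) ^ 2 / lam))) hsN fun η hη =>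
      ⟨σ ^ 2 * (((lam + η) * traceConst K (lam + η) (γ + 1) (fixedPointBound K lam (γ + 1))
        + lam * traceConst K lam (γ + 1) (fixedPointBound K lam (γ + 1))) / η), ?_⟩
    filter_upwards [hev] with k hk
    have := hprob k
    have hck := hc k
    have hpos : (0 : ℝ) < N k := by exact_mod_cast hN0 k
    have hone : (1 : ℝ) ≤ N k := by exact_mod_cast hN0 k
    rw [hAA] at hck
    have key := hck.abs_traceEnergy_sub_le (hvA k) hlam hk.1 hk.2 (hδ0 k) (hfix k) hη
      (Real.one_le_sqrt.2 hone) (Real.sq_sqrt hpos.le).symm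
    have e : σ ^ 2 / ((N k : ℝ) * (1 - alpha (N k) lam (secondMoment (P k) (F k)) (δ k)))
          * ∑ t, μ k t ^ 2 / (μ k t + lam * (1 + δ k)) ^ 2
        = σ ^ 2 * (specMix (N k) (μ k) (lam * (1 + δ k)) (lam * (1 + δ k))
          / (1 - specMix (N k) (μ k) (lam * (1 + δ k)) (lam * (1 + δ k)))) := by
      rw [hAA, hα]
      conv_rhs => rw [mul_div_assoc', mul_comm, mul_div_assoc]
      rw [mul_comm (N k : ℝ), ← div_div]
      generalize σ ^ 2 / (1 - specMix (N k) (μ k) (lam * (1 + δ k)) (lam * (1 + δ k))) = x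
      rw [specMix]
      simp only [← pow_two]
      ring
    rw [e, predVariance_eq (hFm k) hlam (hwθ k) (hc k) (hν2 k) (hν0 k) (hνσ k), ← mul_sub, abs_mul,
      abs_of_nonneg (sq_nonneg σ)]
    exact (mul_le_mul_of_nonneg_left key (sq_nonneg σ)).trans (le_of_eq (by ring))
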